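/- Fix an integer $b\ge 1$ and work over $\mathbb{C}$. Log structures are taken on the small étale site, and $\operatorname{Spec}\mathbb{C}^\dagger$ is the standard log point, with log structure $\mathbb{N}\oplus\mathbb{C}^\times$ generated by $t\mapsto 0$. **Spaces.** Let $X_0=\bigcup_{v\in\mathbb{Z}}\mathbb{P}^1_v$ be the infinite chain of projective lines in which $0\in\mathbb{P}^1_v$ and $\infty\in\mathbb{P}^1_{v+1}$ are glued to the node $q_v$, and let $Y_0=\mathbb{A}^1_s\times X_0$. Near $q_j$ let $x_j$ be the coordinate $z$ on $\mathbb{P}^1_j$ (and $0$ on $\mathbb{P}^1_{j+1}$) and $y_j$ the coordinate $z^{-1}$ on $\mathbb{P}^1_{j+1}$ (and $0$ on $\mathbb{P}^1_j$). The log structure of $Y_0^\dagger$ is generated by $s$, $t$ (with $t\mapsto 0$) and, near $\mathbb{A}^1\times q_j$, by $s_{x_j}, s_{y_j}$ lying over $x_j,y_j$, with $s_{x_j}s_{y_j}=(st)^b$. The group $\mathbb{Z}$ acts on $Y_0^\dagger$ over $\operatorname{Spec}\mathbb{C}^\dagger$ by translations $\Phi_n$, which shift the indices by $n$ and fix $s$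 and $t$. Let $\pi:Y_0^\dagger\to\tilde T_0^\dagger$ be the quotient: $\tilde T_0=\mathbb{A}^1_s\times E$ with $E$ the projective nodal rational cubic, with the log structure of $\mathbb{Z}$-invariant sections. **Corals.** A *marked log smooth curve* $(C^\dagger/\operatorname{Spec}\mathbb{C}^\dagger,(x_1,\dots,x_l))$ is a fine saturated log scheme, log smooth and integral over $\operatorname{Spec}\mathbb{C}^\dagger$, whose underlying scheme is a reduced connected separated curve of finite type (not necessarily proper), with sections $x_i$ in the non-critical locus $U$ such that $\overline{\mathcal M}_C|_U\cong\underline{\mathbb{N}}\,\bar t\oplus\bigoplus_i x_{i*}\mathbb{N}$. A *log map* from it to $Y_0^\dagger$ or $\tilde T_0^\dagger$ is a morphism $f$ of log schemes over $\operatorname{Spec}\mathbb{C}^\dagger$ such that every non-complete irreducible component $C'$ of $C$ is isomorphic to $\mathbb{A}^1$ and $s\circ f|_{C'}$ is dominant, $s(f(x_i))=0$ for all $i$, and the group of automorphisms of $C^\dagger$ over $\operatorname{Spec}\mathbb{C}^\dagger$ that fix the $x_i$ and commute with $f$ is finite. A log map to $Y_0^\dagger$ is a *log coral* if at every non-complete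 component $C'\cong\mathbb{A}^1$, with generic point $\eta$ and function field $\mathbb{C}(z)$, it is asymptotically parallel: if $f(\eta)$ lies over the torus of some $\mathbb{P}^1_v$, then the pull-back of the coordinate of that torus has valuation $0$ at $z=\infty$; if $f(\eta)$ lies over the node $q_j$ and $f^\flat(s_{x_j})=\varphi_x t^\alpha$, $f^\flat(s_{y_j})=\varphi_y t^\beta$ at $\eta$ with $\varphi_x,\varphi_y\in\mathbb{C}(z)^\times$ and $\alpha,\beta>0$, $\alpha+\beta=b$, then $\varphi_x^\beta/\varphi_y^\alpha$ has valuation $0$ at $z=\infty$. A log map to $\tilde T_0^\dagger$ is a *log coral* if its étale-local lifts to $Y_0^\dagger$ satisfy this condition at every non-complete component. The domains of log corals have genus $0$: the complete components are projective lines, and the graph of irreducible components and their intersection points is a tree. **Theorem.** Let $\tilde f:\tilde C^\dagger\to\tilde T_0^\dagger$ be a log coral, with $\tilde C$ of genus $0$. Then there is a log coral $f:\tilde C^\dagger\to Y_0^\dagger$ with $\pi\circ f=\tilde f$ such that $$\tilde C^\dagger\times_{\tilde T_0^\dagger}Y_0^\dagger\;\cong\;\coprod_{n\in\mathbb{Z}}\tilde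 C^\dagger,$$ where on the $n$-th copy of $\tilde C^\dagger$ the projection to $\tilde C^\dagger$ is the identity and the projection to $Y_0^\dagger$ is $\Phi_n\circ f$. Moreover, every morphism of log schemes $g:\tilde C^\dagger\to Y_0^\dagger$ with $\pi\circ g=\tilde f$ is a log coral and equals $\Phi_n\circ f$ for exactly one $n\in\mathbb{Z}$. -/

import Mathlib

open CategoryTheory Limits AlgebraicGeometry

namespace TateCoral

noncomputable section

set_option linter.unusedVariables false

/-! ### The small étale site -/

/-- A scheme étale over `X`. -/
structure Et (X : Scheme.{0}) where
  S : Scheme.{0}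
  p : S ⟶ X
  [et : Etale p]

attribute [instance] Et.et

/-- Pull-back of global functions. -/
def fres {V W : Scheme.{0}} (h : W ⟶ V) : Γ(V, ⊤) →+* Γ(W, ⊤) := h.appTop.hom

lemma fres_id {V : Scheme.{0}} (a : Γ(V, ⊤)) : fres (𝟙 V) a = a := by simp [fres]

lemma fres_comp {V W Z : Scheme.{0}} (h : W ⟶ V) (k : Z ⟶ W) (a : Γ(V, ⊤)) :
    fres (k ≫ h) a = fres k (fres h a) := by
  simp only [fres, Scheme.Hom.comp_appTop]; rfl

/-- A property of étale `V`-schemes holds locally on `V` for the étale topology. -/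
def Et.Locally {X : Scheme.{0}} (V : Et X)
    (Q : ∀ (W : Et X) (h : W.S ⟶ V.S), h ≫ V.p = W.p → Prop) : Prop :=
  ∀ v : V.S, ∃ (W : Et X) (h : W.S ⟶ V.S) (w : h ≫ V.p = W.p), v ∈ Set.range h ∧ Q W h w

lemma Et.etale_hom {X : Scheme.{0}} {V W : Et X} (h : W.S ⟶ V.S) (w : h ≫ V.p = W.p) :
    Etale h := by
  have : Etale (h ≫ V.p) := by rw [w]; infer_instance
  exact Etale.of_comp h V.p

/-- The fibre product `W ×_V Z` for `W` étale over `V`, as a scheme étale over `X`. -/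
def Et.fib {X : Scheme.{0}} {V W Z : Et X} (h : W.S ⟶ V.S) (w : h ≫ V.p = W.p)
    (k : Z.S ⟶ V.S) : Et X :=
  haveI := Et.etale_hom h w
  { S := pullback h k, p := pullback.snd h k ≫ Z.p }

lemma Et.Locally.of_self {X : Scheme.{0}} {V : Et X}
    {Q : ∀ (W : Et X) (h : W.S ⟶ V.S), h ≫ V.p = W.p → Prop}
    (hQ : Q V (𝟙 _) (by simp)) : V.Locally Q :=
  fun v => ⟨V, 𝟙 _, by simp, ⟨v, by simp⟩, hQ⟩

lemma Et.Locally.pull {X : Scheme.{0}} {V : Et X}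
    {Q : ∀ (W : Et X) (h : W.S ⟶ V.S), h ≫ V.p = W.p → Prop} (hQ : V.Locally Q)
    {Z : Et X} (k : Z.S ⟶ V.S) (_ : k ≫ V.p = Z.p) :
    Z.Locally (fun W' k' _ => ∃ (W : Et X) (h : W.S ⟶ V.S) (w : h ≫ V.p = W.p)
      (l : W'.S ⟶ W.S), l ≫ h = k' ≫ k ∧ Q W h w) := by
  intro z
  obtain ⟨W, h, w, ⟨x, hx⟩, hq⟩ := hQ (k z)
  obtain ⟨y, hy1, hy2⟩ := Scheme.Pullback.exists_preimage_pullback (f := h) (g := k) x z hx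
  exact ⟨Et.fib h w k, pullback.snd h k, rfl, ⟨y, hy2⟩, W, h, w, pullback.fst h k,
    pullback.condition, hq⟩

lemma Et.Locally.bind {X : Scheme.{0}} {V : Et X}
    {Q Q' : ∀ (W : Et X) (h : W.S ⟶ V.S), h ≫ V.p = W.p → Prop} (hQ : V.Locally Q)
    (H : ∀ W h w, Q W h w → W.Locally (fun Z k wk => Q' Z (k ≫ h) (by rw [Category.assoc, w, wk]))) :
    V.Locally Q' := by
  intro v
  obtain ⟨W, h, w, ⟨x, rfl⟩, hq⟩ := hQ v
  obtain ⟨Z, k, wk, ⟨z, rfl⟩, hq'⟩ := H W h w hq x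
  exact ⟨Z, k ≫ h, _, ⟨z, by simp⟩, hq'⟩

lemma Et.Locally.mono {X : Scheme.{0}} {V : Et X}
    {Q Q' : ∀ (W : Et X) (h : W.S ⟶ V.S), h ≫ V.p = W.p → Prop} (hQ : V.Locally Q)
    (H : ∀ W h w, Q W h w → Q' W h w) : V.Locally Q' := by
  intro v
  obtain ⟨W, h, w, hx, hq⟩ := hQ v
  exact ⟨W, h, w, hx, H W h w hq⟩

/-- The sieve generated by an étale covering is a covering for the fppf topology. -/
lemma Et.Locally.sieve_mem {X : Scheme.{0}} {V : Et X}
    {Q : ∀ (W : Et X) (h : W.S ⟶ V.S), h ≫ V.p = W.p → Prop} (hQ : V.Locally Q)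
    (R : Sieve V.S) (hR : ∀ W h w, Q W h w → R h) : R ∈ Scheme.fppfTopology V.S := by
  choose W h w hx hq using hQ
  refine Scheme.fppfTopology.superset_covering
    (S := Sieve.generate (Presieve.ofArrows (fun v => (W v).S) h)) ?_ ?_
  · rw [Sieve.generate_le_iff]
    rintro _ _ ⟨v⟩
    exact hR _ _ _ (hq v)
  · refine Precoverage.generate_mem_toGrothendieck ?_
    rw [Scheme.fppfPrecoverage, Scheme.ofArrows_mem_precoverage_iff]
    refine ⟨fun x => ⟨x, hx x⟩, fun v => ?_⟩
    have := Et.etale_hom (h v) (w v)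
    exact ⟨inferInstance, inferInstance⟩

/-- Functions on `V` as morphisms to the affine line. -/
def fnEquiv (V : Scheme.{0}) : Γ(V, ⊤) ≃ (V ⟶ Spec (.of (MvPolynomial PUnit.{1} (ULift.{0} ℤ)))) :=
  (Equiv.funUnique PUnit.{1} _).symm.trans (AffineSpace.toSpecMvPolyIntEquiv PUnit.{1}).symm

lemma fnEquiv_fres {V W : Scheme.{0}} (h : W ⟶ V) (a : Γ(V, ⊤)) :
    fnEquiv W (fres h a) = h ≫ fnEquiv V a := by
  apply (AffineSpace.toSpecMvPolyIntEquiv PUnit.{1}).injective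
  funext i
  rw [AffineSpace.toSpecMvPolyIntEquiv_comp]
  simp [fnEquiv, fres, -AffineSpace.toSpecMvPolyIntEquiv_apply, -AffineSpace.toSpecMvPolyIntEquiv_symm_apply]

/-- Functions satisfy descent for the étale topology: separatedness. -/
lemma fn_sep {X : Scheme.{0}} (V : Et X) (a b : Γ(V.S, ⊤))
    (H : V.Locally (fun _ h _ => fres h a = fres h b)) : a = b := by
  let R : Sieve V.S :=
    { arrows := fun Z g => g ≫ fnEquiv _ a = g ≫ fnEquiv _ b
      downward_closed := fun h k => by simp only [Category.assoc, h] }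
  have hR := H.sieve_mem R (fun W h w e => by
    simp only [R, ← fnEquiv_fres, e])
  have := (GrothendieckTopology.Subcanonical.isSheaf_of_isRepresentable (J := Scheme.fppfTopology)
    (yoneda.obj (Spec (.of (MvPolynomial PUnit.{1} (ULift.{0} ℤ)))))).isSeparated R hR
  exact (fnEquiv _).injective (this.ext fun Z g hg => hg)

/-- Functions satisfy descent for the étale topology: gluing. -/
lemma fn_glue {X : Scheme.{0}} (V : Et X)
    (S : ∀ (W : Et X) (h : W.S ⟶ V.S), h ≫ V.p = W.p → Set Γ(W.S, ⊤))
    (hres : ∀ W h w, ∀ a ∈ S W h w, ∀ (Z : Et X) (k : Z.S ⟶ W.S) (wk : k ≫ W.p = Z.p),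
      fres k a ∈ S Z (k ≫ h) (by rw [Category.assoc, w, wk]))
    (huniq : ∀ W h w, ∀ a ∈ S W h w, ∀ b ∈ S W h w, a = b)
    (hcov : V.Locally (fun W h w => (S W h w).Nonempty)) :
    ∃ a : Γ(V.S, ⊤), ∀ W h w, ∀ b ∈ S W h w, fres h a = b := by
  let R : Sieve V.S :=
    { arrows := fun Z g => ∃ (W : Et X) (h : W.S ⟶ V.S) (w : h ≫ V.p = W.p) (l : Z ⟶ W.S),
        l ≫ h = g ∧ (S W h w).Nonempty
      downward_closed := by
        rintro Y Z f ⟨W, h, w, l, rfl, hn⟩ g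
        exact ⟨W, h, w, g ≫ l, by simp, hn⟩ }
  have hR := hcov.sieve_mem R (fun W h w e => ⟨W, h, w, 𝟙 _, by simp, e⟩)
  have key : ∀ {Z : Scheme.{0}} (W W' : Et X) (h : W.S ⟶ V.S) (h' : W'.S ⟶ V.S)
      (w : h ≫ V.p = W.p) (w' : h' ≫ V.p = W'.p) (l : Z ⟶ W.S) (l' : Z ⟶ W'.S)
      (_ : l ≫ h = l' ≫ h') (a) (_ : a ∈ S W h w) (a') (_ : a' ∈ S W' h' w'),
      fres l a = fres l' a' := by
    intro Z W W' h h' w w' l l' e a ha a' ha'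
    have h1 := hres W h w a ha (Et.fib h w h') (pullback.fst h h')
      (by simp only [Et.fib]; rw [← w, ← w', pullback.condition_assoc])
    have h2 := hres W' h' w' a' ha' (Et.fib h w h') (pullback.snd h h') rfl
    have aux : ∀ {Z : Et X} (k k' : Z.S ⟶ V.S) (_ : k = k') (wk : k ≫ V.p = Z.p)
        (wk' : k' ≫ V.p = Z.p), S Z k wk ⊆ S Z k' wk' := by
      rintro Z k _ rfl wk wk'; exact subset_rfl
    have : fres (pullback.fst h h') a = fres (pullback.snd h h') a' :=
      huniq _ _ _ _ (aux _ _ pullback.condition _ _ h1) _ h2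
    have h3 := congrArg (fres (pullback.lift l l' e)) this
    rwa [← fres_comp, ← fres_comp, pullback.lift_fst, pullback.lift_snd] at h3
  have hs := (GrothendieckTopology.Subcanonical.isSheaf_of_isRepresentable
    (J := Scheme.fppfTopology)
    (yoneda.obj (Spec (.of (MvPolynomial PUnit.{1} (ULift.{0} ℤ)))))) R hR
  have hex : ∀ (Z : Scheme.{0}) (g : Z ⟶ V.S) (_ : R g),
      ∃ y : Z ⟶ Spec (.of (MvPolynomial PUnit.{1} (ULift.{0} ℤ))), ∀ (W : Et X) (h : W.S ⟶ V.S)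
      (w : h ≫ V.p = W.p) (l : Z ⟶ W.S) (_ : l ≫ h = g) (a) (_ : a ∈ S W h w),
      y = fnEquiv Z (fres l a) := by
    rintro Z _ ⟨W₀, h₀, w₀, l₀, rfl, a₀, ha₀⟩
    exact ⟨fnEquiv Z (fres l₀ a₀), fun W h w l e a ha =>
      congrArg _ (key _ _ _ _ _ _ _ _ e.symm _ ha₀ _ ha)⟩
  choose x hx using hex
  let F : Presieve.FamilyOfElements
      (yoneda.obj (Spec (.of (MvPolynomial PUnit.{1} (ULift.{0} ℤ))))) R.arrows :=
    fun Z g hg => x Z g hg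
  obtain ⟨t, ht, -⟩ := hs F ((Presieve.compatible_iff_sieveCompatible F).2 (by
    intro Y Z f g hf
    obtain ⟨W, h, w, l, rfl, a, ha⟩ := id hf
    change x _ (g ≫ l ≫ h) _ = g ≫ x _ (l ≫ h) hf
    rw [hx _ (g ≫ l ≫ h) _ W h w (g ≫ l) (by simp) a ha, hx _ (l ≫ h) hf W h w l rfl a ha,
      fres_comp, fnEquiv_fres]))
  refine ⟨(fnEquiv _).symm t, fun W h w b hb => (fnEquiv _).injective ?_⟩
  rw [fnEquiv_fres, Equiv.apply_symm_apply]
  have h1 : h ≫ t = x _ h _ := ht h ⟨W, h, w, 𝟙 _, by simp, b, hb⟩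
  rw [h1, hx _ h _ W h w (𝟙 _) (by simp) b hb, fres_id]


/-! ### Log structures -/

/-- A presheaf of commutative monoids on the small étale site of `X`. -/
structure EtPre (X : Scheme.{0}) where
  obj : Et X → Type 1
  [inst : ∀ V, CommMonoid (obj V)]
  res : ∀ {V W : Et X} (h : W.S ⟶ V.S), h ≫ V.p = W.p → (obj V →* obj W)
  res_id : ∀ (V : Et X) (a : obj V), res (𝟙 V.S) (Category.id_comp _) a = a
  res_res : ∀ {V W Z : Et X} (h : W.S ⟶ V.S) (w : h ≫ V.p = W.p) (k : Z.S ⟶ W.S)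
    (wk : k ≫ W.p = Z.p) (wkh : (k ≫ h) ≫ V.p = Z.p) (a : obj V),
    res k wk (res h w a) = res (k ≫ h) wkh a

attribute [instance] EtPre.inst

lemma EtPre.res_eq_of {X : Scheme.{0}} (N : EtPre X) {V W Z : Et X} {a b : N.obj V}
    {h : W.S ⟶ V.S} {w : h ≫ V.p = W.p} (e : N.res h w a = N.res h w b) (l : Z.S ⟶ W.S)
    (wl : l ≫ W.p = Z.p) {k : Z.S ⟶ V.S} (ek : l ≫ h = k) (wk : k ≫ V.p = Z.p) :
    N.res k wk a = N.res k wk b := by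
  subst ek
  rw [← N.res_res h w l wl, e, N.res_res h w l wl]

/-- A pre-log structure: a presheaf of commutative monoids with a homomorphism `α` to the
multiplicative monoid of functions. -/
structure PreLog (X : Scheme.{0}) extends EtPre X where
  α : ∀ {V : Et X}, obj V →* Γ(V.S, ⊤)
  α_res : ∀ {V W : Et X} (h : W.S ⟶ V.S) (w : h ≫ V.p = W.p) (a : obj V),
    α (res h w a) = fres h (α a)

/-- A log structure on `X`: a sheaf of commutative monoids on the small étale site (the sheaf
condition is stated for covering sieves, as separatedness `sep` and gluing of matching families
`glue`) with `α : M → 𝒪_X` inducing an isomorphism `α⁻¹(𝒪_X^×) ≅ 𝒪_X^×`. -/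
structure LogStr (X : Scheme.{0}) extends PreLog X where
  unit : ∀ {V : Et X} (u : Γ(V.S, ⊤)ˣ), ∃! a : obj V, α a = u
  sep : ∀ {V : Et X} (a b : obj V), V.Locally (fun _ h w => res h w a = res h w b) → a = b
  glue : ∀ {V : Et X} (F : ∀ (W : Et X) (h : W.S ⟶ V.S), h ≫ V.p = W.p → Set (obj W)),
    (∀ W h w, ∀ a ∈ F W h w, ∀ (Z : Et X) (k : Z.S ⟶ W.S) (wk : k ≫ W.p = Z.p)
      (wkh : (k ≫ h) ≫ V.p = Z.p), res k wk a ∈ F Z (k ≫ h) wkh) →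
    (∀ W h w, ∀ a ∈ F W h w, ∀ b ∈ F W h w, a = b) →
    V.Locally (fun W h w => (F W h w).Nonempty) →
    ∃ a : obj V, ∀ W h w, ∀ b ∈ F W h w, res h w a = b

/-! ### Sheafification -/

/-- A section over `V` of the sheaf associated with `N`, given by its (saturated) system of local
representatives. -/
@[ext]
structure Sh {X : Scheme.{0}} (N : EtPre X) (V : Et X) where
  c : ∀ (W : Et X) (h : W.S ⟶ V.S), h ≫ V.p = W.p → Set (N.obj W)
  res : ∀ {W h w a}, a ∈ c W h w → ∀ {Z : Et X} (k : Z.S ⟶ W.S) (wk : k ≫ W.p = Z.p)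
    (wkh : (k ≫ h) ≫ V.p = Z.p), N.res k wk a ∈ c Z (k ≫ h) wkh
  loc : ∀ {W h w a}, W.Locally (fun Z k wk => N.res k wk a ∈ c Z (k ≫ h)
    (by rw [Category.assoc, w, wk])) → a ∈ c W h w
  eq : ∀ {W h w a b}, a ∈ c W h w → b ∈ c W h w →
    W.Locally (fun _ k wk => N.res k wk a = N.res k wk b)
  cov : V.Locally (fun W h w => (c W h w).Nonempty)

namespace Sh

variable {X : Scheme.{0}} {N : EtPre X} {V : Et X}

lemma cast (S : Sh N V) {W : Et X} {h h' : W.S ⟶ V.S} {w : h ≫ V.p = W.p} {a : N.obj W}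
    (ha : a ∈ S.c W h w) (e : h = h') (w' : h' ≫ V.p = W.p) : a ∈ S.c W h' w' := by
  subst e; exact ha

lemma ext_of_le {S T : Sh N V} (H : ∀ W h w, S.c W h w ⊆ T.c W h w) : S = T := by
  apply Sh.ext
  funext W h w
  refine (H W h w).antisymm fun a ha => S.loc ?_
  refine (S.cov.pull h w).bind fun Z k wk => ?_
  rintro ⟨W₀, h₀, w₀, l, e, b, hb⟩
  have wl : l ≫ W₀.p = Z.p := by rw [← w₀, ← wk, ← w, reassoc_of% e]
  have hb' := S.res hb l wl (by rw [Category.assoc, w₀, wl])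
  have hb'' := S.cast hb' e (by rw [Category.assoc, w, wk])
  refine (T.eq (T.res ha k wk (by rw [Category.assoc, w, wk])) (H _ _ _ hb'')).mono ?_
  intro Z' k' wk' e'
  rw [N.res_res _ _ _ _ (by rw [Category.assoc, wk, wk'])] at e'
  rw [e']
  exact S.cast (S.res hb'' k' wk' (by simp [wk', w, wk])) (by simp) _

instance : One (Sh N V) where
  one :=
    { c := fun W _ _ => {a | W.Locally (fun _ k wk => N.res k wk a = 1)}
      res := by
        intro W h w a ha Z k wk wkh
        refine (Et.Locally.pull ha k wk).mono ?_
        rintro W' k' wk' ⟨W₀, h₀, w₀, l, e, h1⟩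
        have wl : l ≫ W₀.p = W'.p := by rw [← w₀, ← wk', ← wk, reassoc_of% e]
        have := congrArg (N.res l wl) h1
        rw [N.res_res _ _ _ _ (by rw [Category.assoc, w₀, wl]), map_one] at this
        rw [N.res_res _ _ _ _ (by rw [Category.assoc, wk, wk']), ← this]
        simp only [e]
      loc := by
        intro W h w a ha
        refine Et.Locally.bind ha fun Z k wk hz => Et.Locally.mono hz ?_
        intro Z' k' wk' e
        rwa [N.res_res _ _ _ _ (by rw [Category.assoc, wk, wk'])] at e
      eq := by
        intro W h w a b ha hb
        refine Et.Locally.bind ha fun Z k wk hz => (Et.Locally.pull hb k wk).mono ?_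
        rintro W' k' wk' ⟨W₀, h₀, w₀, l, e, h1⟩
        have wl : l ≫ W₀.p = W'.p := by rw [← w₀, ← wk', ← wk, reassoc_of% e]
        have h2 := congrArg (N.res l wl) h1
        have h3 := congrArg (N.res k' wk') hz
        rw [N.res_res _ _ _ _ (by rw [Category.assoc, w₀, wl]), map_one] at h2
        rw [N.res_res _ _ _ _ (by rw [Category.assoc, wk, wk']), map_one] at h3
        simp only [e] at h2
        rw [h2, h3]
      cov := Et.Locally.of_self ⟨1, Et.Locally.of_self (map_one _)⟩ }

instance : Mul (Sh N V) where
  mul S T :=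
    { c := fun W h w => {x | W.Locally (fun Z k wk => ∃ a ∈ S.c Z (k ≫ h)
        (by rw [Category.assoc, w, wk]), ∃ b ∈ T.c Z (k ≫ h) (by rw [Category.assoc, w, wk]),
        N.res k wk x = a * b)}
      res := by
        intro W h w x hx Z k wk wkh
        refine (Et.Locally.pull hx k wk).mono ?_
        rintro W' k' wk' ⟨W₀, h₀, w₀, l, e, a, ha, b, hb, h1⟩
        have wl : l ≫ W₀.p = W'.p := by rw [← w₀, ← wk', ← wk, reassoc_of% e]
        refine ⟨_, S.cast (S.res ha l wl (by simp [wl, w, w₀])) (by simp [reassoc_of% e]) _,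
          _, T.cast (T.res hb l wl (by simp [wl, w, w₀])) (by simp [reassoc_of% e]) _, ?_⟩
        have := congrArg (N.res l wl) h1
        rw [N.res_res _ _ _ _ (by rw [Category.assoc, w₀, wl]), map_mul] at this
        rw [N.res_res _ _ _ _ (by rw [Category.assoc, wk, wk']), ← this]
        simp only [e]
      loc := by
        intro W h w x hx
        refine Et.Locally.bind hx fun Z k wk hz => Et.Locally.mono hz ?_
        rintro Z' k' wk' ⟨a, ha, b, hb, e⟩
        rw [N.res_res _ _ _ _ (by rw [Category.assoc, wk, wk'])] at e
        exact ⟨a, S.cast ha (by simp) _, b, T.cast hb (by simp) _, e⟩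
      eq := by
        intro W h w x y hx hy
        refine Et.Locally.bind hx fun Z k wk hz => (Et.Locally.pull hy k wk).bind ?_
        obtain ⟨a, ha, b, hb, h3⟩ := hz
        rintro W' k' wk' ⟨W₀, h₀, w₀, l, e, a', ha', b', hb', h1⟩
        have wl : l ≫ W₀.p = W'.p := by rw [← w₀, ← wk', ← wk, reassoc_of% e]
        have h2 := congrArg (N.res l wl) h1
        replace h3 := congrArg (N.res k' wk') h3
        rw [N.res_res _ _ _ _ (by rw [Category.assoc, w₀, wl]), map_mul] at h2
        rw [N.res_res _ _ _ _ (by rw [Category.assoc, wk, wk']), map_mul] at h3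
        simp only [e] at h2
        have wt : (k' ≫ k ≫ h) ≫ V.p = W'.p := by simp [w, wk, wk']
        have h4 := S.eq (S.cast (S.res ha k' wk' (by simp [w, wk, wk'])) (by simp) wt)
          (S.cast (S.res ha' l wl (by simp [w, w₀, wl])) (by simp [reassoc_of% e]) wt)
        have h5 := T.eq (T.cast (T.res hb k' wk' (by simp [w, wk, wk'])) (by simp) wt)
          (T.cast (T.res hb' l wl (by simp [w, w₀, wl])) (by simp [reassoc_of% e]) wt)
        refine Et.Locally.bind h4 fun Z₁ k₁ wk₁ e₁ => (Et.Locally.pull h5 k₁ wk₁).mono ?_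
        rintro W₂ k₂ wk₂ ⟨W₃, h₃, w₃, l₃, e₃, h6⟩
        have wl₃ : l₃ ≫ W₃.p = W₂.p := by rw [← w₃, ← wk₂, ← wk₁, reassoc_of% e₃]
        have wz : (k₂ ≫ k₁) ≫ W'.p = W₂.p := by simp [wk₁, wk₂]
        have h7 := N.res_eq_of h6 l₃ wl₃ e₃ wz
        have h8 := N.res_eq_of e₁ k₂ wk₂ rfl wz
        have h9 : N.res (k₂ ≫ k₁) wz (N.res (k' ≫ k) (by simp [wk, wk']) x) =
            N.res (k₂ ≫ k₁) wz (N.res (k' ≫ k) (by simp [wk, wk']) y) := by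
          rw [h3, h2, map_mul, map_mul, h7, h8]
        rw [N.res_res _ _ _ _ (by simp [wk, wk', wk₁, wk₂]),
          N.res_res _ _ _ _ (by simp [wk, wk', wk₁, wk₂])] at h9
        simpa only [Category.assoc] using h9
      cov := by
        refine S.cov.bind fun W h w ⟨a, ha⟩ => (T.cov.pull h w).mono ?_
        rintro Z k wk ⟨W₀, h₀, w₀, l, e, b, hb⟩
        have wl : l ≫ W₀.p = Z.p := by rw [← w₀, ← wk, ← w, reassoc_of% e]
        refine ⟨N.res k wk a * N.res l wl b, Et.Locally.of_self
          ⟨N.res k wk a, S.cast (S.res ha k wk (by simp [w, wk])) (by simp) _, N.res l wl b,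
            T.cast (T.res hb l wl (by simp [w₀, wl])) (by simp [e]) _, N.res_id _ _⟩⟩ }

lemma mem_mul {S T : Sh N V} {W : Et X} {h : W.S ⟶ V.S} {w : h ≫ V.p = W.p} {a b : N.obj W}
    (ha : a ∈ S.c W h w) (hb : b ∈ T.c W h w) : a * b ∈ (S * T).c W h w :=
  Et.Locally.of_self ⟨a, S.cast ha (by simp) _, b, T.cast hb (by simp) _, N.res_id _ _⟩

lemma mem_one {W : Et X} {h : W.S ⟶ V.S} {w : h ≫ V.p = W.p} :
    (1 : N.obj W) ∈ (1 : Sh N V).c W h w := Et.Locally.of_self (map_one _)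

/-- To compare two sections it is enough to compare local representatives. -/
lemma ext_local {S T : Sh N V}
    (H : V.Locally (fun W h w => ∃ a, a ∈ S.c W h w ∧ a ∈ T.c W h w)) : S = T := by
  refine ext_of_le fun W h w a ha => T.loc ?_
  refine (H.pull h w).bind ?_
  rintro Z k wk ⟨W₀, h₀, w₀, l, e, b, hb, hb'⟩
  have wl : l ≫ W₀.p = Z.p := by rw [← w₀, ← wk, ← w, reassoc_of% e]
  have wkh : (k ≫ h) ≫ V.p = Z.p := by simp [w, wk]
  have hc' := T.cast (T.res hb' l wl (by simp [w₀, wl])) e wkh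
  refine (S.eq (S.res ha k wk wkh) (S.cast (S.res hb l wl (by simp [w₀, wl])) e wkh)).mono ?_
  intro Z' k' wk' e'
  rw [N.res_res _ _ _ _ (by simp [wk, wk'])] at e'
  rw [e']
  exact T.cast (T.res hc' k' wk' (by simp [wk', w, wk])) (by simp) _

/-- Two (three) sections have representatives over a common covering. -/
lemma cov₂ (S T : Sh N V) :
    V.Locally (fun W h w => (S.c W h w).Nonempty ∧ (T.c W h w).Nonempty) := by
  refine S.cov.bind fun W h w ⟨a, ha⟩ => (T.cov.pull h w).mono ?_
  rintro Z k wk ⟨W₀, h₀, w₀, l, e, b, hb⟩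
  have wl : l ≫ W₀.p = Z.p := by rw [← w₀, ← wk, ← w, reassoc_of% e]
  exact ⟨⟨_, S.res ha k wk _⟩, ⟨_, T.cast (T.res hb l wl (by simp [w₀, wl])) e _⟩⟩

instance : CommMonoid (Sh N V) where
  mul_assoc S T U := by
    refine ext_local ((cov₂ (S * T) U).bind fun W h w ⟨_, c, hc⟩ => ((cov₂ S T).pull h w).mono ?_)
    rintro Z k wk ⟨W₀, h₀, w₀, l, e, ⟨a, ha⟩, ⟨b, hb⟩⟩
    have wl : l ≫ W₀.p = Z.p := by rw [← w₀, ← wk, ← w, reassoc_of% e]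
    have wkh : (k ≫ h) ≫ V.p = Z.p := by simp [w, wk]
    have ha := S.cast (S.res ha l wl (by simp [w₀, wl])) e wkh
    have hb := T.cast (T.res hb l wl (by simp [w₀, wl])) e wkh
    have hc := U.res hc k wk wkh
    exact ⟨_, mem_mul (mem_mul ha hb) hc, by rw [mul_assoc]; exact mem_mul ha (mem_mul hb hc)⟩
  one_mul S := ext_local (S.cov.mono fun W h w ⟨a, ha⟩ =>
    ⟨1 * a, mem_mul mem_one ha, by rwa [one_mul]⟩)
  mul_one S := ext_local (S.cov.mono fun W h w ⟨a, ha⟩ =>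
    ⟨a * 1, mem_mul ha mem_one, by rwa [mul_one]⟩)
  mul_comm S T := ext_local ((cov₂ S T).mono fun W h w ⟨⟨a, ha⟩, ⟨b, hb⟩⟩ =>
    ⟨a * b, mem_mul ha hb, by rw [mul_comm]; exact mem_mul hb ha⟩)

/-- Restriction of sections of the associated sheaf. -/
def restr (S : Sh N V) {W : Et X} (h : W.S ⟶ V.S) (w : h ≫ V.p = W.p) : Sh N W where
  c Z k wk := S.c Z (k ≫ h) (by rw [Category.assoc, w, wk])
  res ha Z k wk _ := S.cast (S.res ha k wk (by simp [*])) (by simp) _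
  loc hl := S.loc (hl.mono fun Z k wk hk => S.cast hk (by simp) _)
  eq := S.eq
  cov := (S.cov.pull h w).mono (by
    rintro Z k wk ⟨W₀, h₀, w₀, l, e, b, hb⟩
    exact ⟨_, S.cast (S.res hb l (by rw [← w₀, ← wk, ← w, reassoc_of% e])
      (by rw [e, Category.assoc, w, wk])) e _⟩)

/-- The section represented by `a`. -/
def of (a : N.obj V) : Sh N V where
  c W h w := {b | W.Locally (fun _ k wk => N.res k wk b =
    N.res (k ≫ h) (by rw [Category.assoc, w, wk]) a)}
  res := by
    intro W h w b hb Z k wk wkh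
    refine (Et.Locally.pull hb k wk).mono ?_
    rintro W' k' wk' ⟨W₀, h₀, w₀, l, e, h1⟩
    have wl : l ≫ W₀.p = W'.p := by rw [← w₀, ← wk', ← wk, reassoc_of% e]
    have := congrArg (N.res l wl) h1
    rw [N.res_res _ _ _ _ (by rw [Category.assoc, w₀, wl]),
      N.res_res _ _ _ _ (by simp [w, w₀, wl])] at this
    rw [N.res_res _ _ _ _ (by rw [Category.assoc, wk, wk'])]
    simpa only [e, reassoc_of% e] using this
  loc := by
    intro W h w b hb
    refine Et.Locally.bind hb fun Z k wk hz => Et.Locally.mono hz ?_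
    intro Z' k' wk' e
    rw [N.res_res _ _ _ _ (by rw [Category.assoc, wk, wk'])] at e
    simpa only [Category.assoc] using e
  eq := by
    intro W h w x y hx hy
    refine Et.Locally.bind hx fun Z k wk hz => (Et.Locally.pull hy k wk).mono ?_
    rintro W' k' wk' ⟨W₀, h₀, w₀, l, e, h1⟩
    have wl : l ≫ W₀.p = W'.p := by rw [← w₀, ← wk', ← wk, reassoc_of% e]
    have h2 := congrArg (N.res l wl) h1
    have h3 := congrArg (N.res k' wk') hz
    rw [N.res_res _ _ _ _ (by rw [Category.assoc, w₀, wl]),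
      N.res_res _ _ _ _ (by simp [w, w₀, wl])] at h2
    rw [N.res_res _ _ _ _ (by rw [Category.assoc, wk, wk']),
      N.res_res _ _ _ _ (by simp [w, wk, wk'])] at h3
    simp only [e, reassoc_of% e] at h2
    rw [h2, h3]
  cov := Et.Locally.of_self ⟨a, Et.Locally.of_self (by simp)⟩

lemma mem_of (a : N.obj V) {W : Et X} (h : W.S ⟶ V.S) (w : h ≫ V.p = W.p) :
    N.res h w a ∈ (of a).c W h w :=
  Et.Locally.of_self (by rw [N.res_id]; simp)

lemma of_unique {S : Sh N V} {W : Et X} {h : W.S ⟶ V.S} {w : h ≫ V.p = W.p} {a : N.obj W}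
    (ha : a ∈ S.c W h w) : S.restr h w = of a :=
  ext_local (Et.Locally.of_self ⟨a, S.cast ha (by simp) _, by
    have := mem_of a (𝟙 _) (by simp); rwa [N.res_id] at this⟩)

lemma restr_restr (S : Sh N V) {W Z : Et X} (h : W.S ⟶ V.S) (w : h ≫ V.p = W.p)
    (k : Z.S ⟶ W.S) (wk : k ≫ W.p = Z.p) (wkh : (k ≫ h) ≫ V.p = Z.p) :
    (S.restr h w).restr k wk = S.restr (k ≫ h) wkh := by
  apply Sh.ext
  funext T l wl
  exact Set.ext fun a => ⟨fun ha => S.cast ha (by simp) _, fun ha => S.cast ha (by simp) _⟩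

end Sh

/-- The presheaf of sections of the associated sheaf. -/
def EtPre.sh {X : Scheme.{0}} (N : EtPre X) : EtPre X where
  obj := Sh N
  res {V W} h w :=
    { toFun := fun S => S.restr h w
      map_one' := Sh.ext_local (Et.Locally.of_self ⟨1, Sh.mem_one, Sh.mem_one⟩)
      map_mul' := fun S T => Sh.ext_local
        (((Sh.cov₂ S T).pull h w).mono (by
          rintro Z k wk ⟨W₀, h₀, w₀, l, e, ⟨a, ha⟩, ⟨b, hb⟩⟩
          have wl : l ≫ W₀.p = Z.p := by rw [← w₀, ← wk, ← w, reassoc_of% e]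
          have wkh : (k ≫ h) ≫ V.p = Z.p := by rw [Category.assoc, w, wk]
          have ha := S.cast (S.res ha l wl (by simp [w₀, wl])) e wkh
          have hb := T.cast (T.res hb l wl (by simp [w₀, wl])) e wkh
          exact ⟨_, Sh.mem_mul ha hb, Sh.mem_mul (S := S.restr h w) (T := T.restr h w) ha hb⟩)) }
  res_id V S := by
    apply Sh.ext
    funext T l wl
    exact Set.ext fun a => ⟨fun ha => Sh.cast S ha (by simp) _, fun ha => Sh.cast S ha (by simp) _⟩
  res_res h w k wk wkh S := S.restr_restr h w k wk wkh

lemma EtPre.sh_sep {X : Scheme.{0}} (N : EtPre X) {V : Et X} (S T : N.sh.obj V)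
    (H : V.Locally (fun _ h w => N.sh.res h w S = N.sh.res h w T)) : S = T := by
  refine Sh.ext_local ((Sh.cov S).bind fun W h w ⟨a, ha⟩ => (H.pull h w).mono ?_)
  rintro Z k wk ⟨W₀, h₀, w₀, l, e, h1⟩
  have wl : l ≫ W₀.p = Z.p := by rw [← w₀, ← wk, ← w, reassoc_of% e]
  have h2 := Sh.res S ha k wk (by simp [w, wk])
  refine ⟨_, h2, ?_⟩
  have h3 : N.res k wk a ∈ (Sh.restr S h₀ w₀).c Z l wl := Sh.cast S h2 e.symm _
  change Sh.restr S h₀ w₀ = Sh.restr T h₀ w₀ at h1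
  rw [h1] at h3
  exact Sh.cast T h3 e _

lemma EtPre.sh_glue {X : Scheme.{0}} (N : EtPre X) {V : Et X}
    (F : ∀ (W : Et X) (h : W.S ⟶ V.S), h ≫ V.p = W.p → Set (N.sh.obj W))
    (hres : ∀ W h w, ∀ a ∈ F W h w, ∀ (Z : Et X) (k : Z.S ⟶ W.S) (wk : k ≫ W.p = Z.p)
      (wkh : (k ≫ h) ≫ V.p = Z.p), N.sh.res k wk a ∈ F Z (k ≫ h) wkh)
    (huniq : ∀ W h w, ∀ a ∈ F W h w, ∀ b ∈ F W h w, a = b)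
    (hcov : V.Locally (fun W h w => (F W h w).Nonempty)) :
    ∃ a : N.sh.obj V, ∀ W h w, ∀ b ∈ F W h w, N.sh.res h w a = b := by
  have hcast : ∀ {Z : Et X} {k k' : Z.S ⟶ V.S} (_ : k = k') {wk : k ≫ V.p = Z.p}
      (wk' : k' ≫ V.p = Z.p) {s}, s ∈ F Z k wk → s ∈ F Z k' wk' := by
    rintro Z k _ rfl wk wk' s hs; exact hs
  let S : Sh N V :=
    { c := fun W h w => {a | W.Locally (fun Z k wk => ∃ s ∈ F Z (k ≫ h)
        (by rw [Category.assoc, w, wk]), s = Sh.of (N.res k wk a))}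
      res := by
        intro W h w a ha Z k wk wkh
        refine (Et.Locally.pull ha k wk).mono ?_
        rintro W' k' wk' ⟨W₀, h₀, w₀, l, e, s, hs, h1⟩
        have wl : l ≫ W₀.p = W'.p := by rw [← w₀, ← wk', ← wk, reassoc_of% e]
        refine ⟨_, hcast (by simp [reassoc_of% e]) _ (hres _ _ _ s hs W' l wl (by simp [w, w₀, wl])), ?_⟩
        change Sh.restr s l wl = _
        rw [h1, Sh.of_unique (Sh.mem_of _ l wl), N.res_res _ _ _ _ (by simp [w₀, wl]),
          N.res_res _ _ _ _ (by simp [wk, wk'])]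
        simp only [e]
      loc := by
        intro W h w a ha
        refine Et.Locally.bind ha fun Z k wk hz => Et.Locally.mono hz ?_
        rintro Z' k' wk' ⟨s, hs, e⟩
        rw [N.res_res _ _ _ _ (by simp [wk, wk'])] at e
        exact ⟨s, hcast (by simp) _ hs, e⟩
      eq := by
        intro W h w x y hx hy
        refine Et.Locally.bind hx fun Z k wk hz => (Et.Locally.pull hy k wk).bind ?_
        obtain ⟨s, hs, h3⟩ := hz
        rintro W' k' wk' ⟨W₀, h₀, w₀, l, e, s', hs', h1⟩
        have wl : l ≫ W₀.p = W'.p := by rw [← w₀, ← wk', ← wk, reassoc_of% e]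
        have h4 := hres _ _ _ s hs W' k' wk' (by simp [w, wk, wk'])
        have h5 := hres _ _ _ s' hs' W' l wl (by simp [w, w₀, wl])
        have h6 := huniq _ _ _ _ (hcast (by simp) (by simp [w, wk, wk']) h4) _
          (hcast (k' := k' ≫ k ≫ h) (by simp [reassoc_of% e]) (by simp [w, wk, wk']) h5)
        change Sh.restr s k' wk' = Sh.restr s' l wl at h6
        rw [h1, h3, Sh.of_unique (Sh.mem_of _ l wl), Sh.of_unique (Sh.mem_of _ k' wk'),
          N.res_res _ _ _ _ (by simp [wk, wk']), N.res_res _ _ _ _ (by simp [w₀, wl])] at h6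
        simp only [e] at h6
        have h7 := Sh.mem_of (N.res (k' ≫ k) (by simp [wk, wk']) x) (𝟙 _) (by simp)
        have h8 := Sh.mem_of (N.res (k' ≫ k) (by simp [wk, wk']) y) (𝟙 _) (by simp)
        rw [h6] at h7
        rw [N.res_id] at h7 h8
        refine (Sh.eq _ h7 h8).mono ?_
        intro Z₂ k₂ wk₂ h9
        rw [N.res_res _ _ _ _ (by simp [wk, wk', wk₂]),
          N.res_res _ _ _ _ (by simp [wk, wk', wk₂])] at h9
        simpa only [Category.assoc] using h9
      cov := by
        refine hcov.bind fun W h w ⟨s, hs⟩ => (Sh.cov s).mono fun Z k wk ⟨a, ha⟩ => ?_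
        refine ⟨a, Et.Locally.of_self ⟨_, hcast (by simp) _ (hres _ _ _ s hs Z k wk
          (by simp [w, wk])), ?_⟩⟩
        rw [N.res_id]
        exact Sh.of_unique ha }
  refine ⟨S, fun W h w s hs => Sh.ext_local ((Sh.cov s).mono fun Z k wk ⟨a, ha⟩ => ⟨a, ?_, ha⟩)⟩
  refine Et.Locally.of_self ⟨_, hcast (by simp) _ (hres _ _ _ s hs Z k wk (by simp [w, wk])), ?_⟩
  rw [N.res_id]
  exact Sh.of_unique ha


lemma PreLog.exists_shα {X : Scheme.{0}} (N : PreLog X) {V : Et X} (S : Sh N.toEtPre V) :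
    ∃ f : Γ(V.S, ⊤), ∀ W h w, ∀ a ∈ S.c W h w, fres h f = N.α a := by
  obtain ⟨f, hf⟩ := fn_glue V (fun W h w => N.α '' S.c W h w)
    (by
      rintro W h w _ ⟨a, ha, rfl⟩ Z k wk
      exact ⟨_, S.res ha k wk _, N.α_res _ _ _⟩)
    (by
      rintro W h w _ ⟨a, ha, rfl⟩ _ ⟨b, hb, rfl⟩
      refine fn_sep W _ _ ((S.eq ha hb).mono fun Z k wk e => ?_)
      rw [← N.α_res k wk, ← N.α_res k wk, e])
    (S.cov.mono fun W h w ⟨a, ha⟩ => ⟨_, a, ha, rfl⟩)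
  exact ⟨f, fun W h w a ha => hf W h w _ ⟨a, ha, rfl⟩⟩

/-- The function defined by a section of the associated sheaf. -/
def PreLog.shα {X : Scheme.{0}} (N : PreLog X) {V : Et X} (S : Sh N.toEtPre V) : Γ(V.S, ⊤) :=
  (N.exists_shα S).choose

lemma PreLog.shα_spec {X : Scheme.{0}} (N : PreLog X) {V : Et X} (S : Sh N.toEtPre V)
    {W : Et X} {h : W.S ⟶ V.S} {w : h ≫ V.p = W.p} {a : N.obj W} (ha : a ∈ S.c W h w) :
    fres h (N.shα S) = N.α a :=
  (N.exists_shα S).choose_spec W h w a ha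

lemma PreLog.shα_one {X : Scheme.{0}} (N : PreLog X) {V : Et X} :
    N.shα (1 : Sh N.toEtPre V) = 1 :=
  fn_sep V _ _ (Et.Locally.of_self (by
    rw [N.shα_spec 1 (Sh.mem_one (w := by simp)), map_one, map_one]))

lemma PreLog.shα_mul {X : Scheme.{0}} (N : PreLog X) {V : Et X} (S T : Sh N.toEtPre V) :
    N.shα (S * T) = N.shα S * N.shα T :=
  fn_sep V _ _ ((Sh.cov₂ S T).mono fun W h w ⟨⟨a, ha⟩, ⟨b, hb⟩⟩ => by
    rw [N.shα_spec _ (Sh.mem_mul ha hb), map_mul, map_mul, N.shα_spec _ ha, N.shα_spec _ hb])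

lemma PreLog.shα_restr {X : Scheme.{0}} (N : PreLog X) {V W : Et X} (S : Sh N.toEtPre V)
    (h : W.S ⟶ V.S) (w : h ≫ V.p = W.p) : N.shα (S.restr h w) = fres h (N.shα S) := by
  refine fn_sep W _ _ ((S.restr h w).cov.mono fun Z k wk ⟨a, ha⟩ => ?_)
  rw [N.shα_spec _ ha, ← fres_comp]
  exact (N.shα_spec S ha).symm

/-- The log structure associated with a pre-log structure which already contains the units of
`𝒪_X`, by sheafification. -/
def PreLog.assoc {X : Scheme.{0}} (N : PreLog X)
    (hex : ∀ {V : Et X} (u : Γ(V.S, ⊤)ˣ), ∃ a : N.obj V, N.α a = u)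
    (huniq : ∀ {V : Et X} (a b : N.obj V), N.α a = N.α b → IsUnit (N.α a) → a = b) :
    LogStr X where
  toEtPre := N.toEtPre.sh
  α {V} :=
    { toFun := N.shα
      map_one' := N.shα_one
      map_mul' := N.shα_mul }
  α_res h w S := N.shα_restr S h w
  unit {V} u := by
    obtain ⟨a, ha⟩ := hex u
    have h1 : N.shα (Sh.of a) = u := fn_sep V _ _ (Et.Locally.of_self (by
        rw [N.shα_spec _ (Sh.mem_of a (𝟙 _) (by simp)), N.α_res, ha]))
    refine ⟨Sh.of a, h1, fun S hS => ?_⟩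
    change N.shα S = u at hS
    refine Sh.ext_local ((Sh.cov S).mono fun W h w ⟨b, hb⟩ => ⟨b, hb, ?_⟩)
    have h2 := N.shα_spec _ hb
    have h3 := N.shα_spec _ (Sh.mem_of a h w)
    rw [hS] at h2
    rw [h1] at h3
    have : b = N.res h w a := huniq _ _ (h2.symm.trans h3) (by
      rw [← h2]; exact u.isUnit.map (fres h))
    rw [this]
    exact Sh.mem_of a h w
  sep := N.toEtPre.sh_sep
  glue := N.toEtPre.sh_glue

/-! ### Log structures given by generators and relations -/

/-- A presheaf of generators `G` of a log structure, the functions `val g = α(g)`, and relations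
between products of generators. -/
structure LogPres (X : Scheme.{0}) where
  G : Et X → Type 1
  gres : ∀ {V W : Et X} (h : W.S ⟶ V.S), h ≫ V.p = W.p → G V → G W
  gres_id : ∀ (V : Et X) (g : G V), gres (𝟙 V.S) (Category.id_comp _) g = g
  gres_gres : ∀ {V W Z : Et X} (h : W.S ⟶ V.S) (w : h ≫ V.p = W.p) (k : Z.S ⟶ W.S)
    (wk : k ≫ W.p = Z.p) (wkh : (k ≫ h) ≫ V.p = Z.p) (g : G V),
    gres k wk (gres h w g) = gres (k ≫ h) wkh g
  val : ∀ {V : Et X}, G V → Γ(V.S, ⊤)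
  val_res : ∀ {V W : Et X} (h : W.S ⟶ V.S) (w : h ≫ V.p = W.p) (g : G V),
    val (gres h w g) = fres h (val g)
  rel : ∀ (V : Et X), Multiset (G V) → Multiset (G V) → Prop
  rel_res : ∀ {V W : Et X} (h : W.S ⟶ V.S) (w : h ≫ V.p = W.p) {m m' : Multiset (G V)},
    rel V m m' → rel W (m.map (gres h w)) (m'.map (gres h w))
  rel_val : ∀ {V : Et X} {m m' : Multiset (G V)},
    rel V m m' → (m.map val).prod = (m'.map val).prod

namespace LogPres

variable {X : Scheme.{0}} (R : LogPres X)

/-- The free commutative monoid on the generators times the units of `𝒪`. -/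
abbrev Free (V : Et X) : Type 1 := Multiplicative (Multiset (R.G V)) × Γ(V.S, ⊤)ˣ

/-- Besides the given relations, a generator `g` with `α(g)` invertible is identified with the
unit `α(g)`. -/
inductive Rel (V : Et X) : R.Free V → R.Free V → Prop
  | rel (m m' : Multiset (R.G V)) : R.rel V m m' →
      Rel V (Multiplicative.ofAdd m, 1) (Multiplicative.ofAdd m', 1)
  | unit (g : R.G V) (u : Γ(V.S, ⊤)ˣ) : R.val g = u → Rel V (Multiplicative.ofAdd {g}, 1) (1, u)

/-- The congruence generated by the relations. -/
def con (V : Et X) : Con (R.Free V) := conGen (R.Rel V)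

/-- The homomorphism `α` on the free monoid. -/
def freeα (V : Et X) : R.Free V →* Γ(V.S, ⊤) where
  toFun x := ((Multiplicative.toAdd x.1).map R.val).prod * x.2
  map_one' := by simp
  map_mul' x y := by simp; ring

/-- Restriction on the free monoid. -/
def freeRes {V W : Et X} (h : W.S ⟶ V.S) (w : h ≫ V.p = W.p) : R.Free V →* R.Free W where
  toFun x := (Multiplicative.ofAdd ((Multiplicative.toAdd x.1).map (R.gres h w)),
    Units.map (fres h).toMonoidHom x.2)
  map_one' := by simp
  map_mul' x y := by simp

lemma freeα_res {V W : Et X} (h : W.S ⟶ V.S) (w : h ≫ V.p = W.p) (x : R.Free V) :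
    R.freeα W (R.freeRes h w x) = fres h (R.freeα V x) := by
  simp [freeα, freeRes, Multiset.map_map, map_multiset_prod, R.val_res]

lemma con_le_α (V : Et X) : R.con V ≤ Con.ker (R.freeα V) := by
  refine Con.conGen_le.2 ?_
  rintro _ _ (⟨m, m', h⟩ | ⟨g, u, h⟩)
  · simpa [Con.ker_rel, freeα] using R.rel_val h
  · simpa [Con.ker_rel, freeα] using h

lemma con_le_res {V W : Et X} (h : W.S ⟶ V.S) (w : h ≫ V.p = W.p) :
    R.con V ≤ Con.ker ((R.con W).mk'.comp (R.freeRes h w)) := by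
  refine Con.conGen_le.2 ?_
  rintro _ _ (⟨m, m', hm⟩ | ⟨g, u, hu⟩)
  · refine (Con.eq _).2 (ConGen.Rel.of _ _ ?_)
    simpa [freeRes] using Rel.rel _ _ (R.rel_res h w hm)
  · refine (Con.eq _).2 (ConGen.Rel.of _ _ ?_)
    have := Rel.unit (R.gres h w g) (Units.map (fres h).toMonoidHom u)
      (by rw [R.val_res, hu]; rfl)
    simpa [freeRes] using this

/-- The pre-log structure with the given generators and relations. -/
def preLog : PreLog X where
  obj V := (R.con V).Quotient
  res h w := (R.con _).lift _ (R.con_le_res h w)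
  res_id V a := by
    induction a using Con.induction_on with
    | H x =>
      change ((R.freeRes (𝟙 V.S) _ x : R.Free V) : (R.con V).Quotient) = x
      congr 1
      ext1
      · simp [freeRes, R.gres_id]
      · ext; simp [freeRes, fres_id]
  res_res {V W Z} h w k wk wkh a := by
    induction a using Con.induction_on with
    | H x =>
      change ((R.freeRes k wk (R.freeRes h w x) : R.Free Z) : (R.con Z).Quotient) =
        ((R.freeRes (k ≫ h) wkh x : R.Free Z) : (R.con Z).Quotient)
      congr 1
      ext1
      · simp [freeRes, Multiset.map_map, R.gres_gres h w k wk wkh]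
      · ext; simp [freeRes, fres_comp]
  α {V} := (R.con V).lift _ (R.con_le_α V)
  α_res h w a := by
    induction a using Con.induction_on with
    | H x => exact R.freeα_res h w x

lemma eq_unit {V : Et X} (m : Multiset (R.G V)) (u : Γ(V.S, ⊤)ˣ)
    (h : (m.map R.val).prod = u) :
    R.con V (Multiplicative.ofAdd m, 1) (1, u) := by
  induction m using Multiset.induction_on generalizing u with
  | empty =>
    have : u = 1 := by ext; simpa using h.symm
    subst this
    exact (R.con V).refl _
  | cons g m ih =>
    rw [Multiset.map_cons, Multiset.prod_cons] at h
    have h1 : IsUnit (R.val g) := isUnit_of_mul_isUnit_left (h ▸ u.isUnit)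
    have h2 : IsUnit (m.map R.val).prod := isUnit_of_mul_isUnit_right (h ▸ u.isUnit)
    have h3 := (R.con V).mul (ConGen.Rel.of _ _ (Rel.unit g h1.unit rfl)) (ih h2.unit rfl)
    have h4 : u = h1.unit * h2.unit := by ext; simpa using h.symm
    rw [h4]
    simpa [Prod.mk_mul_mk, ← ofAdd_add] using h3

lemma preLog_ex {V : Et X} (u : Γ(V.S, ⊤)ˣ) : ∃ a : R.preLog.obj V, R.preLog.α a = u :=
  ⟨(((1, u) : R.Free V) : (R.con V).Quotient), by
    change R.freeα V (1, u) = u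
    simp [freeα]⟩

lemma preLog_uniq {V : Et X} (a b : R.preLog.obj V) (hab : R.preLog.α a = R.preLog.α b)
    (hu : IsUnit (R.preLog.α a)) : a = b := by
  induction a using Con.induction_on with
  | H x =>
  induction b using Con.induction_on with
  | H y =>
    have key : ∀ (x : R.Free V) (u : Γ(V.S, ⊤)ˣ), R.freeα V x = u → R.con V x (1, u) := by
      rintro ⟨m, v⟩ u h
      have h1 := R.eq_unit (Multiplicative.toAdd m) (u * v⁻¹) (by
        rw [Units.val_mul, ← h]; simp [freeα])
      have h2 := (R.con V).mul h1 ((R.con V).refl (1, v))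
      simpa using h2
    obtain ⟨u, hu⟩ := hu
    exact (Con.eq _).2 (((R.con V).trans (key x u hu.symm))
      ((R.con V).symm (key y u (hab ▸ hu.symm))))

/-- The log structure with the given generators and relations. -/
def logStr : LogStr X := R.preLog.assoc R.preLog_ex R.preLog_uniq

/-- The section defined by a generator. -/
def gen {V : Et X} (g : R.G V) : R.logStr.obj V :=
  Sh.of (N := R.preLog.toEtPre)
    ((((Multiplicative.ofAdd {g}, 1) : R.Free V) : (R.con V).Quotient) : R.preLog.obj V)

end LogPres

/-! ### Log schemes -/

/-- A homomorphism of (pre-)log structures over `f : X ⟶ Y`: compatible maps `N(U) → M(V)` for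
`V → U` over `f`; equivalently a homomorphism `f⁻¹ N → M`, compatible with `α`. -/
structure LogMap {X Y : Scheme.{0}} (N : PreLog Y) (M : PreLog X) (f : X ⟶ Y) where
  map : ∀ {U : Et Y} {V : Et X} (h : V.S ⟶ U.S), h ≫ U.p = V.p ≫ f → (N.obj U →* M.obj V)
  map_res : ∀ {U U' : Et Y} {V : Et X} (k : U'.S ⟶ U.S) (wk : k ≫ U.p = U'.p) (h : V.S ⟶ U'.S)
    (w : h ≫ U'.p = V.p ≫ f) (w' : (h ≫ k) ≫ U.p = V.p ≫ f) (a : N.obj U),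
    map h w (N.res k wk a) = map (h ≫ k) w' a
  res_map : ∀ {U : Et Y} {V V' : Et X} (h : V.S ⟶ U.S) (w : h ≫ U.p = V.p ≫ f)
    (k : V'.S ⟶ V.S) (wk : k ≫ V.p = V'.p) (w' : (k ≫ h) ≫ U.p = V'.p ≫ f) (a : N.obj U),
    M.res k wk (map h w a) = map (k ≫ h) w' a
  α_map : ∀ {U : Et Y} {V : Et X} (h : V.S ⟶ U.S) (w : h ≫ U.p = V.p ≫ f) (a : N.obj U),
    M.α (map h w a) = fres h (N.α a)

/-- The fibre product `U ×_Y X`, étale over `X`. -/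
def Et.pb {X Y : Scheme.{0}} (U : Et Y) (f : X ⟶ Y) : Et X where
  S := pullback U.p f
  p := pullback.snd U.p f

/-- The projection `U ×_Y X → U`. -/
def Et.pbFst {X Y : Scheme.{0}} (U : Et Y) (f : X ⟶ Y) : (U.pb f).S ⟶ U.S := pullback.fst U.p f

/-- The morphism to `U ×_Y X` with given components. -/
def Et.pbLift {X Y Z : Scheme.{0}} (U : Et Y) (f : X ⟶ Y) (h : Z ⟶ U.S) (k : Z ⟶ X)
    (w : h ≫ U.p = k ≫ f) : Z ⟶ (U.pb f).S := pullback.lift h k w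

section pb

variable {X Y Z : Scheme.{0}} (U : Et Y) (f : X ⟶ Y)

lemma Et.pb_cond : U.pbFst f ≫ U.p = (U.pb f).p ≫ f := pullback.condition

@[simp]
lemma Et.pbLift_fst (h : Z ⟶ U.S) (k : Z ⟶ X) (w : h ≫ U.p = k ≫ f) :
    U.pbLift f h k w ≫ U.pbFst f = h := pullback.lift_fst _ _ _

@[simp]
lemma Et.pbLift_p (h : Z ⟶ U.S) (k : Z ⟶ X) (w : h ≫ U.p = k ≫ f) :
    U.pbLift f h k w ≫ (U.pb f).p = k := pullback.lift_snd _ _ _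

@[simp]
lemma Et.pbLift_fst_assoc {T : Scheme.{0}} (h : Z ⟶ U.S) (k : Z ⟶ X) (w : h ≫ U.p = k ≫ f)
    (l : U.S ⟶ T) : U.pbLift f h k w ≫ U.pbFst f ≫ l = h ≫ l := by rw [← Category.assoc, pbLift_fst]

@[simp]
lemma Et.pbLift_p_assoc {T : Scheme.{0}} (h : Z ⟶ U.S) (k : Z ⟶ X) (w : h ≫ U.p = k ≫ f)
    (l : X ⟶ T) : U.pbLift f h k w ≫ (U.pb f).p ≫ l = k ≫ l := by rw [← Category.assoc, pbLift_p]

lemma Et.pb_ext {a b : Z ⟶ (U.pb f).S} (h₁ : a ≫ U.pbFst f = b ≫ U.pbFst f)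
    (h₂ : a ≫ (U.pb f).p = b ≫ (U.pb f).p) : a = b := pullback.hom_ext h₁ h₂

end pb

/-- A log scheme. -/
structure LogScheme where
  X : Scheme.{0}
  L : LogStr X

namespace LogScheme

/-- A morphism of log schemes. -/
structure Hom (X Y : LogScheme) where
  base : X.X ⟶ Y.X
  log : LogMap Y.L.toPreLog X.L.toPreLog base

lemma Hom.ext {X Y : LogScheme} {f g : Hom X Y} (e : f.base = g.base)
    (K : ∀ (U : Et Y.X) (V : Et X.X) (h : V.S ⟶ U.S) (w : h ≫ U.p = V.p ≫ f.base)
      (w' : h ≫ U.p = V.p ≫ g.base) (a : Y.L.obj U), f.log.map h w a = g.log.map h w' a) :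
    f = g := by
  obtain ⟨f, F⟩ := f
  obtain ⟨g, G⟩ := g
  obtain rfl : f = g := e
  have K' : @LogMap.map _ _ _ _ _ F = @LogMap.map _ _ _ _ _ G := by
    funext U V h w
    exact MonoidHom.ext fun a => K U V h w w a
  cases F
  cases G
  cases K'
  rfl

/-- The identity. -/
def Hom.id (X : LogScheme) : Hom X X where
  base := 𝟙 _
  log :=
    { map := fun h w => X.L.res h (by simpa using w)
      map_res := fun k wk h w w' a => X.L.res_res k wk h (by simpa using w) (by simpa using w') a
      res_map := fun h w k wk w' a => X.L.res_res h (by simpa using w) k wk (by simpa using w') a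
      α_map := fun h w a => X.L.α_res h (by simpa using w) a }

/-- Composition of morphisms. -/
def Hom.comp {X Y Z : LogScheme} (f : Hom X Y) (g : Hom Y Z) : Hom X Z where
  base := f.base ≫ g.base
  log :=
    { map := fun {U V} h w => (f.log.map (U.pbLift g.base h (V.p ≫ f.base) (by simpa using w))
        (U.pbLift_p _ _ _ _)).comp (g.log.map (U.pbFst g.base) (U.pb_cond g.base))
      map_res := fun {U U' V} k wk h w w' a => by
        have hk : (U'.pbFst g.base ≫ k) ≫ U.p = (U'.pb g.base).p ≫ g.base := by
          rw [Category.assoc, wk, U'.pb_cond]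
        have e1 := g.log.map_res k wk (U'.pbFst g.base) (U'.pb_cond g.base) hk a
        have e2 := g.log.res_map (U.pbFst g.base) (U.pb_cond g.base)
          (U.pbLift g.base _ _ hk) (U.pbLift_p _ _ _ _)
          (by rw [U.pbLift_fst, hk]) a
        simp only [MonoidHom.comp_apply]
        simp only [U.pbLift_fst] at e2
        rw [e1, ← e2, f.log.map_res _ _ _ _ (by simp)]
        congr 2
        apply U.pb_ext <;> simp
      res_map := fun {U V V'} h w k wk w' a => by
        simp only [MonoidHom.comp_apply]
        rw [f.log.res_map _ _ _ _ (by simp [reassoc_of% wk])]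
        congr 2
        apply U.pb_ext <;> simp [reassoc_of% wk]
      α_map := fun {U V} h w a => by
        simp only [MonoidHom.comp_apply]
        rw [f.log.α_map, g.log.α_map, ← fres_comp, U.pbLift_fst] }

lemma Hom.comp_map {X Y Z : LogScheme} (f : Hom X Y) (g : Hom Y Z) {U : Et Z.X} {W : Et Y.X}
    {V : Et X.X} (h : V.S ⟶ U.S) (w : h ≫ U.p = V.p ≫ f.base ≫ g.base) (l : V.S ⟶ W.S)
    (wl : l ≫ W.p = V.p ≫ f.base) (m : W.S ⟶ U.S) (wm : m ≫ U.p = W.p ≫ g.base)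
    (e : l ≫ m = h) (a : Z.L.obj U) :
    (f.comp g).log.map h w a = f.log.map l wl (g.log.map m wm a) := by
  subst e
  have e2 := g.log.res_map (U.pbFst g.base) (U.pb_cond g.base) (U.pbLift g.base m W.p wm)
    (U.pbLift_p _ _ _ _) (by rw [U.pbLift_fst, wm]) a
  simp only [U.pbLift_fst] at e2
  rw [← e2, f.log.map_res _ _ _ _ (by simpa using wl)]
  change f.log.map _ _ (g.log.map _ _ a) = _
  congr 2
  apply U.pb_ext <;> simp [wl]

instance : Category LogScheme where
  Hom := Hom
  id := Hom.id
  comp := Hom.comp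
  id_comp {X Y} f := Hom.ext (Category.id_comp _) (by
    intro U V h w w' a
    rw [Hom.comp_map (Hom.id X) f h w (W := V) (𝟙 _) rfl h w' (Category.id_comp _)]
    exact X.L.res_id _ _)
  comp_id {X Y} f := Hom.ext (Category.comp_id _) (by
    intro U V h w w' a
    rw [Hom.comp_map f (Hom.id Y) h w (W := U) h w' (𝟙 _) rfl (Category.comp_id _)]
    congr 1
    exact Y.L.res_id _ _)
  assoc {X Y Z T} f g k := Hom.ext (Category.assoc _ _ _) (by
    intro U V h w w' a
    have hw : h ≫ U.p = (V.p ≫ f.base ≫ g.base) ≫ k.base := by simpa [Hom.comp] using w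
    let U₁ := U.pb k.base
    let U₂ := U₁.pb g.base
    let l : V.S ⟶ U₁.S := U.pbLift k.base h (V.p ≫ f.base ≫ g.base) hw
    have wl : l ≫ U₁.p = V.p ≫ f.base ≫ g.base := U.pbLift_p _ _ _ _
    have wl' : l ≫ U₁.p = (V.p ≫ f.base) ≫ g.base := by rw [wl, Category.assoc]
    let l₂ : V.S ⟶ U₂.S := U₁.pbLift g.base l (V.p ≫ f.base) wl'
    have wl₂ : l₂ ≫ U₂.p = V.p ≫ f.base := U₁.pbLift_p _ _ _ _
    have el₂ : l₂ ≫ U₁.pbFst g.base = l := U₁.pbLift_fst _ _ _ _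
    have el : l ≫ U.pbFst k.base = h := U.pbLift_fst _ _ _ _
    have c1 := U.pb_cond k.base
    have c2 := U₁.pb_cond g.base
    have c3 : (U₁.pbFst g.base ≫ U.pbFst k.base) ≫ U.p = U₂.p ≫ g.base ≫ k.base := by
      rw [Category.assoc, c1, reassoc_of% c2]
    rw [Hom.comp_map (f.comp g) k h w (W := U₁) l wl (U.pbFst _) c1 el,
      Hom.comp_map f g (U := U₁) (W := U₂) l wl l₂ wl₂ (U₁.pbFst _) c2 el₂,
      Hom.comp_map f (g.comp k) h w' l₂ wl₂ (U₁.pbFst _ ≫ U.pbFst _) c3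
        (by rw [reassoc_of% el₂, el]),
      Hom.comp_map g k _ c3 (W := U₁) (U₁.pbFst _) c2 (U.pbFst _) c1 rfl])

@[simp] lemma id_base (X : LogScheme) : Hom.base (𝟙 X) = 𝟙 X.X := rfl
@[simp] lemma comp_base {X Y Z : LogScheme} (f : X ⟶ Y) (g : Y ⟶ Z) :
    Hom.base (f ≫ g) = f.base ≫ g.base := rfl

lemma hom_ext {X Y : LogScheme} {f g : X ⟶ Y} (e : f.base = g.base)
    (H : ∀ (U : Et Y.X) (V : Et X.X) (h : V.S ⟶ U.S) (w : h ≫ U.p = V.p ≫ f.base)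
      (w' : h ≫ U.p = V.p ≫ g.base) (a : Y.L.obj U), f.log.map h w a = g.log.map h w' a) :
    f = g := Hom.ext e H

lemma comp_map {X Y Z : LogScheme} (f : X ⟶ Y) (g : Y ⟶ Z) {U : Et Z.X} {W : Et Y.X}
    {V : Et X.X} (h : V.S ⟶ U.S) (w : h ≫ U.p = V.p ≫ f.base ≫ g.base) (l : V.S ⟶ W.S)
    (wl : l ≫ W.p = V.p ≫ f.base) (m : W.S ⟶ U.S) (wm : m ≫ U.p = W.p ≫ g.base)
    (e : l ≫ m = h) (a : Z.L.obj U) :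
    (f ≫ g).log.map h w a = f.log.map l wl (g.log.map m wm a) := Hom.comp_map f g h w l wl m wm e a

/-- An étale `V → X`, with the restricted log structure. -/
def restrict (X : LogScheme) (V : Et X.X) : LogScheme where
  X := V.S
  L :=
    { obj := fun W => X.L.obj ⟨W.S, W.p ≫ V.p⟩
      res := fun {W W'} h w => X.L.res (V := ⟨W.S, W.p ≫ V.p⟩) (W := ⟨W'.S, W'.p ≫ V.p⟩) h
        (by simp [reassoc_of% w])
      res_id := fun W a => X.L.res_id _ a
      res_res := fun h w k wk wkh a => X.L.res_res _ _ _ _ _ a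
      α := X.L.α
      α_res := fun h w a => X.L.α_res _ _ a
      unit := fun {W} u => X.L.unit (V := ⟨W.S, W.p ≫ V.p⟩) u
      sep := fun {W} a b H => X.L.sep a b (by
        intro v
        obtain ⟨W', h, w, hx, e⟩ := H v
        exact ⟨⟨W'.S, W'.p ≫ V.p⟩, h, by simp [reassoc_of% w], hx, e⟩)
      glue := fun {W} F hres huniq hcov => by
        have aux : ∀ {T : Et V.S} {l l' : T.S ⟶ W.S} (_ : l = l') {wl : l ≫ W.p = T.p}
            (wl' : l' ≫ W.p = T.p) {s}, s ∈ F T l wl → s ∈ F T l' wl' := by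
          rintro T l _ rfl _ _ s hs; exact hs
        have et : ∀ (Z : Et X.X) (k : Z.S ⟶ W.S), k ≫ W.p ≫ V.p = Z.p → Etale (k ≫ W.p) := by
          intro Z k wk
          have : Etale ((k ≫ W.p) ≫ V.p) := by rw [Category.assoc, wk]; infer_instance
          exact Etale.of_comp _ V.p
        have key : ∀ (Z : Et V.S) (k : Z.S ⟶ W.S) (wk : k ≫ W.p = Z.p) (e : Etale (k ≫ W.p)),
            ∀ s ∈ F Z k wk, X.L.res (V := ⟨Z.S, Z.p ≫ V.p⟩) (W := ⟨Z.S, (k ≫ W.p) ≫ V.p⟩) (𝟙 _)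
              (by simp [reassoc_of% wk]) s ∈ F ⟨Z.S, k ≫ W.p⟩ k rfl := by
          intro Z k wk e s hs
          exact aux (Category.id_comp _) _
            (hres Z k wk s hs ⟨Z.S, k ≫ W.p⟩ (𝟙 _) (by simp [wk]) (by simp))
        obtain ⟨a, ha⟩ := X.L.glue (V := ⟨W.S, W.p ≫ V.p⟩)
          (fun Z k wk => {s | X.L.res (V := Z)
            (W := haveI := et Z k wk; ⟨Z.S, (k ≫ W.p) ≫ V.p⟩) (𝟙 _) (by simpa using wk.symm) s ∈
              F (haveI := et Z k wk; ⟨Z.S, k ≫ W.p⟩) k rfl})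
          (by
            intro Z k wk s hs T l wl wlk
            have e₁ := et Z k wk
            have e₂ := et T (l ≫ k) wlk
            have h1 := hres ⟨Z.S, k ≫ W.p⟩ k rfl _ hs ⟨T.S, (l ≫ k) ≫ W.p⟩ l (by simp) (by simp)
            rw [X.L.res_res _ _ _ _ (by simp [← wk])] at h1
            rw [Set.mem_ofPred_eq, X.L.res_res _ _ _ _ (by simp [← wk])]
            simpa using h1)
          (by
            intro Z k wk s hs s₂ hs₂
            have e₁ := et Z k wk
            have h1 := congrArg (X.L.res (V := ⟨Z.S, (k ≫ W.p) ≫ V.p⟩) (W := Z) (𝟙 _)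
              (by simpa using wk)) (huniq _ _ _ _ hs _ hs₂)
            rw [X.L.res_res _ _ _ _ (by simp), X.L.res_res _ _ _ _ (by simp)] at h1
            simpa [X.L.res_id] using h1)
          (by
            intro v
            obtain ⟨W', h, w, hx, s, hs⟩ := hcov v
            exact ⟨⟨W'.S, W'.p ≫ V.p⟩, h, by simp [reassoc_of% w], hx, s, key W' h w _ s hs⟩)
        exact ⟨a, fun Z k wk s hs => ha ⟨Z.S, Z.p ≫ V.p⟩ k (by simp [reassoc_of% wk]) s
          (key Z k wk _ s hs)⟩ }

/-- The étale morphism `V → X`. -/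
def restrictHom (X : LogScheme) (V : Et X.X) : X.restrict V ⟶ X where
  base := (V.p : V.S ⟶ X.X)
  log :=
    { map := fun {U} {W : Et V.S} h w => X.L.res (V := U) (W := ⟨W.S, W.p ≫ V.p⟩) h w
      map_res := fun k wk h w w' a => X.L.res_res _ _ _ _ _ a
      res_map := fun h w k wk w' a => X.L.res_res _ _ _ _ _ a
      α_map := fun h w a => X.L.α_res _ _ a }

end LogScheme


/-! ### Homomorphisms out of an associated log structure -/

/-- The section defined by an invertible function. -/
def LogStr.unitSec {X : Scheme.{0}} (M : LogStr X) {V : Et X} : Γ(V.S, ⊤)ˣ →* M.obj V where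
  toFun u := (M.unit u).choose
  map_one' := (M.unit (V := V) 1).unique (M.unit (V := V) 1).choose_spec.1 (by simp)
  map_mul' u v := (M.unit (u * v)).unique (M.unit (u * v)).choose_spec.1 (by
    rw [map_mul, (M.unit u).choose_spec.1, (M.unit v).choose_spec.1, Units.val_mul])

lemma LogStr.α_unitSec {X : Scheme.{0}} (M : LogStr X) {V : Et X} (u : Γ(V.S, ⊤)ˣ) :
    M.α (M.unitSec u) = u := (M.unit u).choose_spec.1

lemma LogStr.eq_unitSec {X : Scheme.{0}} (M : LogStr X) {V : Et X} (u : Γ(V.S, ⊤)ˣ) (a : M.obj V)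
    (h : M.α a = u) : a = M.unitSec u := (M.unit u).unique h (M.α_unitSec u)

lemma Et.pb_exists {X Y : Scheme.{0}} (U : Et Y) (f : X ⟶ Y) (x : U.S) (z : X)
    (e : U.p x = f z) : ∃ y : (U.pb f).S, U.pbFst f y = x ∧ (U.pb f).p y = z := by
  obtain ⟨y, h1, h2⟩ := Scheme.Pullback.exists_preimage_pullback (f := U.p) (g := f) x z e
  exact ⟨y, h1, h2⟩

section assoc

variable {X Y : Scheme.{0}} {f : X ⟶ Y} {N : PreLog Y} {M : LogStr X}
  (φ : LogMap N M.toPreLog f) {U : Et Y} {V : Et X}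

/-- Étale coverings pull back along arbitrary morphisms. -/
lemma Et.Locally.pullback {Q : ∀ (W : Et Y) (h : W.S ⟶ U.S), h ≫ U.p = W.p → Prop}
    (hQ : U.Locally Q) (h : V.S ⟶ U.S) (w : h ≫ U.p = V.p ≫ f) :
    V.Locally (fun Z k _ => ∃ (U' : Et Y) (j : U'.S ⟶ U.S) (wj : j ≫ U.p = U'.p)
      (l : Z.S ⟶ U'.S), l ≫ j = k ≫ h ∧ l ≫ U'.p = Z.p ≫ f ∧ Q U' j wj) := by
  intro v
  obtain ⟨U', j, wj, ⟨x, hx⟩, hq⟩ := hQ (h v)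
  have := Et.etale_hom j wj
  obtain ⟨y, hy, hy'⟩ := Et.pb_exists ⟨U'.S, j⟩ h x v hx
  refine ⟨⟨(Et.pb ⟨U'.S, j⟩ h).S, (Et.pb ⟨U'.S, j⟩ h).p ≫ V.p⟩, (Et.pb ⟨U'.S, j⟩ h).p, rfl,
    ⟨y, hy'⟩, U', j, wj, Et.pbFst ⟨U'.S, j⟩ h, Et.pb_cond ⟨U'.S, j⟩ h, ?_, hq⟩
  have c := Et.pb_cond ⟨U'.S, j⟩ h
  change Et.pbFst ⟨U'.S, j⟩ h ≫ U'.p = ((Et.pb ⟨U'.S, j⟩ h).p ≫ V.p) ≫ f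
  rw [Category.assoc, ← w, ← wj, reassoc_of% c]

/-- `m` is the image of the section `S` of the associated sheaf. -/
def LogMap.IsImg (S : Sh N.toEtPre U) (h : V.S ⟶ U.S) (m : M.obj V) : Prop :=
  ∀ (Z : Et X) (k : Z.S ⟶ V.S) (wk : k ≫ V.p = Z.p) (U' : Et Y) (j : U'.S ⟶ U.S)
    (wj : j ≫ U.p = U'.p) (l : Z.S ⟶ U'.S) (wl : l ≫ U'.p = Z.p ≫ f) (e : l ≫ j = k ≫ h),
    ∀ b ∈ S.c U' j wj, M.res k wk m = φ.map l wl b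

lemma LogMap.map_eq (S : Sh N.toEtPre U) {Z : Et X} {U₁ U₂ : Et Y} {j₁ : U₁.S ⟶ U.S}
    {j₂ : U₂.S ⟶ U.S} {w₁ : j₁ ≫ U.p = U₁.p} {w₂ : j₂ ≫ U.p = U₂.p} (l₁ : Z.S ⟶ U₁.S)
    (wl₁ : l₁ ≫ U₁.p = Z.p ≫ f) (l₂ : Z.S ⟶ U₂.S) (wl₂ : l₂ ≫ U₂.p = Z.p ≫ f)
    (e : l₁ ≫ j₁ = l₂ ≫ j₂) {b₁ : N.obj U₁} {b₂ : N.obj U₂} (h₁ : b₁ ∈ S.c U₁ j₁ w₁)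
    (h₂ : b₂ ∈ S.c U₂ j₂ w₂) : φ.map l₁ wl₁ b₁ = φ.map l₂ wl₂ b₂ := by
  have := Et.etale_hom j₁ w₁
  let D : Et U.S := ⟨U₁.S, j₁⟩
  let U₃ : Et Y := ⟨(D.pb j₂).S, (D.pb j₂).p ≫ U₂.p⟩
  let q₁ : U₃.S ⟶ U₁.S := D.pbFst j₂
  let q₂ : U₃.S ⟶ U₂.S := (D.pb j₂).p
  have c : q₁ ≫ j₁ = q₂ ≫ j₂ := D.pb_cond j₂
  have wq₁ : q₁ ≫ U₁.p = U₃.p := by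
    change q₁ ≫ U₁.p = q₂ ≫ U₂.p
    rw [← w₁, ← w₂, reassoc_of% c]
  have wq₂ : q₂ ≫ U₂.p = U₃.p := rfl
  let l : Z.S ⟶ U₃.S := D.pbLift j₂ l₁ l₂ e
  have el₁ : l ≫ q₁ = l₁ := D.pbLift_fst _ _ _ _
  have el₂ : l ≫ q₂ = l₂ := D.pbLift_p _ _ _ _
  have wl : l ≫ U₃.p = Z.p ≫ f := by rw [← wq₂, reassoc_of% el₂, wl₂]
  have h₃ := S.eq (S.res h₁ q₁ wq₁ (by rw [Category.assoc, w₁, wq₁]))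
    (S.cast (S.res h₂ q₂ wq₂ (by rw [Category.assoc, w₂, wq₂])) c.symm _)
  refine M.sep _ _ ((h₃.pullback l wl).mono ?_)
  rintro Z' k wk ⟨U₄, j₄, w₄, l₄, e₄, wl₄, h₄⟩
  have e₅ := congrArg (φ.map l₄ wl₄) h₄
  have v₁ : (l₄ ≫ j₄ ≫ q₁) ≫ U₁.p = Z'.p ≫ f := by
    rw [Category.assoc, Category.assoc, wq₁, w₄, wl₄]
  have v₂ : (l₄ ≫ j₄ ≫ q₂) ≫ U₂.p = Z'.p ≫ f := by
    rw [Category.assoc, Category.assoc, wq₂, w₄, wl₄]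
  rw [N.res_res q₁ wq₁ j₄ w₄ (by rw [Category.assoc, wq₁, w₄]),
    N.res_res q₂ wq₂ j₄ w₄ (by rw [Category.assoc, wq₂, w₄]),
    φ.map_res _ _ _ _ v₁, φ.map_res _ _ _ _ v₂] at e₅
  rw [φ.res_map l₁ wl₁ k wk (by rw [Category.assoc, wl₁, ← wk, Category.assoc]),
    φ.res_map l₂ wl₂ k wk (by rw [Category.assoc, wl₂, ← wk, Category.assoc])]
  have t₁ : l₄ ≫ j₄ ≫ q₁ = k ≫ l₁ := by rw [reassoc_of% e₄, el₁]
  have t₂ : l₄ ≫ j₄ ≫ q₂ = k ≫ l₂ := by rw [reassoc_of% e₄, el₂]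
  simpa only [t₁, t₂] using e₅

lemma LogMap.img_exists (S : Sh N.toEtPre U) (h : V.S ⟶ U.S) (w : h ≫ U.p = V.p ≫ f) :
    ∃ m : M.obj V, φ.IsImg S h m := by
  obtain ⟨m, hm⟩ := M.glue (V := V) (fun Z k wk => {m | ∃ (U' : Et Y) (j : U'.S ⟶ U.S)
      (wj : j ≫ U.p = U'.p) (l : Z.S ⟶ U'.S) (wl : l ≫ U'.p = Z.p ≫ f) (e : l ≫ j = k ≫ h) (b : _)
      (hb : b ∈ S.c U' j wj), m = φ.map l wl b})
    (by
      rintro Z k wk _ ⟨U', j, wj, l, wl, e, b, hb, rfl⟩ T q wq wqk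
      exact ⟨U', j, wj, q ≫ l, by rw [Category.assoc, wl, ← wq, Category.assoc],
        by simp [e], b, hb, φ.res_map _ _ _ _ _ _⟩)
    (by
      rintro Z k wk _ ⟨U', j, wj, l, wl, e, b, hb, rfl⟩ _ ⟨U₂, j₂, wj₂, l₂, wl₂, e₂, b₂, hb₂, rfl⟩
      exact φ.map_eq S l wl l₂ wl₂ (e.trans e₂.symm) hb hb₂)
    ((S.cov.pullback h w).mono (by
      rintro Z k wk ⟨U', j, wj, l, e, wl, b, hb⟩
      exact ⟨_, U', j, wj, l, wl, e, b, hb, rfl⟩))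
  exact ⟨m, fun Z k wk U' j wj l wl e b hb => hm Z k wk _ ⟨U', j, wj, l, wl, e, b, hb, rfl⟩⟩

lemma LogMap.img_unique (S : Sh N.toEtPre U) (h : V.S ⟶ U.S) (w : h ≫ U.p = V.p ≫ f)
    {m m' : M.obj V} (hm : φ.IsImg S h m) (hm' : φ.IsImg S h m') : m = m' :=
  M.sep _ _ ((S.cov.pullback h w).mono (by
    rintro Z k wk ⟨U', j, wj, l, e, wl, b, hb⟩
    rw [hm Z k wk U' j wj l wl e b hb, hm' Z k wk U' j wj l wl e b hb]))

/-- To check that `m` is the image of `S` it is enough to do so on one covering. -/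
lemma LogMap.img_of_cov (S : Sh N.toEtPre U) (h : V.S ⟶ U.S) (w : h ≫ U.p = V.p ≫ f)
    (m : M.obj V) {Q : ∀ (W : Et Y) (h : W.S ⟶ U.S), h ≫ U.p = W.p → Prop} (hQ : U.Locally Q)
    (H : ∀ (Z : Et X) (k : Z.S ⟶ V.S) (wk : k ≫ V.p = Z.p) (U' : Et Y) (j : U'.S ⟶ U.S)
    (wj : j ≫ U.p = U'.p) (l : Z.S ⟶ U'.S) (wl : l ≫ U'.p = Z.p ≫ f) (e : l ≫ j = k ≫ h),
    Q U' j wj → ∃ b ∈ S.c U' j wj, M.res k wk m = φ.map l wl b) : φ.IsImg S h m := by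
  obtain ⟨m', hm'⟩ := φ.img_exists S h w
  have : m = m' := M.sep _ _ ((hQ.pullback h w).mono (by
    rintro Z k wk ⟨U', j, wj, l, e, wl, hq⟩
    obtain ⟨b, hb, hb'⟩ := H Z k wk U' j wj l wl e hq
    rw [hb', hm' Z k wk U' j wj l wl e b hb]))
  rwa [this]

/-- The image of a section of the associated sheaf. -/
def LogMap.img (S : Sh N.toEtPre U) (h : V.S ⟶ U.S) (w : h ≫ U.p = V.p ≫ f) : M.obj V :=
  (φ.img_exists S h w).choose

lemma LogMap.img_spec (S : Sh N.toEtPre U) (h : V.S ⟶ U.S) (w : h ≫ U.p = V.p ≫ f) :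
    φ.IsImg S h (φ.img S h w) := (φ.img_exists S h w).choose_spec

lemma LogMap.eq_img (S : Sh N.toEtPre U) (h : V.S ⟶ U.S) (w : h ≫ U.p = V.p ≫ f) {m : M.obj V}
    (hm : φ.IsImg S h m) : φ.img S h w = m := φ.img_unique S h w (φ.img_spec S h w) hm

lemma LogMap.img_one (h : V.S ⟶ U.S) (w : h ≫ U.p = V.p ≫ f) : φ.img 1 h w = 1 :=
  φ.eq_img _ h w (φ.img_of_cov _ h w _ (Sh.cov (1 : Sh N.toEtPre U))
    (fun Z k wk U' j wj l wl e _ => ⟨1, Sh.mem_one, by simp⟩))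

lemma LogMap.img_mul (S T : Sh N.toEtPre U) (h : V.S ⟶ U.S) (w : h ≫ U.p = V.p ≫ f) :
    φ.img (S * T) h w = φ.img S h w * φ.img T h w :=
  φ.eq_img _ h w (φ.img_of_cov _ h w _ (Sh.cov₂ S T)
    (fun Z k wk U' j wj l wl e ⟨⟨a, ha⟩, ⟨b, hb⟩⟩ => ⟨a * b, Sh.mem_mul ha hb, by
      rw [map_mul, map_mul, φ.img_spec S h w Z k wk U' j wj l wl e a ha,
        φ.img_spec T h w Z k wk U' j wj l wl e b hb]⟩))

lemma LogMap.img_restr {U' : Et Y} (S : Sh N.toEtPre U) (k : U'.S ⟶ U.S) (wk : k ≫ U.p = U'.p)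
    (h : V.S ⟶ U'.S) (w : h ≫ U'.p = V.p ≫ f) (w' : (h ≫ k) ≫ U.p = V.p ≫ f) :
    φ.img (S.restr k wk) h w = φ.img S (h ≫ k) w' :=
  φ.eq_img _ h w (fun Z i wi U₁ j wj l wl e b hb =>
    φ.img_spec S (h ≫ k) w' Z i wi U₁ (j ≫ k) (by rw [Category.assoc, wk, wj]) l wl
      (by rw [reassoc_of% e]) b hb)

lemma LogMap.res_img {V' : Et X} (S : Sh N.toEtPre U) (h : V.S ⟶ U.S) (w : h ≫ U.p = V.p ≫ f)
    (k : V'.S ⟶ V.S) (wk : k ≫ V.p = V'.p) (w' : (k ≫ h) ≫ U.p = V'.p ≫ f) :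
    M.res k wk (φ.img S h w) = φ.img S (k ≫ h) w' :=
  (φ.eq_img _ _ w' (fun Z i wi U₁ j wj l wl e b hb => by
    rw [M.res_res k wk i wi (by rw [Category.assoc, wk, wi])]
    exact φ.img_spec S h w Z _ _ U₁ j wj l wl (by rw [e, Category.assoc]) b hb)).symm

lemma LogMap.α_img (S : Sh N.toEtPre U) (h : V.S ⟶ U.S) (w : h ≫ U.p = V.p ≫ f) :
    M.α (φ.img S h w) = fres h (N.shα S) :=
  fn_sep V _ _ ((S.cov.pullback h w).mono (by
    rintro Z k wk ⟨U', j, wj, l, e, wl, b, hb⟩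
    rw [← M.α_res k wk, φ.img_spec S h w Z k wk U' j wj l wl e b hb, φ.α_map, ← fres_comp, ← e,
      fres_comp, N.shα_spec _ hb]))

/-- A homomorphism to a log structure extends to the associated log structure. -/
def LogMap.assoc
    (hex : ∀ {V : Et Y} (u : Γ(V.S, ⊤)ˣ), ∃ a : N.obj V, N.α a = u)
    (huniq : ∀ {V : Et Y} (a b : N.obj V), N.α a = N.α b → IsUnit (N.α a) → a = b) :
    LogMap (N.assoc hex huniq).toPreLog M.toPreLog f where
  map h w :=
    { toFun := fun S => φ.img S h w
      map_one' := φ.img_one h w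
      map_mul' := fun S T => φ.img_mul S T h w }
  map_res k wk h w w' S := φ.img_restr S k wk h w w'
  res_map h w k wk w' S := φ.res_img S h w k wk w'
  α_map h w S := φ.α_img S h w

end assoc

/-- Images of the generators of a log structure, compatible with `α` and the relations. -/
structure GenMap {X Y : Scheme.{0}} (R : LogPres Y) (M : LogStr X) (f : X ⟶ Y) where
  map : ∀ {U : Et Y} {V : Et X} (h : V.S ⟶ U.S), h ≫ U.p = V.p ≫ f → R.G U → M.obj V
  map_res : ∀ {U U' : Et Y} {V : Et X} (k : U'.S ⟶ U.S) (wk : k ≫ U.p = U'.p) (h : V.S ⟶ U'.S)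
    (w : h ≫ U'.p = V.p ≫ f) (w' : (h ≫ k) ≫ U.p = V.p ≫ f) (a : R.G U),
    map h w (R.gres k wk a) = map (h ≫ k) w' a
  res_map : ∀ {U : Et Y} {V V' : Et X} (h : V.S ⟶ U.S) (w : h ≫ U.p = V.p ≫ f)
    (k : V'.S ⟶ V.S) (wk : k ≫ V.p = V'.p) (w' : (k ≫ h) ≫ U.p = V'.p ≫ f) (a : R.G U),
    M.res k wk (map h w a) = map (k ≫ h) w' a
  α_map : ∀ {U : Et Y} {V : Et X} (h : V.S ⟶ U.S) (w : h ≫ U.p = V.p ≫ f) (a : R.G U),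
    M.α (map h w a) = fres h (R.val a)
  rel : ∀ {U : Et Y} {V : Et X} (h : V.S ⟶ U.S) (w : h ≫ U.p = V.p ≫ f) (m m' : Multiset (R.G U)),
    R.rel U m m' → (m.map (map h w)).prod = (m'.map (map h w)).prod

namespace GenMap

variable {X Y : Scheme.{0}} {R : LogPres Y} {M : LogStr X} {f : X ⟶ Y} (γ : GenMap R M f)

/-- The homomorphism on the free monoid. -/
def free {U : Et Y} {V : Et X} (h : V.S ⟶ U.S) (w : h ≫ U.p = V.p ≫ f) : R.Free U →* M.obj V where
  toFun x := ((Multiplicative.toAdd x.1).map (γ.map h w)).prod *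
    M.unitSec (Units.map (fres h).toMonoidHom x.2)
  map_one' := by simp
  map_mul' x y := by
    simp only [Prod.fst_mul, Prod.snd_mul, toAdd_mul, Multiset.map_add, Multiset.prod_add, map_mul]
    exact mul_mul_mul_comm _ _ _ _

lemma con_le {U : Et Y} {V : Et X} (h : V.S ⟶ U.S) (w : h ≫ U.p = V.p ≫ f) :
    R.con U ≤ Con.ker (γ.free h w) := by
  refine Con.conGen_le.2 ?_
  rintro _ _ (⟨m, m', hm⟩ | ⟨g, u, hu⟩)
  · simpa [Con.ker_rel, free] using γ.rel h w m m' hm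
  · have := M.eq_unitSec (Units.map (fres h).toMonoidHom u) (γ.map h w g) (by
      rw [γ.α_map, hu]; rfl)
    simpa [Con.ker_rel, free] using this

/-- The homomorphism on the presented pre-log structure. -/
def logMap : LogMap R.preLog M.toPreLog f where
  map h w := (R.con _).lift _ (γ.con_le h w)
  map_res {U U' V} k wk h w w' a := by
    induction a using Con.induction_on with
    | H x =>
      change γ.free h w (R.freeRes k wk x) = γ.free (h ≫ k) w' x
      have : Units.map (fres h).toMonoidHom (Units.map (fres k).toMonoidHom x.2) =
          Units.map (fres (h ≫ k)).toMonoidHom x.2 := by ext; simp [fres_comp]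
      simp [free, LogPres.freeRes, Multiset.map_map, γ.map_res k wk h w w']
      exact congrArg (_ * M.unitSec ·) this
  res_map {U V V'} h w k wk w' a := by
    induction a using Con.induction_on with
    | H x =>
      change M.res k wk (γ.free h w x) = γ.free (k ≫ h) w' x
      have : M.res k wk (M.unitSec (Units.map (fres h).toMonoidHom x.2)) =
          M.unitSec (Units.map (fres (k ≫ h)).toMonoidHom x.2) := M.eq_unitSec _ _ (by
        rw [M.α_res, M.α_unitSec]; simp [fres_comp])
      simp [free, map_multiset_prod, Multiset.map_map, γ.res_map h w k wk w']
      exact congrArg (_ * ·) this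
  α_map {U V} h w a := by
    induction a using Con.induction_on with
    | H x =>
      change M.α (γ.free h w x) = fres h (R.freeα U x)
      simp [free, LogPres.freeα, map_multiset_prod, Multiset.map_map, γ.α_map, M.α_unitSec]

end GenMap

/-- The log scheme with log structure given by generators and relations. -/
def LogPres.logScheme {Y : Scheme.{0}} (R : LogPres Y) : LogScheme := ⟨Y, R.logStr⟩

/-- The morphism of log schemes defined by the images of the generators. -/
def GenMap.hom {X : LogScheme} {Y : Scheme.{0}} {R : LogPres Y} {f : X.X ⟶ Y}
    (γ : GenMap R X.L f) : X ⟶ R.logScheme := LogScheme.Hom.mk f (γ.logMap.assoc R.preLog_ex R.preLog_uniq)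

/-! ### The infinite chain of projective lines and the nodal curve -/

/-- The coordinate ring `ℂ[z, z⁻¹]` of the torus. -/
abbrev RG : Type := Localization.Away (Polynomial.X : Polynomial ℂ)

/-- The coordinate `z`. -/
def zG : RG := algebraMap (Polynomial ℂ) RG Polynomial.X

/-- The coordinate ring of the torus minus the point `z = 1`. -/
abbrev RW : Type := Localization.Away (1 - zG)

/-- The coordinate `z`. -/
def zW : RW := algebraMap RG RW zG

/-- The ring `ℂ[x, y] / (x y)`. -/
abbrev RA : Type := MvPolynomial (Fin 2) ℂ ⧸ Ideal.span {(MvPolynomial.X 0 * MvPolynomial.X 1 :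
  MvPolynomial (Fin 2) ℂ)}

/-- The coordinate `x` (for `i = 0`) or `y` (for `i = 1`). -/
def xA (i : Fin 2) : RA := Ideal.Quotient.mk _ (MvPolynomial.X i)

/-- The coordinate ring of the neighbourhood `1 - x - y ≠ 0` of the node of `x y = 0`. -/
abbrev RD : Type := Localization.Away (1 - xA 0 - xA 1)

/-- The coordinate `x` (for `i = 0`) or `y` (for `i = 1`). -/
def xD (i : Fin 2) : RD := algebraMap RA RD (xA i)

/-- The coordinate ring `ℂ[X, Y] / (Y² + X Y - X³)` of the affine nodal cubic. -/
abbrev RN : Type := MvPolynomial (Fin 2) ℂ ⧸ Ideal.span {(MvPolynomial.X 1 ^ 2 +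
  MvPolynomial.X 0 * MvPolynomial.X 1 - MvPolynomial.X 0 ^ 3 : MvPolynomial (Fin 2) ℂ)}

/-- The coordinate `X` (for `i = 0`) or `Y` (for `i = 1`). -/
def xN (i : Fin 2) : RN := Ideal.Quotient.mk _ (MvPolynomial.X i)

lemma zG_unit : IsUnit zG := IsLocalization.Away.algebraMap_isUnit _
lemma one_sub_zW : IsUnit (1 - zW) := by
  have := IsLocalization.Away.algebraMap_isUnit (S := RW) (1 - zG)
  simpa [zW] using this
lemma zW_unit : IsUnit zW := zG_unit.map _
lemma xA_mul : xA 0 * xA 1 = 0 := by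
  rw [xA, xA, ← map_mul]; exact Ideal.Quotient.eq_zero_iff_mem.2 (Ideal.subset_span rfl)
lemma xD_mul : xD 0 * xD 1 = 0 := by rw [xD, xD, ← map_mul, xA_mul, map_zero]
lemma dD_unit : IsUnit (1 - xD 0 - xD 1) := by
  have := IsLocalization.Away.algebraMap_isUnit (S := RD) (1 - xA 0 - xA 1)
  simpa [xD] using this
lemma xN_rel : xN 1 ^ 2 + xN 0 * xN 1 - xN 0 ^ 3 = 0 := by
  rw [xN, xN, ← map_mul, ← map_pow, ← map_pow, ← map_add, ← map_sub]
  exact Ideal.Quotient.eq_zero_iff_mem.2 (Ideal.subset_span rfl)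

lemma eq_of_mul_eq_one' {P : Type} [CommRing P] {a b c : P} (h : a * b = 1) (h' : a * c = 1) :
    b = c := left_inv_eq_right_inv ((mul_comm _ _).trans h) h'

section lifts

variable {P : Type} [CommRing P] [Algebra ℂ P]

/-- Extension of a homomorphism to a localization. -/
def awayLift {A : Type} [CommRing A] [Algebra ℂ A] (a : A) (f : A →ₐ[ℂ] P) (h : IsUnit (f a)) :
    Localization.Away a →ₐ[ℂ] P :=
  IsLocalization.liftAlgHom (M := Submonoid.powers a) (f := f) (by
    rintro ⟨_, n, rfl⟩; simpa using h.pow n)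

@[simp]
lemma awayLift_algebraMap {A : Type} [CommRing A] [Algebra ℂ A] (a : A) (f : A →ₐ[ℂ] P)
    (h : IsUnit (f a)) (b : A) : awayLift a f h (algebraMap _ _ b) = f b := by
  simp [awayLift]

/-- The homomorphism `z ↦ u`. -/
def liftG (u : P) (hu : IsUnit u) : RG →ₐ[ℂ] P :=
  awayLift _ (Polynomial.aeval u) (by simpa using hu)

@[simp] lemma liftG_z (u : P) (hu : IsUnit u) : liftG u hu zG = u := by simp [liftG, zG]

/-- The homomorphism `z ↦ u`. -/
def liftW (u : P) (hu : IsUnit u) (hu' : IsUnit (1 - u)) : RW →ₐ[ℂ] P :=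
  awayLift _ (liftG u hu) (by simpa using hu')

@[simp] lemma liftW_z (u : P) (hu : IsUnit u) (hu' : IsUnit (1 - u)) :
    liftW u hu hu' zW = u := by simp [liftW, zW]

/-- The homomorphism from `ℂ[x, y] / (p)` with `x ↦ u`, `y ↦ v`. -/
def liftQ (p : MvPolynomial (Fin 2) ℂ) (u v : P) (h : MvPolynomial.aeval ![u, v] p = 0) :
    (MvPolynomial (Fin 2) ℂ ⧸ Ideal.span {p}) →ₐ[ℂ] P :=
  Ideal.Quotient.liftₐ _ (MvPolynomial.aeval ![u, v]) (by
    intro a ha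
    have : Ideal.span {p} ≤ RingHom.ker (MvPolynomial.aeval ![u, v]) := by
      rw [Ideal.span_singleton_le_iff_mem, RingHom.mem_ker, h]
    exact this ha)

lemma liftQ_mk (p : MvPolynomial (Fin 2) ℂ) (u v : P) (h : MvPolynomial.aeval ![u, v] p = 0)
    (i : Fin 2) : liftQ p u v h (Ideal.Quotient.mk _ (MvPolynomial.X i)) = ![u, v] i := by
  change MvPolynomial.aeval ![u, v] (MvPolynomial.X i) = _
  rw [MvPolynomial.aeval_X]

/-- The homomorphism `x ↦ u`, `y ↦ v`. -/
def liftD (u v : P) (h : u * v = 0) (hu : IsUnit (1 - u - v)) : RD →ₐ[ℂ] P :=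
  awayLift _ (liftQ _ u v (by simpa using h)) (by simpa [xA, liftQ_mk] using hu)

@[simp] lemma liftD_x (u v : P) (h : u * v = 0) (hu : IsUnit (1 - u - v)) :
    liftD u v h hu (xD 0) = u :=
  (awayLift_algebraMap _ _ _ _).trans (liftQ_mk _ _ _ _ _)
@[simp] lemma liftD_y (u v : P) (h : u * v = 0) (hu : IsUnit (1 - u - v)) :
    liftD u v h hu (xD 1) = v :=
  (awayLift_algebraMap _ _ _ _).trans (liftQ_mk _ _ _ _ _)

/-- The homomorphism `X ↦ u`, `Y ↦ v`. -/
def liftN (u v : P) (h : v ^ 2 + u * v - u ^ 3 = 0) : RN →ₐ[ℂ] P := liftQ _ u v (by simpa using h)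

@[simp] lemma liftN_x (u v : P) (h : v ^ 2 + u * v - u ^ 3 = 0) :
    liftN u v h (xN 0) = u := liftQ_mk _ _ _ _ _
@[simp] lemma liftN_y (u v : P) (h : v ^ 2 + u * v - u ^ 3 = 0) :
    liftN u v h (xN 1) = v := liftQ_mk _ _ _ _ _

lemma RG_ext {f g : RG →ₐ[ℂ] P} (h : f zG = g zG) : f = g :=
  IsLocalization.algHom_ext (Submonoid.powers (Polynomial.X : Polynomial ℂ))
    (Polynomial.algHom_ext h)

lemma RW_ext {f g : RW →ₐ[ℂ] P} (h : f zW = g zW) : f = g :=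
  IsLocalization.algHom_ext (Submonoid.powers (1 - zG)) (RG_ext h)

lemma RD_ext {f g : RD →ₐ[ℂ] P} (h : ∀ i, f (xD i) = g (xD i)) : f = g :=
  IsLocalization.algHom_ext (Submonoid.powers (1 - xA 0 - xA 1))
    (Ideal.Quotient.algHom_ext _ (MvPolynomial.algHom_ext h))

lemma RN_ext {f g : RN →ₐ[ℂ] P} (h : ∀ i, f (xN i) = g (xN i)) : f = g :=
  Ideal.Quotient.algHom_ext _ (MvPolynomial.algHom_ext h)

end lifts

/-- The morphism of spectra. -/
abbrev specMap {A B : Type} [CommRing A] [Algebra ℂ A] [CommRing B] [Algebra ℂ B] (f : A →ₐ[ℂ] B) :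
    Spec (.of B) ⟶ Spec (.of A) := Spec.map (CommRingCat.ofHom f.toRingHom)

/-- If `g` inverts `f` after localization at `a`, then `f` is an open immersion of spectra. -/
lemma specMap_openImmersion {A B : Type} [CommRing A] [Algebra ℂ A] [CommRing B] [Algebra ℂ B]
    (f : A →ₐ[ℂ] B) (a : A) (ha : IsUnit (f a)) (g : B →ₐ[ℂ] Localization.Away a)
    (h₁ : (awayLift a f ha).comp g = AlgHom.id ℂ B)
    (h₂ : g.comp f = IsScalarTower.toAlgHom ℂ A (Localization.Away a)) :
    IsOpenImmersion (specMap f) := by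
  have h₃ : g.comp (awayLift a f ha) = AlgHom.id ℂ _ :=
    IsLocalization.algHom_ext (Submonoid.powers a) (by
      refine AlgHom.ext fun b => ?_
      have := DFunLike.congr_fun h₂ b
      change g (awayLift a f ha (algebraMap A _ b)) = algebraMap A _ b
      rw [awayLift_algebraMap]
      exact this)
  let e : Localization.Away a ≃ₐ[ℂ] B := AlgEquiv.ofAlgHom (awayLift a f ha) g h₁ h₃
  have h₄ : specMap f = Spec.map (CommRingCat.ofHom e.toRingEquiv.toRingHom) ≫
      Spec.map (CommRingCat.ofHom (algebraMap A (Localization.Away a))) := by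
    rw [← Spec.map_comp, ← CommRingCat.ofHom_comp]
    refine congrArg (fun r => Spec.map (CommRingCat.ofHom r)) (RingHom.ext fun b => ?_)
    exact (awayLift_algebraMap a f ha b).symm
  have : IsIso (Spec.map (CommRingCat.ofHom e.toRingEquiv.toRingHom)) := by
    have : IsIso (CommRingCat.ofHom e.toRingEquiv.toRingHom) :=
      (RingEquiv.toCommRingCatIso e.toRingEquiv).isIso_hom
    infer_instance
  rw [h₄]
  infer_instance

/-- `W → D`, `x ↦ z`, `y ↦ 0`. -/
def φ₀ : RD →ₐ[ℂ] RW := liftD zW 0 (mul_zero _) (by simpa using one_sub_zW)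

lemma zW_inv : IsUnit (1 - ((zW_unit.unit⁻¹ : RWˣ) : RW)) := by
  have : (1 - ((zW_unit.unit⁻¹ : RWˣ) : RW)) = -(1 - zW) * ((zW_unit.unit⁻¹ : RWˣ) : RW) := by
    have := zW_unit.mul_val_inv
    linear_combination -this
  rw [this]
  exact one_sub_zW.neg.mul (Units.isUnit _)

/-- `W → D`, `x ↦ 0`, `y ↦ z⁻¹`. -/
def φ₁ : RD →ₐ[ℂ] RW := liftD 0 ((zW_unit.unit⁻¹ : RWˣ) : RW) (zero_mul _) (by
  simpa using zW_inv)

instance : IsOpenImmersion (specMap φ₀) := by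
  have hx : IsUnit (algebraMap RD (Localization.Away (xD 0)) (xD 0)) :=
    IsLocalization.Away.algebraMap_isUnit _
  have hy : algebraMap RD (Localization.Away (xD 0)) (xD 1) = 0 := by
    have := congrArg (algebraMap RD (Localization.Away (xD 0))) xD_mul
    rw [map_mul, map_zero] at this
    exact hx.mul_right_eq_zero.1 this
  have hd := dD_unit.map (algebraMap RD (Localization.Away (xD 0)))
  rw [map_sub, map_sub, map_one, hy, sub_zero] at hd
  refine specMap_openImmersion φ₀ (xD 0) (by simpa [φ₀] using zW_unit) (liftW _ hx hd) ?_ ?_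
  · exact RW_ext (by simp [φ₀])
  · refine RD_ext fun i => ?_
    fin_cases i <;> simp [φ₀, hy]

instance : IsOpenImmersion (specMap φ₁) := by
  have hx : IsUnit (algebraMap RD (Localization.Away (xD 1)) (xD 1)) :=
    IsLocalization.Away.algebraMap_isUnit _
  have hy : algebraMap RD (Localization.Away (xD 1)) (xD 0) = 0 := by
    have := congrArg (algebraMap RD (Localization.Away (xD 1))) xD_mul
    rw [map_mul, map_zero] at this
    exact hx.mul_left_eq_zero.1 this
  have hd := dD_unit.map (algebraMap RD (Localization.Away (xD 1)))
  rw [map_sub, map_sub, map_one, hy, sub_zero] at hd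
  have hd' : IsUnit (1 - ((hx.unit⁻¹ : _ˣ) : Localization.Away (xD 1))) := by
    have e : 1 - ((hx.unit⁻¹ : _ˣ) : Localization.Away (xD 1)) =
        -(1 - algebraMap RD (Localization.Away (xD 1)) (xD 1)) *
          ((hx.unit⁻¹ : _ˣ) : Localization.Away (xD 1)) := by
      have := hx.mul_val_inv
      linear_combination -this
    rw [e]
    exact hd.neg.mul (Units.isUnit _)
  refine specMap_openImmersion φ₁ (xD 1) (by simp [φ₁]) (liftW _ (Units.isUnit hx.unit⁻¹) hd') ?_ ?_
  · refine RW_ext (eq_of_mul_eq_one' (a := φ₁ (xD 1)) ?_ (by simp [φ₁]))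
    have h1 : IsUnit (φ₁ (xD 1)) := by simp [φ₁]
    have h2 := awayLift_algebraMap (xD 1) φ₁ h1 (xD 1)
    have h3 := congrArg (awayLift (xD 1) φ₁ h1) hx.mul_val_inv
    rw [map_mul, map_one, h2] at h3
    rw [AlgHom.comp_apply, liftW_z]
    exact h3
  · refine RD_ext fun i => ?_
    fin_cases i
    · simp [φ₁, hy]
    · refine eq_of_mul_eq_one' (a := liftW _ (Units.isUnit hx.unit⁻¹) hd' zW) ?_ ?_
      · change _ * liftW _ (Units.isUnit hx.unit⁻¹) hd' (φ₁ (xD 1)) = 1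
        rw [← map_mul]
        simp [φ₁]
      · rw [liftW_z]
        exact hx.val_inv_mul

/-- The homomorphism `W → N`, `X ↦ z / (1 - z)²`, `Y ↦ z² / (1 - z)³`. -/
def ψW : RN →ₐ[ℂ] RW :=
  liftN (zW * ((one_sub_zW.unit⁻¹ : RWˣ) : RW) ^ 2) (zW ^ 2 * ((one_sub_zW.unit⁻¹ : RWˣ) : RW) ^ 3)
    (by
      have h := one_sub_zW.mul_val_inv
      set i := ((one_sub_zW.unit⁻¹ : RWˣ) : RW)
      have h' : zW * i = i - 1 := by linear_combination -h
      linear_combination (zW ^ 3 * i ^ 5) * h')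

/-- The homomorphism `D → N`, `X ↦ (x + y) / d²`, `Y ↦ (x² - y) / d³` with `d = 1 - x - y`. -/
def ψD : RN →ₐ[ℂ] RD :=
  liftN ((xD 0 + xD 1) * ((dD_unit.unit⁻¹ : RDˣ) : RD) ^ 2)
    ((xD 0 ^ 2 - xD 1) * ((dD_unit.unit⁻¹ : RDˣ) : RD) ^ 3) (by
      have h := dD_unit.mul_val_inv
      have h0 := xD_mul
      set i := ((dD_unit.unit⁻¹ : RDˣ) : RD)
      have e : (xD 0 ^ 2 - xD 1) ^ 2 + (xD 0 + xD 1) * (xD 0 ^ 2 - xD 1) * (1 - xD 0 - xD 1) -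
          (xD 0 + xD 1) ^ 3 = 0 := by
        linear_combination (-3 * xD 0 - xD 1 - 2 * xD 0 ^ 2 - xD 0 * xD 1 - 1) * h0
      linear_combination i ^ 6 * e - (xD 0 + xD 1) * (xD 0 ^ 2 - xD 1) * i ^ 5 * h)

instance : IsOpenImmersion (specMap ψW) := by
  let j := algebraMap RN (Localization.Away (xN 0))
  have hX : IsUnit (j (xN 0)) := IsLocalization.Away.algebraMap_isUnit _
  have hr : j (xN 1) * (j (xN 0) + j (xN 1)) = j (xN 0) ^ 3 := by
    have := congrArg j xN_rel
    rw [map_sub, map_add, map_pow, map_pow, map_mul, map_zero] at this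
    linear_combination this
  have hY : IsUnit (j (xN 1)) := isUnit_of_mul_isUnit_left (hr ▸ hX.pow 3)
  have hXY : IsUnit (j (xN 0) + j (xN 1)) := isUnit_of_mul_isUnit_right (hr ▸ hX.pow 3)
  have hi := hXY.mul_val_inv
  set i := ((hXY.unit⁻¹ : (Localization.Away (xN 0))ˣ) : Localization.Away (xN 0)) with hidef
  have hz : IsUnit (j (xN 1) * i) := hY.mul (Units.isUnit _)
  have e1 : 1 - j (xN 1) * i = j (xN 0) * i := by linear_combination -hi
  have hz' : IsUnit (1 - j (xN 1) * i) := e1 ▸ hX.mul (Units.isUnit _)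
  have hw := one_sub_zW.mul_val_inv
  set w := ((one_sub_zW.unit⁻¹ : RWˣ) : RW) with hwdef
  have hψX : ψW (xN 0) = zW * w ^ 2 := liftN_x _ _ _
  have hψY : ψW (xN 1) = zW ^ 2 * w ^ 3 := liftN_y _ _ _
  have hu : IsUnit (ψW (xN 0)) := hψX ▸ zW_unit.mul ((Units.isUnit _).pow 2)
  refine specMap_openImmersion ψW (xN 0) hu (liftW _ hz hz') ?_ ?_
  · refine RW_ext ?_
    have hj : ∀ a, awayLift (xN 0) ψW hu (j a) = ψW a := awayLift_algebraMap (xN 0) ψW hu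
    have h3 := congrArg (awayLift (xN 0) ψW hu) hi
    rw [map_mul, map_one, map_add, hj, hj, hψX, hψY] at h3
    rw [AlgHom.comp_apply, liftW_z, map_mul, hj, hψY]
    change _ = zW
    have e2 : zW * w ^ 2 + zW ^ 2 * w ^ 3 = zW * w ^ 3 := by
      linear_combination (-zW * w ^ 2) * hw
    rw [e2] at h3
    linear_combination zW * h3
  · have hg := congrArg (liftW _ hz hz') hw
    rw [map_mul, map_sub, map_one, liftW_z, e1] at hg
    set v := liftW _ hz hz' w with hv
    have e3 : j (xN 0) * v = j (xN 0) + j (xN 1) := by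
      linear_combination (j (xN 0) + j (xN 1)) * hg - j (xN 0) * v * hi
    set X := j (xN 0)
    set Y := j (xN 1)
    refine RN_ext fun k => (hX.pow 3).mul_left_cancel ?_
    fin_cases k
    · change X ^ 3 * liftW _ hz hz' (ψW (xN 0)) = X ^ 3 * X
      rw [hψX, map_mul, liftW_z, map_pow, ← hv]
      linear_combination (X * Y * i * (X * v + (X + Y))) * e3 + (X * Y * (X + Y)) * hi + X * hr
    · change X ^ 3 * liftW _ hz hz' (ψW (xN 1)) = X ^ 3 * Y
      rw [hψY, map_mul, map_pow, liftW_z, map_pow, ← hv]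
      linear_combination (Y ^ 2 * i ^ 2 * ((X * v) ^ 2 + X * v * (X + Y) + (X + Y) ^ 2)) * e3 +
        (Y ^ 2 * (X + Y) * (i * (X + Y) + 1)) * hi + Y * hr

/-- `D → N` and `W → N` agree on the two branches. -/
lemma φ₀_ψD : φ₀.comp ψD = ψW := by
  have h := congrArg φ₀ dD_unit.mul_val_inv
  have h' := one_sub_zW.mul_val_inv
  have hx : φ₀ (xD 0) = zW := liftD_x _ _ _ _
  have hy : φ₀ (xD 1) = 0 := liftD_y _ _ _ _
  rw [map_mul, map_sub, map_sub, map_one, hx, hy, sub_zero] at h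
  have e := eq_of_mul_eq_one' h h'
  refine RN_ext fun k => ?_
  fin_cases k
  · change φ₀ (ψD (xN 0)) = ψW (xN 0)
    rw [ψD, ψW, liftN_x, liftN_x, map_mul, map_add, map_pow, hx, hy, e, add_zero]
  · change φ₀ (ψD (xN 1)) = ψW (xN 1)
    rw [ψD, ψW, liftN_y, liftN_y, map_mul, map_sub, map_pow, map_pow, hx, hy, e, sub_zero]

lemma φ₁_ψD : φ₁.comp ψD = ψW := by
  have h := congrArg φ₁ dD_unit.mul_val_inv
  have h' := one_sub_zW.mul_val_inv
  have hz := zW_unit.mul_val_inv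
  set i := ((zW_unit.unit⁻¹ : RWˣ) : RW) with hi
  have hx : φ₁ (xD 0) = 0 := liftD_x _ _ _ _
  have hy : φ₁ (xD 1) = i := liftD_y _ _ _ _
  rw [map_mul, map_sub, map_sub, map_one, hx, hy, sub_zero] at h
  set w := ((one_sub_zW.unit⁻¹ : RWˣ) : RW) with hw
  set v := φ₁ ((dD_unit.unit⁻¹ : RDˣ) : RD) with hv
  have e : v = -zW * w := eq_of_mul_eq_one' h (by linear_combination h' + w * hz)
  refine RN_ext fun k => ?_
  fin_cases k
  · change φ₁ (ψD (xN 0)) = ψW (xN 0)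
    rw [ψD, ψW, liftN_x, liftN_x, map_mul, map_add, map_pow, hx, hy, ← hv, ← hw, e]
    linear_combination (zW * w ^ 2) * hz
  · change φ₁ (ψD (xN 1)) = ψW (xN 1)
    rw [ψD, ψW, liftN_y, liftN_y, map_mul, map_sub, map_pow, map_pow, hx, hy, ← hv, ← hw, e]
    linear_combination (zW ^ 2 * w ^ 3) * hz

/-- The cells of the chain of projective lines: neighbourhoods of the nodes, the tori in the
components, and their overlaps. The component `v` joins the node `v - 1` (at `z = ∞`) and the node
`v` (at `z = 0`). -/
inductive Cell
  | node (j : ℤ)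
  | comp (v : ℤ)
  | overlap (v : ℤ)

namespace Cell

/-- Inclusions of cells. -/
def Le : Cell → Cell → Prop
  | node j, node j' => j = j'
  | comp v, comp v' => v = v'
  | overlap v, overlap v' => v = v'
  | overlap v, comp v' => v = v'
  | overlap v, node j => j = v ∨ j = v - 1
  | _, _ => False

instance : Preorder Cell where
  le := Le
  le_refl a := by cases a <;> rfl
  le_trans a b c := by
    cases a <;> cases b <;> cases c <;> simp only [Le] <;> intros <;> subst_vars <;> simp_all

/-- The scheme attached to a cell. -/
def sch : Cell → Scheme.{0}
  | node _ => Spec (.of RD)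
  | comp _ => Spec (.of RG)
  | overlap _ => Spec (.of RW)

/-- The torus minus a point in the torus. -/
def wg : RG →ₐ[ℂ] RW := IsScalarTower.toAlgHom ℂ RG RW

instance : IsOpenImmersion (specMap wg) :=
  inferInstanceAs (IsOpenImmersion (Spec.map (CommRingCat.ofHom (algebraMap RG RW))))

/-- The open immersion attached to an inclusion of cells: near the node `v` the component `v` is
the branch `y = 0` with `x = z`, near the node `v - 1` it is the branch `x = 0` with `y = z⁻¹`. -/
def incl : ∀ (a b : Cell), a ≤ b → (a.sch ⟶ b.sch)
  | node _, node _, _ => 𝟙 (Spec (.of RD))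
  | comp _, comp _, _ => 𝟙 (Spec (.of RG))
  | overlap _, overlap _, _ => 𝟙 (Spec (.of RW))
  | overlap _, comp _, _ => specMap wg
  | overlap v, node j, _ => if j = v then specMap φ₀ else specMap φ₁
  | node _, comp _, h => h.elim
  | node _, overlap _, h => h.elim
  | comp _, node _, h => h.elim
  | comp _, overlap _, h => h.elim

/-- The diagram of cells. -/
def diag : Cell ⥤ Scheme.{0} where
  obj := sch
  map {a b} f := incl a b (leOfHom f)
  map_id a := by cases a <;> rfl
  map_comp {a b c} f g := by
    have h1 := leOfHom f
    have h2 := leOfHom g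
    generalize leOfHom (f ≫ g) = h3
    revert h1 h2 h3
    cases a <;> cases b <;> cases c <;> intro h1 h2 h3 <;> try exact h1.elim
    all_goals try exact h2.elim
    · exact (Category.comp_id _).symm
    · exact (Category.comp_id _).symm
    · obtain rfl : _ = _ := h2
      exact (Category.comp_id _).symm
    · exact (Category.comp_id _).symm
    · obtain rfl : _ = _ := h1
      exact (Category.id_comp _).symm
    · exact (Category.id_comp _).symm
    · exact (Category.comp_id _).symm

instance {a b : Cell} (f : a ⟶ b) : IsOpenImmersion (diag.map f) := by
  change IsOpenImmersion (incl a b (leOfHom f))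
  generalize leOfHom f = h
  revert h
  cases a <;> cases b <;> intro h <;> try exact h.elim
  all_goals try exact inferInstanceAs (IsOpenImmersion (𝟙 (Spec _)))
  · rename_i v j
    change IsOpenImmersion (if j = v then specMap φ₀ else specMap φ₁)
    split_ifs <;> infer_instance
  · exact inferInstanceAs (IsOpenImmersion (specMap wg))

/-- The two branches of the node are disjoint away from the node. -/
lemma disj (a b : Spec (.of RW)) (h : specMap φ₀ a = specMap φ₁ b) : False := by
  have hx : xD 0 ∉ (specMap φ₀ a).asIdeal := fun hm => by
    have : φ₀ (xD 0) ∈ a.asIdeal := hm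
    rw [φ₀, liftD_x] at this
    exact a.2.ne_top (Ideal.eq_top_of_isUnit_mem _ this zW_unit)
  have hy : xD 1 ∉ (specMap φ₁ b).asIdeal := fun hm => by
    have : φ₁ (xD 1) ∈ b.asIdeal := hm
    rw [φ₁, liftD_y] at this
    exact b.2.ne_top (Ideal.eq_top_of_isUnit_mem _ this (Units.isUnit _))
  rw [← h] at hy
  have h0 : xD 0 * xD 1 ∈ (specMap φ₀ a).asIdeal := by rw [xD_mul]; exact Ideal.zero_mem _
  exact ((specMap φ₀ a).2.mem_or_mem h0).elim hx hy

instance : (diag ⋙ Scheme.forget).IsLocallyDirected where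
  cond {a b c} f g x y e := by
    have key : a ≤ b ∨ b ≤ a := by
      have h1 := leOfHom f
      have h2 := leOfHom g
      change incl a c h1 x = incl b c h2 y at e
      revert e x y h1 h2
      cases a <;> cases b <;> cases c <;> intro x y h1 h2 e <;>
        first | exact h1.elim | exact h2.elim | skip
      case overlap.overlap.node v v' j =>
        have h1 : j = v ∨ j = v - 1 := h1
        have h2 : j = v' ∨ j = v' - 1 := h2
        change (if j = v then specMap φ₀ else specMap φ₁) x =
          (if j = v' then specMap φ₀ else specMap φ₁) y at e
        left
        change v = v'
        split_ifs at e with h3 h4 h5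
        · omega
        · exact (disj x y e).elim
        · exact (disj y x e.symm).elim
        · omega
      all_goals
        simp only [LE.le, Le] at h1 h2 ⊢
        omega
    have inj : ∀ {a b : Cell} (f : a ⟶ b), Function.Injective ((diag ⋙ Scheme.forget).map f) :=
      fun f => (diag.map f).isOpenEmbedding.injective
    rcases key with h | h
    · refine ⟨a, 𝟙 _, homOfLE h, x, by simp, inj g ?_⟩
      rw [← e, ← ConcreteCategory.comp_apply, ← Functor.map_comp]
      rfl
    · refine ⟨b, homOfLE h, 𝟙 _, y, inj f ?_, by simp⟩
      rw [e, ← ConcreteCategory.comp_apply, ← Functor.map_comp]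
      rfl

end Cell

/-- The infinite chain of projective lines, glued from its cells. -/
def X₀ : Scheme.{0} := colimit Cell.diag

/-- The open immersion of the neighbourhood of a node. -/
def ιD (j : ℤ) : Spec (.of RD) ⟶ X₀ := colimit.ι Cell.diag (Cell.node j)

/-- The open immersion of the torus of a component. -/
def ιG (v : ℤ) : Spec (.of RG) ⟶ X₀ := colimit.ι Cell.diag (Cell.comp v)

instance (j : ℤ) : IsOpenImmersion (ιD j) :=
  inferInstanceAs (IsOpenImmersion (colimit.ι Cell.diag (Cell.node j)))

instance (v : ℤ) : IsOpenImmersion (ιG v) :=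
  inferInstanceAs (IsOpenImmersion (colimit.ι Cell.diag (Cell.comp v)))

lemma glue₀ (v : ℤ) : specMap φ₀ ≫ ιD v = specMap Cell.wg ≫ ιG v := by
  have h1 := colimit.w Cell.diag (homOfLE (show Cell.overlap v ≤ Cell.node v from (Or.inl rfl)))
  have h2 := colimit.w Cell.diag (homOfLE (show Cell.overlap v ≤ Cell.comp v from rfl))
  have h3 : Cell.diag.map (homOfLE (show Cell.overlap v ≤ Cell.node v from Or.inl rfl)) =
    specMap φ₀ := if_pos rfl
  rw [h3] at h1
  exact h1.trans h2.symm

lemma glue₁ (v : ℤ) : specMap φ₁ ≫ ιD (v - 1) = specMap Cell.wg ≫ ιG v := by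
  have h1 := colimit.w Cell.diag (homOfLE (show Cell.overlap v ≤ Cell.node (v - 1) from (Or.inr rfl)))
  have h2 := colimit.w Cell.diag (homOfLE (show Cell.overlap v ≤ Cell.comp v from rfl))
  have h3 : Cell.diag.map (homOfLE (show Cell.overlap v ≤ Cell.node (v - 1) from Or.inr rfl)) =
    specMap φ₁ := if_neg (by omega)
  rw [h3] at h1
  exact h1.trans h2.symm

/-- Morphisms out of the chain. -/
def descX {T : Scheme.{0}} (d : ℤ → (Spec (.of RD) ⟶ T)) (g : ℤ → (Spec (.of RG) ⟶ T))
    (h₀ : ∀ v, specMap φ₀ ≫ d v = specMap Cell.wg ≫ g v)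
    (h₁ : ∀ v, specMap φ₁ ≫ d (v - 1) = specMap Cell.wg ≫ g v) : X₀ ⟶ T :=
  colimit.desc Cell.diag
    { pt := T
      ι :=
        { app := fun c => match c with
            | .node j => d j
            | .comp v => g v
            | .overlap v => specMap Cell.wg ≫ g v
          naturality := by
            intro a b f
            have h := leOfHom f
            refine Eq.trans ?_ (Category.comp_id _).symm
            change Cell.incl a b h ≫ _ = _
            revert h
            cases a <;> cases b <;> intro h <;> first | exact h.elim | skip
            · obtain rfl : _ = _ := h
              exact Category.id_comp _
            · obtain rfl : _ = _ := h
              exact Category.id_comp _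
            · rename_i v j
              change (if j = v then specMap φ₀ else specMap φ₁) ≫ d j = specMap Cell.wg ≫ g v
              split_ifs with hj
              · rw [hj, h₀]
              · obtain rfl : j = v - 1 := h.resolve_left hj
                exact h₁ v
            · obtain rfl : _ = _ := h
              rfl
            · obtain rfl : _ = _ := h
              exact Category.id_comp _ } }

lemma ιD_descX {T : Scheme.{0}} (d : ℤ → (Spec (.of RD) ⟶ T)) (g : ℤ → (Spec (.of RG) ⟶ T))
    (h₀ h₁) (j : ℤ) : ιD j ≫ descX d g h₀ h₁ = d j := colimit.ι_desc _ _

lemma ιG_descX {T : Scheme.{0}} (d : ℤ → (Spec (.of RD) ⟶ T)) (g : ℤ → (Spec (.of RG) ⟶ T))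
    (h₀ h₁) (v : ℤ) : ιG v ≫ descX d g h₀ h₁ = g v := colimit.ι_desc _ _

lemma X₀_ext {T : Scheme.{0}} {a b : X₀ ⟶ T} (hD : ∀ j, ιD j ≫ a = ιD j ≫ b)
    (hG : ∀ v, ιG v ≫ a = ιG v ≫ b) : a = b := by
  refine colimit.hom_ext fun c => ?_
  cases c with
  | node j => exact hD j
  | comp v => exact hG v
  | overlap v =>
    have h2 := colimit.w Cell.diag (homOfLE (show Cell.overlap v ≤ Cell.comp v from rfl))
    have h3 : Cell.diag.map (homOfLE (show Cell.overlap v ≤ Cell.comp v from rfl)) ≫ ιG v ≫ a =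
      Cell.diag.map (homOfLE (show Cell.overlap v ≤ Cell.comp v from rfl)) ≫ ιG v ≫ b :=
      congrArg _ (hG v)
    have h4 : ∀ a : X₀ ⟶ T, Cell.diag.map (homOfLE (show Cell.overlap v ≤ Cell.comp v from rfl)) ≫
        ιG v ≫ a = colimit.ι Cell.diag (Cell.overlap v) ≫ a := fun a =>
      (Category.assoc _ _ _).symm.trans (congrArg (· ≫ a) h2)
    exact (h4 a).symm.trans (h3.trans (h4 b))

/-- Translation by `n` on the chain. -/
def shiftX (n : ℤ) : X₀ ⟶ X₀ :=
  descX (fun j => ιD (j + n)) (fun v => ιG (v + n)) (fun v => glue₀ (v + n)) (fun v => by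
    have := glue₁ (v + n)
    rwa [show v + n - 1 = v - 1 + n by ring] at this)

/-- The structure morphism of a complex algebra. -/
abbrev toℂ (A : Type) [CommRing A] [Algebra ℂ A] : Spec (.of A) ⟶ Spec (.of ℂ) :=
  Spec.map (CommRingCat.ofHom (algebraMap ℂ A))

lemma specMap_toℂ {A B : Type} [CommRing A] [Algebra ℂ A] [CommRing B] [Algebra ℂ B]
    (f : A →ₐ[ℂ] B) : specMap f ≫ toℂ A = toℂ B := by
  rw [← Spec.map_comp, ← CommRingCat.ofHom_comp]
  exact congrArg (fun r => Spec.map (CommRingCat.ofHom r)) (RingHom.ext fun c => f.commutes c)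

/-- The structure morphism of the chain. -/
def strX : X₀ ⟶ Spec (.of ℂ) :=
  descX (fun _ => toℂ RD) (fun _ => toℂ RG) (fun _ => by rw [specMap_toℂ, specMap_toℂ])
    (fun _ => by rw [specMap_toℂ, specMap_toℂ])

/-- The nodal curve `E`: a projective line with `0` and `∞` identified transversally, glued from the
affine nodal cubic and the torus along `W`. -/
def E : Scheme.{0} := pushout (specMap ψW) (specMap Cell.wg)

/-- The inclusion of the affine nodal cubic. -/
def ιN : Spec (.of RN) ⟶ E := pushout.inl (specMap ψW) (specMap Cell.wg)

/-- The inclusion of the torus. -/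
def ιE : Spec (.of RG) ⟶ E := pushout.inr (specMap ψW) (specMap Cell.wg)

lemma E_cond : specMap ψW ≫ ιN = specMap Cell.wg ≫ ιE := pushout.condition

/-- The structure morphism of the nodal curve. -/
def strE : E ⟶ Spec (.of ℂ) := pushout.desc (toℂ RN) (toℂ RG) (by rw [specMap_toℂ, specMap_toℂ])

lemma ιN_strE : ιN ≫ strE = toℂ RN := pushout.inl_desc _ _ _
lemma ιE_strE : ιE ≫ strE = toℂ RG := pushout.inr_desc _ _ _

/-- The quotient map from the chain to the nodal curve. -/
def πX : X₀ ⟶ E :=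
  descX (fun _ => specMap ψD ≫ ιN) (fun _ => ιE)
    (fun v => by
      rw [← E_cond, ← Category.assoc, ← Spec.map_comp, ← CommRingCat.ofHom_comp, ← φ₀_ψD]; rfl)
    (fun v => by
      rw [← E_cond, ← Category.assoc, ← Spec.map_comp, ← CommRingCat.ofHom_comp, ← φ₁_ψD]; rfl)

lemma shiftX_πX (n : ℤ) : shiftX n ≫ πX = πX :=
  X₀_ext (fun j => by rw [← Category.assoc, shiftX, ιD_descX, πX, ιD_descX, ιD_descX])
    (fun v => by rw [← Category.assoc, shiftX, ιG_descX, πX, ιG_descX, ιG_descX])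

lemma shiftX_strX (n : ℤ) : shiftX n ≫ strX = strX :=
  X₀_ext (fun j => by rw [← Category.assoc, shiftX, ιD_descX, strX, ιD_descX, ιD_descX])
    (fun v => by rw [← Category.assoc, shiftX, ιG_descX, strX, ιG_descX, ιG_descX])

lemma πX_strE : πX ≫ strE = strX :=
  X₀_ext
    (fun j => by
      rw [← Category.assoc, πX, strX, ιD_descX, ιD_descX, Category.assoc, ιN_strE, specMap_toℂ])
    (fun v => by
      rw [← Category.assoc, πX, strX, ιG_descX, ιG_descX, ιE_strE])

/-! ### Sections defined by generators -/

namespace LogPres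

variable {X : Scheme.{0}} (R : LogPres X)

lemma gen_res {V W : Et X} (h : W.S ⟶ V.S) (w : h ≫ V.p = W.p) (g : R.G V) :
    R.logStr.res h w (R.gen g) = R.gen (R.gres h w g) := by
  have h1 := Sh.of_unique (Sh.mem_of (N := R.preLog.toEtPre)
    ((((Multiplicative.ofAdd {g}, 1) : R.Free V) : (R.con V).Quotient) : R.preLog.obj V) h w)
  refine h1.trans ?_
  change Sh.of (N := R.preLog.toEtPre) ((R.freeRes h w (Multiplicative.ofAdd {g}, 1) : R.Free W) :
    (R.con W).Quotient) = _
  simp [freeRes, gen]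

lemma of_mul {N : EtPre X} {V : Et X} (a b : N.obj V) : Sh.of (a * b) = Sh.of a * Sh.of b :=
  Sh.ext_local (Et.Locally.of_self ⟨a * b, by
    have := Sh.mem_of (a * b) (𝟙 _) (by simp); rwa [N.res_id] at this, by
    have h1 := Sh.mem_of a (𝟙 _) (by simp)
    have h2 := Sh.mem_of b (𝟙 _) (by simp)
    rw [N.res_id] at h1 h2
    exact Sh.mem_mul h1 h2⟩)

lemma gen_α {V : Et X} (g : R.G V) : R.logStr.α (R.gen g) = R.val g := by
  have key : ∀ a : R.preLog.obj V, R.preLog.shα (Sh.of a) = R.preLog.α a := fun a => by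
    have h1 := R.preLog.shα_spec _ (Sh.mem_of a (𝟙 _) (by simp))
    rwa [fres_id, R.preLog.α_res, fres_id] at h1
  refine (key _).trans ?_
  change R.freeα V (Multiplicative.ofAdd {g}, 1) = _
  simp [freeα]

lemma gen_prod {V : Et X} (m : Multiset (R.G V)) : (m.map R.gen).prod =
    (Sh.of (N := R.preLog.toEtPre) ((((Multiplicative.ofAdd m, 1) : R.Free V) :
      (R.con V).Quotient) : R.preLog.obj V) : R.logStr.obj V) := by
  induction m using Multiset.induction_on with
  | empty =>
    rw [Multiset.map_zero, Multiset.prod_zero]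
    exact Sh.ext_local (Et.Locally.of_self ⟨1, Sh.mem_one, by
      have := Sh.mem_of (N := R.preLog.toEtPre) (V := V) 1 (𝟙 _) (by simp)
      rwa [R.preLog.res_id] at this⟩)
  | cons g m ih =>
    rw [Multiset.map_cons, Multiset.prod_cons, ih]
    refine (of_mul (N := R.preLog.toEtPre) _ _).symm.trans ?_
    refine congrArg (Sh.of (N := R.preLog.toEtPre)) ?_
    change ((((Multiplicative.ofAdd {g}, 1) * (Multiplicative.ofAdd m, 1) : R.Free V)) :
      (R.con V).Quotient) = _
    simp [← ofAdd_add]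

lemma gen_rel {V : Et X} {m m' : Multiset (R.G V)} (h : R.rel V m m') :
    (m.map R.gen).prod = (m'.map R.gen).prod := by
  rw [gen_prod, gen_prod]
  exact congrArg (Sh.of (N := R.preLog.toEtPre)) ((Con.eq _).2 (ConGen.Rel.of _ _ (Rel.rel m m' h)))

end LogPres

/-! ### The standard log point -/

/-- One generator `t` with `α(t) = 0`. -/
def ptPres : LogPres (Spec (.of ℂ)) where
  G _ := PUnit.{2}
  gres _ _ g := g
  gres_id _ _ := rfl
  gres_gres _ _ _ _ _ _ := rfl
  val _ := 0
  val_res h _ _ := (map_zero (fres h)).symm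
  rel _ _ _ := False
  rel_res _ _ _ _ h := h
  rel_val h := h.elim

/-- The standard log point `Spec ℂ`, with log structure `ℕ ⊕ ℂ^×`. -/
def logPoint : LogScheme := ptPres.logScheme

/-- The final object of the small étale site. -/
def Et.self (X : Scheme.{0}) : Et X := ⟨X, 𝟙 X⟩

/-- The section `t` of the log structure of a log scheme over the standard log point. -/
def tSec {X : LogScheme} (p : X ⟶ logPoint) (V : Et X.X) : X.L.obj V :=
  p.log.map (U := Et.self logPoint.X) (V := V) (V.p ≫ p.base) (Category.comp_id _)
    (ptPres.gen (V := Et.self (Spec (.of ℂ))) PUnit.unit)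

/-! ### The central fibre of the degeneration of the universal cover of the Tate curve -/

/-- The product of the affine line (with coordinate `s`) and the chain of projective lines. -/
def Y₀ : Scheme.{0} := 𝔸(PUnit.{1}; X₀)

/-- The projection to the chain. -/
def toX₀ : Y₀ ⟶ X₀ := 𝔸(PUnit.{1}; X₀) ↘ X₀

/-- The coordinate `s`. -/
def sY₀ : Γ(Y₀, ⊤) := AffineSpace.coord X₀ PUnit.unit

/-- Translation by `n`. -/
def shiftY (n : ℤ) : Y₀ ⟶ Y₀ := AffineSpace.map PUnit.{1} (shiftX n)

lemma shiftY_toX₀ (n : ℤ) : shiftY n ≫ toX₀ = toX₀ ≫ shiftX n := AffineSpace.map_over _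

lemma shiftY_s (n : ℤ) : fres (shiftY n) sY₀ = sY₀ := AffineSpace.map_appTop_coord _ _

/-- The pull-back of the element `a` of `A` along a morphism to `Spec A`. -/
def pullFn {V : Scheme.{0}} {A : Type} [CommRing A] (h : V ⟶ Spec (.of A)) : A →+* Γ(V, ⊤) :=
  (fres h).comp (Scheme.ΓSpecIso (.of A)).inv.hom

lemma pullFn_comp {V W : Scheme.{0}} {A : Type} [CommRing A] (k : W ⟶ V) (h : V ⟶ Spec (.of A))
    (a : A) : pullFn (k ≫ h) a = fres k (pullFn h a) := fres_comp h k _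

/-- The generators of the log structure of `Y₀`: `s`, `t` and, on the neighbourhood of the node `j`,
the coordinates `x_j` (for `i = 0`) and `y_j` (for `i = 1`). -/
inductive YGen (V : Et Y₀) : Type 1
  | s : YGen V
  | t : YGen V
  | x (i : Fin 2) (j : ℤ) (h : V.S ⟶ Spec (.of RD)) (w : h ≫ ιD j = V.p ≫ toX₀) : YGen V

/-- Restriction of generators. -/
def YGen.res {V W : Et Y₀} (h : W.S ⟶ V.S) (w : h ≫ V.p = W.p) : YGen V → YGen W
  | s => s
  | t => t
  | x i j k wk => x i j (h ≫ k) (by rw [Category.assoc, wk, ← Category.assoc, w])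

/-- The images in the structure sheaf; `t` is mapped to `0`. -/
def YGen.val {V : Et Y₀} : YGen V → Γ(V.S, ⊤)
  | s => fres V.p sY₀
  | t => 0
  | x i _ h _ => pullFn h (xD i)

/-- The relations `x_j y_j = (s t)^b`. -/
inductive YRel (b : ℕ+) (V : Et Y₀) : Multiset (YGen V) → Multiset (YGen V) → Prop
  | mk (j : ℤ) (h : V.S ⟶ Spec (.of RD)) (w : h ≫ ιD j = V.p ≫ toX₀) : YRel b V
      {YGen.x 0 j h w, YGen.x 1 j h w}
      (Multiset.replicate b YGen.s + Multiset.replicate b YGen.t)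

/-- The presentation of the log structure of `Y₀`. -/
def YPres (b : ℕ+) : LogPres Y₀ where
  G := YGen
  gres := YGen.res
  gres_id V g := by cases g <;> simp [YGen.res]
  gres_gres h w k wk wkh g := by cases g <;> simp [YGen.res]
  val := YGen.val
  val_res h w g := by
    cases g with
    | s => simp only [YGen.res, YGen.val, ← w, fres_comp]
    | t => simp [YGen.res, YGen.val]
    | x i j k wk => exact pullFn_comp _ _ _
  rel := YRel b
  rel_res h w m m' hm := by
    obtain ⟨j, k, wk⟩ := hm
    simpa [YGen.res] using YRel.mk (b := b) j (h ≫ k) (by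
      rw [Category.assoc, wk, ← Category.assoc, w])
  rel_val hm := by
    obtain ⟨j, k, wk⟩ := hm
    simp [YGen.val, ← map_mul, xD_mul]

/-- The log scheme `Y₀`. -/
def YLog (b : ℕ+) : LogScheme := (YPres b).logScheme

/-- The structure morphism of `Y₀` over the standard log point. -/
def YPt (b : ℕ+) : YLog b ⟶ logPoint :=
  GenMap.hom (X := YLog b) (R := ptPres) (f := toX₀ ≫ strX)
    { map := fun {U V} h w g => (YPres b).gen (YGen.t : YGen V)
      map_res := fun k wk h w w' a => rfl
      res_map := fun h w k wk w' a => (YPres b).gen_res k wk _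
      α_map := fun h w a => ((YPres b).gen_α _).trans (map_zero (fres h)).symm
      rel := fun h w m m' hm => hm.elim }

lemma ιD_shiftX (j n : ℤ) : ιD j ≫ shiftX n = ιD (j + n) := ιD_descX _ _ _ _ _
lemma ιG_shiftX (j n : ℤ) : ιG j ≫ shiftX n = ιG (j + n) := ιG_descX _ _ _ _ _

lemma shiftX_neg (n : ℤ) : shiftX n ≫ shiftX (-n) = 𝟙 _ :=
  X₀_ext
    (fun j => by rw [← Category.assoc, ιD_shiftX, ιD_shiftX, add_neg_cancel_right, Category.comp_id])
    (fun j => by rw [← Category.assoc, ιG_shiftX, ιG_shiftX, add_neg_cancel_right, Category.comp_id])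

lemma shift_w (n j : ℤ) {U V : Et Y₀} (h : V.S ⟶ U.S) (w : h ≫ U.p = V.p ≫ shiftY n)
    (k : U.S ⟶ Spec (.of RD)) (wk : k ≫ ιD j = U.p ≫ toX₀) :
    (h ≫ k) ≫ ιD (j + -n) = V.p ≫ toX₀ := by
  have e : shiftY n ≫ toX₀ ≫ shiftX (-n) = toX₀ := by
    rw [← Category.assoc, shiftY_toX₀, Category.assoc, shiftX_neg, Category.comp_id]
  rw [← ιD_shiftX, Category.assoc, reassoc_of% wk, reassoc_of% w, e]

/-- The image of a generator under translation by `n`: it permutes the charts. -/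
def YGen.shift (n : ℤ) {U V : Et Y₀} (h : V.S ⟶ U.S) (w : h ≫ U.p = V.p ≫ shiftY n) :
    YGen U → YGen V
  | s => s
  | t => t
  | x i j k wk => x i (j + -n) (h ≫ k) (shift_w n j h w k wk)

/-- Translation by `n` on generators. -/
def shiftGen (b : ℕ+) (n : ℤ) : GenMap (YPres b) (YPres b).logStr (shiftY n) where
  map h w g := (YPres b).gen (YGen.shift n h w g)
  map_res k wk h w w' a := by
    refine congrArg (YPres b).gen ?_
    cases a with
    | x i j l wl => simp [YPres, YGen.res, YGen.shift]
    | _ => rfl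
  res_map h w k wk w' a := by
    refine ((YPres b).gen_res k wk _).trans ?_
    refine congrArg (YPres b).gen ?_
    cases a with
    | x i j l wl => simp [YPres, YGen.res, YGen.shift]
    | _ => rfl
  α_map {U V} h w a := by
    refine ((YPres b).gen_α _).trans ?_
    cases a with
    | s =>
      change fres V.p sY₀ = fres h (fres U.p sY₀)
      rw [← fres_comp, w, fres_comp, shiftY_s]
    | t => exact (map_zero (fres h)).symm
    | x i j l wl => exact pullFn_comp _ _ _
  rel {U V} h w m m' hm := by
    obtain ⟨j, k, wk⟩ := hm
    have := (YPres b).gen_rel (YRel.mk (b := b) (j + -n) (h ≫ k) (shift_w n j h w k wk))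
    have e₁ : Multiset.map (YGen.shift n h w) {YGen.x 0 j k wk, YGen.x 1 j k wk} =
        {YGen.x 0 (j + -n) (h ≫ k) (shift_w n j h w k wk),
          YGen.x 1 (j + -n) (h ≫ k) (shift_w n j h w k wk)} := by simp [YGen.shift]
    have e₂ : Multiset.map (YGen.shift n h w) (Multiset.replicate b YGen.s +
        Multiset.replicate b YGen.t) = Multiset.replicate b YGen.s +
        Multiset.replicate b YGen.t := by simp [YGen.shift]
    have e₃ : ∀ (m : Multiset (YGen U)) (m' : Multiset (YGen V)), m.map (YGen.shift n h w) = m' →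
        (Multiset.map (fun g => (YPres b).gen (YGen.shift n h w g)) m).prod =
        (Multiset.map (YPres b).gen m').prod := by
      rintro m _ rfl
      exact congrArg Multiset.prod
        (Multiset.map_map (YPres b).gen (YGen.shift n h w) m).symm
    exact (e₃ _ _ e₁).trans (this.trans (e₃ _ _ e₂).symm)

/-- Translation by `n` on the log scheme `Y₀`. -/
def YShift (b : ℕ+) (n : ℤ) : YLog b ⟶ YLog b := GenMap.hom (X := YLog b) (shiftGen b n)

/-! ### The quotient log structure -/

section Quot

variable {Y : LogScheme} {T : Scheme.{0}} (π : Y.X ⟶ T) (Φ : Y ⟶ Y) (hΦ : Φ.base ≫ π = π)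

/-- The functoriality of `V ×_T Y` in `V`. -/
def Et.pbMap {V W : Et T} (h : W.S ⟶ V.S) (w : h ≫ V.p = W.p) : (W.pb π).S ⟶ (V.pb π).S :=
  V.pbLift π (W.pbFst π ≫ h) (W.pb π).p (by rw [Category.assoc, w, W.pb_cond])

lemma Et.pbMap_p {V W : Et T} (h : W.S ⟶ V.S) (w : h ≫ V.p = W.p) :
    Et.pbMap π h w ≫ (V.pb π).p = (W.pb π).p := V.pbLift_p _ _ _ _

lemma Et.pbMap_fst {V W : Et T} (h : W.S ⟶ V.S) (w : h ≫ V.p = W.p) :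
    Et.pbMap π h w ≫ V.pbFst π = W.pbFst π ≫ h := V.pbLift_fst _ _ _ _

lemma Et.pbAct_w (hΦ : Φ.base ≫ π = π) (V : Et T) : V.pbFst π ≫ V.p = ((V.pb π).p ≫ Φ.base) ≫ π := by
  rw [Category.assoc, hΦ, V.pb_cond]

/-- The action of `Φ` on `V ×_T Y`. -/
def Et.pbAct (V : Et T) : (V.pb π).S ⟶ (V.pb π).S :=
  V.pbLift π (V.pbFst π) ((V.pb π).p ≫ Φ.base) (Et.pbAct_w π Φ hΦ V)

lemma Et.pbAct_p (V : Et T) : V.pbAct π Φ hΦ ≫ (V.pb π).p = (V.pb π).p ≫ Φ.base :=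
  V.pbLift_p _ _ _ _

lemma Et.pbAct_fst (V : Et T) : V.pbAct π Φ hΦ ≫ V.pbFst π = V.pbFst π := V.pbLift_fst _ _ _ _

/-- The action of `Φ` on the sections of the log structure over `V ×_T Y`. -/
def Et.act (V : Et T) : Y.L.obj (V.pb π) →* Y.L.obj (V.pb π) :=
  Φ.log.map (V.pbAct π Φ hΦ) (V.pbAct_p π Φ hΦ)

lemma Et.act_res {V W : Et T} (h : W.S ⟶ V.S) (w : h ≫ V.p = W.p) (m : Y.L.obj (V.pb π)) :
    W.act π Φ hΦ (Y.L.res (Et.pbMap π h w) (Et.pbMap_p π h w) m) =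
      Y.L.res (Et.pbMap π h w) (Et.pbMap_p π h w) (V.act π Φ hΦ m) := by
  have e : W.pbAct π Φ hΦ ≫ Et.pbMap π h w = Et.pbMap π h w ≫ V.pbAct π Φ hΦ := by
    apply V.pb_ext
    · simp [Et.pbMap, Et.pbAct]
    · simp [Et.pbMap, Et.pbAct]
  have w₁ : (W.pbAct π Φ hΦ ≫ Et.pbMap π h w) ≫ (V.pb π).p = (W.pb π).p ≫ Φ.base := by
    simp [Et.pbMap, Et.pbAct]
  rw [Et.act, Et.act, Φ.log.map_res _ _ _ _ w₁, Φ.log.res_map _ _ _ _ (e ▸ w₁)]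
  simp only [e]

/-- The pairs of a `Φ`-invariant section of the log structure of `Y` over `V ×_T Y` and a function
on `V` with the same image in the functions on `V ×_T Y`. -/
def invSub (V : Et T) : Submonoid (Y.L.obj (V.pb π) × Γ(V.S, ⊤)) where
  carrier := {q | V.act π Φ hΦ q.1 = q.1 ∧ Y.L.α q.1 = fres (V.pbFst π) q.2}
  one_mem' := ⟨map_one _, by simp⟩
  mul_mem' h h' := ⟨by simp only [Prod.fst_mul, map_mul, h.1, h'.1],
    by simp only [Prod.fst_mul, Prod.snd_mul, map_mul, h.2, h'.2]⟩

/-- Restriction of invariant sections. -/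
def invRes {V W : Et T} (h : W.S ⟶ V.S) (w : h ≫ V.p = W.p) :
    invSub π Φ hΦ V →* invSub π Φ hΦ W where
  toFun q := ⟨(Y.L.res (Et.pbMap π h w) (Et.pbMap_p π h w) q.1.1, fres h q.1.2), by
    rw [Et.act_res, q.2.1], by
    rw [Y.L.α_res, q.2.2, ← fres_comp, ← fres_comp, Et.pbMap_fst]⟩
  map_one' := Subtype.ext (Prod.ext (map_one _) (map_one (fres h)))
  map_mul' q r := Subtype.ext (Prod.ext (map_mul _ _ _) (map_mul (fres h) _ _))

lemma Et.act_α (V : Et T) {m : Y.L.obj (V.pb π)} {a : Γ(V.S, ⊤)}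
    (h : Y.L.α m = fres (V.pbFst π) a) : Y.L.α (V.act π Φ hΦ m) = fres (V.pbFst π) a := by
  rw [Et.act, Φ.log.α_map, h, ← fres_comp, Et.pbAct_fst]

/-- The log structure on `T` whose sections over `V` are the `Φ`-invariant sections of the log
structure of `Y` over `V ×_T Y` which lie over a function on `V`. -/
def invLog : LogStr T where
  obj V := invSub π Φ hΦ V
  res h w := invRes π Φ hΦ h w
  res_id V q := by
    refine Subtype.ext (Prod.ext ?_ (fres_id _))
    have e : Et.pbMap π (𝟙 V.S) (Category.id_comp V.p) = 𝟙 _ := by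
      apply V.pb_ext <;> simp [Et.pbMap]
    have h1 := Y.L.res_id (V.pb π) q.1.1
    refine Eq.trans ?_ h1
    change Y.L.res _ _ q.1.1 = _
    simp only [e]
  res_res {V W Z} h w k wk wkh q := by
    refine Subtype.ext (Prod.ext ?_ (fres_comp _ _ _).symm)
    have e : Et.pbMap π k wk ≫ Et.pbMap π h w = Et.pbMap π (k ≫ h) wkh := by
      apply V.pb_ext <;> simp [Et.pbMap]
    have h1 := Y.L.res_res (Et.pbMap π h w) (Et.pbMap_p π h w) (Et.pbMap π k wk)
      (Et.pbMap_p π k wk) (by rw [e]; exact Et.pbMap_p _ _ _) q.1.1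
    refine Eq.trans h1 ?_
    change _ = Y.L.res _ _ q.1.1
    simp only [e]
  α {V} := (MonoidHom.snd _ _).comp (invSub π Φ hΦ V).subtype
  α_res h w q := rfl
  unit {V} u := by
    let u' : Γ((V.pb π).S, ⊤)ˣ := Units.map (fres (V.pbFst π)).toMonoidHom u
    have hα : Y.L.α (Y.L.unitSec u') = fres (V.pbFst π) u := Y.L.α_unitSec u'
    refine ⟨⟨(Y.L.unitSec u', u), Y.L.eq_unitSec u' _ (Et.act_α π Φ hΦ V hα), hα⟩, rfl, ?_⟩
    rintro ⟨⟨m, a⟩, h1, h2⟩ (e : a = u)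
    subst e
    exact Subtype.ext (Prod.ext (Y.L.eq_unitSec u' _ h2) rfl)
  sep {V} q r H := by
    refine Subtype.ext (Prod.ext (Y.L.sep _ _ ?_) (fn_sep V _ _ (H.mono fun W h w e =>
      congrArg (fun q => q.1.2) e)))
    refine (H.pullback (f := π) (V.pbFst π) (V.pb_cond π)).mono ?_
    rintro Z k wk ⟨W, h, w, l, e, wl, hq⟩
    let l' : Z.S ⟶ (W.pb π).S := W.pbLift π l Z.p wl
    have hl' : l' ≫ (W.pb π).p = Z.p := W.pbLift_p _ _ _ _
    have ek : l' ≫ Et.pbMap π h w = k := by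
      apply V.pb_ext <;> simp [Et.pbMap, l', e, wk]
    exact Y.L.res_eq_of (congrArg (fun q => q.1.1) hq) l' hl' ek wk
  glue {V} F hres huniq hcov := by
    have hcast : ∀ {Z : Et T} {k k' : Z.S ⟶ V.S} (_ : k = k') {wk : k ≫ V.p = Z.p}
        (wk' : k' ≫ V.p = Z.p) {s}, s ∈ F Z k wk → s ∈ F Z k' wk' := by
      rintro Z k _ rfl wk wk' s hs; exact hs
    obtain ⟨a, ha⟩ := fn_glue V (fun W h w => (fun q => q.1.2) '' F W h w)
      (by
        rintro W h w _ ⟨q, hq, rfl⟩ Z k wk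
        exact ⟨_, hres W h w q hq Z k wk _, rfl⟩)
      (by
        rintro W h w _ ⟨q, hq, rfl⟩ _ ⟨r, hr, rfl⟩
        rw [huniq W h w q hq r hr])
      (hcov.mono fun W h w ⟨q, hq⟩ => ⟨_, q, hq, rfl⟩)
    obtain ⟨m, hm⟩ := Y.L.glue (V := V.pb π) (fun Z k wk => {m | ∃ (W : Et T) (h : W.S ⟶ V.S)
        (w : h ≫ V.p = W.p) (q : _) (_ : q ∈ F W h w) (l : Z.S ⟶ (W.pb π).S)
        (wl : l ≫ (W.pb π).p = Z.p), l ≫ Et.pbMap π h w = k ∧ m = Y.L.res l wl q.1.1})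
      (by
        rintro Z k wk _ ⟨W, h, w, q, hq, l, wl, e, rfl⟩ Z' k' wk' wkk
        exact ⟨W, h, w, q, hq, k' ≫ l, by rw [Category.assoc, wl, wk'],
          by rw [Category.assoc, e], Y.L.res_res _ _ _ _ _ _⟩)
      (by
        rintro Z k wk _ ⟨W₁, h₁, w₁, q₁, hq₁, l₁, wl₁, e₁, rfl⟩ _
          ⟨W₂, h₂, w₂, q₂, hq₂, l₂, wl₂, e₂, rfl⟩
        have := Et.etale_hom h₁ w₁
        let D : Et V.S := ⟨W₁.S, h₁⟩
        let W₃ : Et T := ⟨(D.pb h₂).S, (D.pb h₂).p ≫ W₂.p⟩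
        let p₁ : W₃.S ⟶ W₁.S := D.pbFst h₂
        let p₂ : W₃.S ⟶ W₂.S := (D.pb h₂).p
        have c : p₁ ≫ h₁ = p₂ ≫ h₂ := D.pb_cond h₂
        have wp₂ : p₂ ≫ W₂.p = W₃.p := rfl
        have wp₁ : p₁ ≫ W₁.p = W₃.p := by rw [← wp₂, ← w₁, ← w₂, reassoc_of% c]
        have h3 := huniq _ _ _ _
          (hcast c (by rw [Category.assoc, w₂, wp₂]) (hres _ _ _ _ hq₁ W₃ p₁ wp₁
            (by rw [Category.assoc, w₁, wp₁]))) _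
          (hres _ _ _ _ hq₂ W₃ p₂ wp₂ (by rw [Category.assoc, w₂, wp₂]))
        have el : (l₁ ≫ W₁.pbFst π) ≫ h₁ = (l₂ ≫ W₂.pbFst π) ≫ h₂ := by
          have := congrArg (· ≫ V.pbFst π) (e₁.trans e₂.symm)
          simpa [Et.pbMap_fst] using this
        let l₃ : Z.S ⟶ W₃.S := D.pbLift h₂ (l₁ ≫ W₁.pbFst π) (l₂ ≫ W₂.pbFst π) el
        have el₁ : l₃ ≫ p₁ = l₁ ≫ W₁.pbFst π := D.pbLift_fst _ _ _ _
        have el₂ : l₃ ≫ p₂ = l₂ ≫ W₂.pbFst π := D.pbLift_p _ _ _ _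
        let l : Z.S ⟶ (W₃.pb π).S := W₃.pbLift π l₃ Z.p (by
          rw [← wp₂, reassoc_of% el₂, W₂.pb_cond, reassoc_of% wl₂])
        have wl : l ≫ (W₃.pb π).p = Z.p := W₃.pbLift_p _ _ _ _
        have ll : l ≫ W₃.pbFst π = l₃ := W₃.pbLift_fst _ _ _ _
        have f₁ : l ≫ Et.pbMap π p₁ wp₁ = l₁ := by
          apply W₁.pb_ext
          · rw [Category.assoc, Et.pbMap_fst, reassoc_of% ll, el₁]
          · rw [Category.assoc, Et.pbMap_p, wl, wl₁]
        have f₂ : l ≫ Et.pbMap π p₂ wp₂ = l₂ := by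
          apply W₂.pb_ext
          · rw [Category.assoc, Et.pbMap_fst, reassoc_of% ll, el₂]
          · rw [Category.assoc, Et.pbMap_p, wl, wl₂]
        have h4 : Y.L.res (Et.pbMap π p₁ wp₁) (Et.pbMap_p π p₁ wp₁) q₁.1.1 =
          Y.L.res (Et.pbMap π p₂ wp₂) (Et.pbMap_p π p₂ wp₂) q₂.1.1 :=
          congrArg (fun q => q.1.1) h3
        have h5 := congrArg (Y.L.res l wl) h4
        rw [Y.L.res_res _ _ _ _ (by rw [f₁, wl₁]), Y.L.res_res _ _ _ _ (by rw [f₂, wl₂])] at h5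
        simpa only [f₁, f₂] using h5)
      (by
        refine (hcov.pullback (f := π) (V.pbFst π) (V.pb_cond π)).mono ?_
        rintro Z k wk ⟨W, h, w, l, e, wl, q, hq⟩
        refine ⟨_, W, h, w, q, hq, W.pbLift π l Z.p wl, W.pbLift_p _ _ _ _, ?_, rfl⟩
        apply V.pb_ext <;> simp [Et.pbMap, e, wk])
    have hm' : ∀ (W : Et T) (h : W.S ⟶ V.S) (w : h ≫ V.p = W.p), ∀ q ∈ F W h w,
        Y.L.res (Et.pbMap π h w) (Et.pbMap_p π h w) m = q.1.1 := fun W h w q hq =>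
      hm (W.pb π) _ _ _ ⟨W, h, w, q, hq, 𝟙 _, Category.id_comp _, Category.id_comp _,
        (Y.L.res_id _ _).symm⟩
    have key : ∀ (m₁ m₂ : Y.L.obj (V.pb π)), (∀ (W : Et T) (h : W.S ⟶ V.S) (w : h ≫ V.p = W.p),
        ∀ q ∈ F W h w, Y.L.res (Et.pbMap π h w) (Et.pbMap_p π h w) m₁ =
          Y.L.res (Et.pbMap π h w) (Et.pbMap_p π h w) m₂) → m₁ = m₂ := by
      intro m₁ m₂ H
      refine Y.L.sep _ _ ((hcov.pullback (f := π) (V.pbFst π) (V.pb_cond π)).mono ?_)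
      rintro Z k wk ⟨W, h, w, l, e, wl, q, hq⟩
      refine Y.L.res_eq_of (H W h w q hq) (W.pbLift π l Z.p wl) (W.pbLift_p _ _ _ _) ?_ wk
      apply V.pb_ext <;> simp [Et.pbMap, e, wk]
    refine ⟨⟨(m, a), key _ _ fun W h w q hq => ?_, ?_⟩, fun W h w q hq =>
      Subtype.ext (Prod.ext (hm' W h w q hq) (ha W h w _ ⟨q, hq, rfl⟩))⟩
    · rw [← Et.act_res, hm' W h w q hq, q.2.1]
    · refine fn_sep (V.pb π) _ _ ((hcov.pullback (f := π) (V.pbFst π) (V.pb_cond π)).mono ?_)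
      rintro Z k wk ⟨W, h, w, l, e, wl, q, hq⟩
      have h1 := congrArg Y.L.α (hm' W h w q hq)
      have h0 : fres h a = q.1.2 := ha W h w _ ⟨q, hq, rfl⟩
      rw [Y.L.α_res, q.2.2, ← h0, ← fres_comp] at h1
      have ek : W.pbLift π l Z.p wl ≫ Et.pbMap π h w = k := by
        apply V.pb_ext <;> simp [Et.pbMap, e, wk]
      have h2 := congrArg (fres (W.pbLift π l Z.p wl)) h1
      rw [← fres_comp, ← fres_comp, ek, ← Et.pbMap_fst π h w, reassoc_of% ek] at h2
      refine h2.trans ?_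
      rw [fres_comp]

/-- The log scheme with the quotient log structure. -/
def quotLog : LogScheme := ⟨T, invLog π Φ hΦ⟩

/-- The quotient map. -/
def quotPull : LogMap (invLog π Φ hΦ).toPreLog Y.L.toPreLog π where
  map {U V} h w := (Y.L.res (U.pbLift π h V.p w) (U.pbLift_p _ _ _ _)).comp
      ((MonoidHom.fst _ _).comp (invSub π Φ hΦ U).subtype)
  map_res {U U' V} k wk h w w' q := by
    refine (Y.L.res_res _ _ _ _ (by simp [Et.pbMap]) q.1.1).trans ?_
    change _ = Y.L.res _ _ q.1.1
    have : U'.pbLift π h V.p w ≫ Et.pbMap π k wk = U.pbLift π (h ≫ k) V.p w' := by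
      apply U.pb_ext <;> simp [Et.pbMap]
    simp only [this]
  res_map {U V V'} h w k wk w' q := by
    refine (Y.L.res_res _ _ _ _ (by simp [wk]) q.1.1).trans ?_
    change _ = Y.L.res _ _ q.1.1
    have : k ≫ U.pbLift π h V.p w = U.pbLift π (k ≫ h) V'.p w' := by
      apply U.pb_ext <;> simp [wk]
    simp only [this]
  α_map {U V} h w q := by
    refine (Y.L.α_res _ _ q.1.1).trans ?_
    rw [q.2.2, ← fres_comp, U.pbLift_fst]
    rfl

/-- The quotient map. -/
def quotMap : Y ⟶ quotLog π Φ hΦ :=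
  LogScheme.Hom.mk (Y := quotLog π Φ hΦ) π (quotPull π Φ hΦ)

lemma LogScheme.map_congr {X Y : LogScheme} {f g : X ⟶ Y} (e : f = g) {U : Et Y.X} {V : Et X.X}
    {h h' : V.S ⟶ U.S} (eh : h = h') (w : h ≫ U.p = V.p ≫ f.base) (w' : h' ≫ U.p = V.p ≫ g.base)
    (a : Y.L.obj U) : f.log.map h w a = g.log.map h' w' a := by
  subst e eh; rfl

lemma quotDesc_w {Z : LogScheme} (g : Y ⟶ Z) (g₀ : T ⟶ Z.X) (hg₀ : π ≫ g₀ = g.base) {U : Et Z.X}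
    {V : Et T} (h : V.S ⟶ U.S) (w : h ≫ U.p = V.p ≫ g₀) :
    (V.pbFst π ≫ h) ≫ U.p = (V.pb π).p ≫ g.base := by
  rw [Category.assoc, w, ← hg₀, ← Category.assoc, V.pb_cond, Category.assoc]

/-- A `Φ`-invariant morphism descends to the quotient, given a descent `g₀` of the morphism of
schemes. -/
def quotDescLog {Z : LogScheme} (g : Y ⟶ Z) (hg : Φ ≫ g = g) (g₀ : T ⟶ Z.X)
    (hg₀ : π ≫ g₀ = g.base) : LogMap Z.L.toPreLog (invLog π Φ hΦ).toPreLog g₀ where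
  map {U V} h w := MonoidHom.codRestrict
    ((g.log.map (V.pbFst π ≫ h) (quotDesc_w π g g₀ hg₀ h w)).prod
      ((fres h).toMonoidHom.comp Z.L.α)) (invSub π Φ hΦ V) (fun a => by
        constructor
        · have hb : Φ.base ≫ g.base = g.base := congrArg LogScheme.Hom.base hg
          have e1 := LogScheme.comp_map Φ g (V.pbFst π ≫ h)
            (by rw [hb]; exact quotDesc_w π g g₀ hg₀ h w) (V.pbAct π Φ hΦ) (V.pbAct_p π Φ hΦ)
            (V.pbFst π ≫ h) (quotDesc_w π g g₀ hg₀ h w)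
            (by rw [← Category.assoc, Et.pbAct_fst]) a
          exact e1.symm.trans (LogScheme.map_congr hg rfl _ _ a)
        · change Y.L.α (g.log.map _ _ a) = fres _ (fres h (Z.L.α a))
          rw [g.log.α_map, fres_comp])
  map_res {U U' V} k wk h w w' a := by
    refine Subtype.ext (Prod.ext ?_ ?_)
    · have h1 := g.log.map_res k wk (V.pbFst π ≫ h) (quotDesc_w π g g₀ hg₀ h w)
        (by rw [Category.assoc]; exact quotDesc_w π g g₀ hg₀ (h ≫ k) w') a
      exact h1.trans (LogScheme.map_congr rfl (Category.assoc _ _ _) _ _ a)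
    · change fres h (Z.L.α (Z.L.res k wk a)) = fres (h ≫ k) (Z.L.α a)
      rw [Z.L.α_res, fres_comp]
  res_map {U V V'} h w k wk w' a := by
    refine Subtype.ext (Prod.ext ?_ (fres_comp _ _ _).symm)
    have e : Et.pbMap π k wk ≫ V.pbFst π ≫ h = V'.pbFst π ≫ k ≫ h := by
      rw [← Category.assoc, Et.pbMap_fst, Category.assoc]
    have h1 := g.log.res_map (V.pbFst π ≫ h) (quotDesc_w π g g₀ hg₀ h w) (Et.pbMap π k wk)
      (Et.pbMap_p π k wk) (by rw [e]; exact quotDesc_w π g g₀ hg₀ (k ≫ h) w') a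
    exact h1.trans (LogScheme.map_congr rfl e _ _ a)
  α_map h w a := rfl

/-- The descended morphism. -/
def quotDesc {Z : LogScheme} (g : Y ⟶ Z) (hg : Φ ≫ g = g) (g₀ : T ⟶ Z.X)
    (hg₀ : π ≫ g₀ = g.base) : quotLog π Φ hΦ ⟶ Z :=
  LogScheme.Hom.mk (X := quotLog π Φ hΦ) g₀ (quotDescLog π Φ hΦ g hg g₀ hg₀)

end Quot

/-! ### The degenerate Tate curve -/

lemma GenMap.hom_gen {X : LogScheme} {Y : Scheme.{0}} {R : LogPres Y} {f : X.X ⟶ Y}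
    (γ : GenMap R X.L f) {U : Et Y} {V : Et X.X} (h : V.S ⟶ U.S) (w : h ≫ U.p = V.p ≫ f)
    (g : R.G U) : (γ.hom : X ⟶ R.logScheme).log.map (U := U) h w (R.gen g) = γ.map h w g := by
  let q : R.preLog.obj U := (((Multiplicative.ofAdd {g}, 1) : R.Free U) : (R.con U).Quotient)
  have hq : q ∈ (Sh.of (N := R.preLog.toEtPre) q).c U (𝟙 _) (Category.id_comp _) := by
    have := Sh.mem_of (N := R.preLog.toEtPre) q (𝟙 _) (by simp)
    rwa [R.preLog.res_id] at this
  have h1 := γ.logMap.img_spec (Sh.of (N := R.preLog.toEtPre) q) h w V (𝟙 _) (Category.id_comp _) U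
    (𝟙 _) (Category.id_comp _) h w (by simp) q hq
  rw [X.L.res_id] at h1
  refine h1.trans ?_
  change γ.free h w (Multiplicative.ofAdd {g}, 1) = _
  simp [GenMap.free]

/-- Homomorphisms from a presented log structure are determined on generators. -/
lemma LogPres.logMap_ext {X Y : Scheme.{0}} {R : LogPres Y} {M : LogStr X} {f : X ⟶ Y}
    (F G : LogMap R.logStr.toPreLog M.toPreLog f)
    (H : ∀ (U : Et Y) (V : Et X) (h : V.S ⟶ U.S) (w : h ≫ U.p = V.p ≫ f) (a : R.G U),
      F.map h w (R.gen a) = G.map h w (R.gen a)) (U : Et Y) (V : Et X) (h : V.S ⟶ U.S)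
    (w : h ≫ U.p = V.p ≫ f) (S : R.logStr.obj U) : F.map h w S = G.map h w S := by
  refine M.sep _ _ (((Sh.cov S).pullback h w).mono ?_)
  rintro Z k wk ⟨U', j, wj, l, el, wl, q, hq⟩
  have key : F.map l wl (R.logStr.res j wj S) = G.map l wl (R.logStr.res j wj S) := by
    have h1 : R.logStr.res j wj S = Sh.of q := Sh.of_unique hq
    rw [h1]
    clear h1 hq
    induction q using Con.induction_on with
    | H x =>
      let q₁ : R.preLog.obj U' := (((x.1, 1) : R.Free U') : (R.con U').Quotient)
      let q₂ : R.preLog.obj U' := (((1, x.2) : R.Free U') : (R.con U').Quotient)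
      let s₂ : R.logStr.obj U' := Sh.of (N := R.preLog.toEtPre) q₂
      let s : R.logStr.obj U' :=
        Sh.of (N := R.preLog.toEtPre) ((x : (R.con U').Quotient) : R.preLog.obj U')
      have h2 : s = ((Multiplicative.toAdd x.1).map R.gen).prod * s₂ := by
        rw [LogPres.gen_prod]
        refine Eq.trans ?_ (LogPres.of_mul (N := R.preLog.toEtPre) q₁ q₂)
        refine congrArg (Sh.of (N := R.preLog.toEtPre)) ?_
        change _ = (((x.1, 1) * (1, x.2) : R.Free U') : (R.con U').Quotient)
        simp
      have h3 : R.logStr.α s₂ = x.2 := by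
        have h4 := R.preLog.shα_spec _ (Sh.mem_of q₂ (𝟙 _) (by simp))
        rw [fres_id, R.preLog.α_res, fres_id] at h4
        refine h4.trans ?_
        change R.freeα U' (1, x.2) = _
        simp [freeα]
      have h5 : ∀ F : LogMap R.logStr.toPreLog M.toPreLog f,
          F.map l wl s₂ = M.unitSec (Units.map (fres l).toMonoidHom x.2) := fun F =>
        M.eq_unitSec _ _ ((F.α_map l wl _).trans (congrArg (fres l) h3))
      change F.map l wl s = G.map l wl s
      rw [h2, map_mul, map_mul, h5, h5, map_multiset_prod, map_multiset_prod, Multiset.map_map,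
        Multiset.map_map]
      congr 2
      exact Multiset.map_congr rfl fun a _ => H U' Z l wl a
  have w₁ : (l ≫ j) ≫ U.p = Z.p ≫ f := by rw [Category.assoc, wj, wl]
  have v₁ : (k ≫ h) ≫ U.p = Z.p ≫ f := by rw [Category.assoc, w, ← wk, Category.assoc]
  have e1 := F.map_res j wj l wl w₁ S
  have e2 := G.map_res j wj l wl w₁ S
  have e3 := (e1.symm.trans key).trans e2
  rw [F.res_map h w k wk v₁, G.res_map h w k wk v₁]
  simpa only [el] using e3

/-- Morphisms to a log scheme with a presented log structure are determined on generators. -/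
lemma LogPres.hom_ext {X : LogScheme} {Y : Scheme.{0}} {R : LogPres Y} {f g : X ⟶ R.logScheme}
    (e : f.base = g.base)
    (K : ∀ (U : Et Y) (V : Et X.X) (h : V.S ⟶ U.S) (w : h ≫ U.p = V.p ≫ f.base)
      (w' : h ≫ U.p = V.p ≫ g.base) (a : R.G U),
      f.log.map (U := U) h w (R.gen a) = g.log.map (U := U) h w' (R.gen a)) : f = g := by
  obtain ⟨f, F⟩ := f
  obtain ⟨g, G⟩ := g
  obtain rfl : f = g := e
  exact LogScheme.hom_ext rfl fun U V h w w' S =>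
    LogPres.logMap_ext (R := R) (M := X.L) (f := f) F G (fun U V h w a => K U V h w w a) U V h w S

lemma YShift_t (b : ℕ+) (n : ℤ) {U V : Et Y₀} (h : V.S ⟶ U.S) (w : h ≫ U.p = V.p ≫ shiftY n) :
    (YShift b n).log.map (U := U) (V := V) h w ((YPres b).gen (YGen.t : YGen U)) =
      (YPres b).gen (YGen.t : YGen V) :=
  GenMap.hom_gen (X := YLog b) (shiftGen b n) h w YGen.t

lemma YPt_t (b : ℕ+) {U : Et (Spec (.of ℂ))} {V : Et Y₀} (h : V.S ⟶ U.S)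
    (w : h ≫ U.p = V.p ≫ toX₀ ≫ strX) (a : ptPres.G U) :
    (YPt b).log.map (U := U) (V := V) h w (ptPres.gen a) = (YPres b).gen (YGen.t : YGen V) :=
  GenMap.hom_gen (X := YLog b) _ h w a

lemma YShift_YPt (b : ℕ+) (n : ℤ) : YShift b n ≫ YPt b = YPt b := by
  have hb : shiftY n ≫ toX₀ ≫ strX = toX₀ ≫ strX := by
    rw [← Category.assoc, shiftY_toX₀, Category.assoc, shiftX_strX]
  refine LogPres.hom_ext hb fun U (V : Et Y₀) h w w' a => ?_
  have w₁ : h ≫ U.p = (V.p ≫ shiftY n) ≫ toX₀ ≫ strX := by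
    rw [Category.assoc, hb]; exact w'
  refine (LogScheme.comp_map (YShift b n) (YPt b) (U := U) (W := U.pb (toX₀ ≫ strX)) (V := V) h w
    (U.pbLift _ h (V.p ≫ shiftY n) w₁) (U.pbLift_p _ _ _ _)
    (U.pbFst _) (U.pb_cond _) (U.pbLift_fst _ _ _ _) (ptPres.gen a)).trans ?_
  refine Eq.trans (congrArg _ (YPt_t b (U.pbFst _) (U.pb_cond _) a)) ?_
  exact (YShift_t b n _ (U.pbLift_p _ _ _ _)).trans (YPt_t b h w' a).symm

/-- The product of the affine line (with coordinate `s`) and the nodal curve. -/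
def T₀ : Scheme.{0} := 𝔸(PUnit.{1}; E)

/-- The quotient map. -/
def πY : Y₀ ⟶ T₀ := AffineSpace.map PUnit.{1} πX

/-- The structure morphism. -/
def strT : T₀ ⟶ Spec (.of ℂ) := (𝔸(PUnit.{1}; E) ↘ E) ≫ strE

lemma shiftY_πY (n : ℤ) : shiftY n ≫ πY = πY := by
  have h := AffineSpace.map_comp (n := PUnit.{1}) (shiftX n) πX
  rw [shiftX_πX] at h
  exact h.symm

lemma πY_strT : πY ≫ strT = toX₀ ≫ strX := by
  have h : πY ≫ (𝔸(PUnit.{1}; E) ↘ E) = toX₀ ≫ πX := AffineSpace.map_over _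
  refine (Category.assoc _ _ _).symm.trans ((congrArg (· ≫ strE) h).trans ?_)
  rw [Category.assoc, πX_strE]

/-- The degenerate Tate curve: the quotient of `Y₀` by translations, with the quotient log
structure. -/
def TLog (b : ℕ+) : LogScheme := quotLog (Y := YLog b) πY (YShift b 1) (shiftY_πY 1)

/-- The quotient map. -/
def πLog (b : ℕ+) : YLog b ⟶ TLog b := quotMap (Y := YLog b) πY (YShift b 1) (shiftY_πY 1)

/-- The structure morphism over the standard log point. -/
def TPt (b : ℕ+) : TLog b ⟶ logPoint :=
  quotDesc (Y := YLog b) πY (YShift b 1) (shiftY_πY 1) (YPt b) (YShift_YPt b 1) strT πY_strT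

/-- The affine line with coordinate `s`. -/
def Aff : Scheme.{0} := 𝔸(PUnit.{1}; Spec (.of ℂ))

/-- The projection to the affine line with coordinate `s`. -/
def sY (b : ℕ+) : (YLog b).X ⟶ Aff := AffineSpace.map PUnit.{1} strX

/-- The projection to the affine line with coordinate `s`. -/
def sT (b : ℕ+) : (TLog b).X ⟶ Aff := AffineSpace.map PUnit.{1} strE

/-! ### Charts, fine saturated log schemes, log smooth and integral morphisms -/

lemma EtPre.res_congr {X : Scheme.{0}} (N : EtPre X) {V W : Et X} {h h' : W.S ⟶ V.S} (e : h = h')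
    (w : h ≫ V.p = W.p) (w' : h' ≫ V.p = W.p) (a : N.obj V) : N.res h w a = N.res h' w' a := by
  subst e; rfl

section Chart

variable (X : LogScheme) {P : Type} [CommMonoid P] (c : P →* X.L.obj (Et.self X.X))

/-- The restriction to `V` of the sections defined by a homomorphism `P → M(X)`. -/
def chartSec (V : Et X.X) : P →* X.L.obj V :=
  (X.L.res (V := Et.self X.X) (W := V) V.p (Category.comp_id _)).comp c

lemma chartSec_res {V W : Et X.X} (h : W.S ⟶ V.S) (w : h ≫ V.p = W.p) (a : P) :
    X.L.res h w (chartSec X c V a) = chartSec X c W a := by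
  have h1 := X.L.res_res (V := Et.self X.X) V.p (Category.comp_id _) h w
    ((Category.comp_id _).trans w) (c a)
  exact h1.trans (X.L.res_congr (V := Et.self X.X) w _ _ (c a))

/-- The log structure associated with `P → 𝒪_X`. -/
def chartPres : LogPres X.X where
  G _ := ULift.{1} P
  gres _ _ g := g
  gres_id _ _ := rfl
  gres_gres _ _ _ _ _ _ := rfl
  val {V} g := X.L.α (chartSec X c V g.down)
  val_res h w g := by rw [← chartSec_res X c h w, X.L.α_res]
  rel _ m m' := (m.map ULift.down).prod = (m'.map ULift.down).prod
  rel_res _ _ _ _ h := by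
    rw [Multiset.map_id', Multiset.map_id']
    exact h
  rel_val {V m m'} h := by
    have h' := congrArg (fun a => X.L.α (chartSec X c V a)) h
    simpa only [map_multiset_prod, Multiset.map_map, Function.comp_def] using h'

/-- The canonical morphism to `X` with the log structure associated with `P`. -/
def chartHom : X ⟶ (chartPres X c).logScheme :=
  GenMap.hom (X := X) (f := 𝟙 X.X)
    { map := fun {U V} _ _ g => chartSec X c V g.down
      map_res := fun _ _ _ _ _ _ => rfl
      res_map := fun _ _ k wk _ a => chartSec_res X c k wk _
      α_map := fun {U V} h w a => by
        have w' : h ≫ U.p = V.p := w.trans (Category.comp_id _)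
        change X.L.α _ = fres h (X.L.α _)
        rw [← X.L.α_res h w', chartSec_res]
      rel := fun {U V} _ _ m m' h => by
        have h' := congrArg (chartSec X c V) h
        rw [map_multiset_prod, map_multiset_prod] at h'
        refine (congrArg _ ?_).trans (h'.trans (congrArg _ ?_))
        · exact (Multiset.map_map _ _ m).symm
        · exact Multiset.map_map _ _ m' }

/-- `c : P → M(X)` is a chart: `M` is the log structure associated with `P → 𝒪_X`. -/
def IsChart : Prop := IsIso (chartHom X c)

end Chart

/-- A fine monoid: finitely generated and integral. -/
structure IsFine (P : Type) [CommMonoid P] : Prop where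
  fg : Monoid.FG P
  integral : IsCancelMul P

/-- A (fine) monoid is saturated: an element `a / b` of the group of fractions with a positive power
in `P` is in `P`. -/
def IsSaturated (P : Type) [CommMonoid P] : Prop :=
  ∀ (a b c : P) (n : ℕ), 0 < n → a ^ n = b ^ n * c → ∃ c', a = b * c'

/-- A fine saturated log scheme: étale locally there are charts by fine saturated monoids. -/
def LogScheme.IsFS (X : LogScheme) : Prop :=
  ∀ x : X.X, ∃ V : Et X.X, x ∈ Set.range V.p ∧ ∃ (P : Type) (_ : CommMonoid P),
    IsFine P ∧ IsSaturated P ∧ ∃ c : P →* (X.restrict V).L.obj (Et.self _),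
      IsChart (X.restrict V) c

/-- The morphism `X → Spec ℤ[P]` defined by `P → M(X)`. -/
def chartSpec (X : LogScheme) {P : Type} [CommMonoid P] (c : P →* X.L.obj (Et.self X.X)) :
    X.X ⟶ Spec (.of (MonoidAlgebra ℤ P)) :=
  X.X.toSpecΓ ≫ Spec.map (CommRingCat.ofHom
    (MonoidAlgebra.lift ℤ Γ(X.X, ⊤) P (X.L.α.comp c)).toRingHom)

/-- The morphism `Spec ℤ[P] → Spec ℤ[Q]` defined by `Q → P`. -/
def monoidSpec {Q P : Type} [CommMonoid Q] [CommMonoid P] (φ : Q →* P) :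
    Spec (.of (MonoidAlgebra ℤ P)) ⟶ Spec (.of (MonoidAlgebra ℤ Q)) :=
  Spec.map (CommRingCat.ofHom (MonoidAlgebra.mapDomainRingHom ℤ φ))

/-- The homomorphism `Q^gp → P^gp`. -/
def gpMap {Q P : Type} [CommMonoid Q] [CommMonoid P] (φ : Q →* P) :
    Algebra.GrothendieckGroup Q →* Algebra.GrothendieckGroup P :=
  Algebra.GrothendieckGroup.lift (Algebra.GrothendieckGroup.of.comp φ)

/-- A subgroup is finite, of order invertible on `X`. -/
def FiniteInvertible (X : Scheme.{0}) {G : Type} [Group G] (H : Subgroup G) : Prop :=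
  Finite H ∧ IsUnit ((Nat.card H : ℕ) : Γ(X, ⊤))

/-- Log smooth morphisms: étale locally there are charts `Q`, `P` of target and source by fine
monoids and a homomorphism `Q → P` compatible with the morphism, such that the kernel and the torsion
of the cokernel of `Q^gp → P^gp` are finite of invertible order, and
`X → Y ×_{Spec ℤ[Q]} Spec ℤ[P]` is smooth. -/
def IsLogSmooth {X Y : LogScheme} (f : X ⟶ Y) : Prop :=
  ∀ x : X.X, ∃ (V : Et X.X) (U : Et Y.X) (f' : X.restrict V ⟶ Y.restrict U),
    x ∈ Set.range V.p ∧ f' ≫ Y.restrictHom U = X.restrictHom V ≫ f ∧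
    ∃ (Q P : Type) (_ : CommMonoid Q) (_ : CommMonoid P)
      (cQ : Q →* (Y.restrict U).L.obj (Et.self _)) (cP : P →* (X.restrict V).L.obj (Et.self _))
      (φ : Q →* P),
      IsFine Q ∧ IsFine P ∧ IsChart (Y.restrict U) cQ ∧ IsChart (X.restrict V) cP ∧
      (∀ q, f'.log.map (U := Et.self _) (V := Et.self _) f'.base
        ((Category.comp_id _).trans (Category.id_comp _).symm) (cQ q) = cP (φ q)) ∧
      FiniteInvertible V.S (gpMap φ).ker ∧
      FiniteInvertible V.S
        (CommGroup.torsion (Algebra.GrothendieckGroup P ⧸ (gpMap φ).range)) ∧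
      ∃ k : (X.restrict V).X ⟶ pullback (chartSpec (Y.restrict U) cQ) (monoidSpec φ),
        k ≫ pullback.fst _ _ = f'.base ∧ k ≫ pullback.snd _ _ = chartSpec (X.restrict V) cP ∧
        Smooth k

/-- Integral morphisms of log schemes: `M̄_{Y,f(x)} → M̄_{X,x}` is an integral homomorphism of monoids
at all geometric points, i.e. if `f(a₁) b₁ = f(a₂) b₂` then `b₁ = f(a₃) b`, `b₂ = f(a₄) b` and
`a₁ a₃ = a₂ a₄` for some `a₃`, `a₄`, `b`. Two sections of `M` are associated if they have the same
image in `M̄`. -/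
def IsIntegralLog {X Y : LogScheme} (f : X ⟶ Y) : Prop :=
  ∀ (U : Et Y.X) (V : Et X.X) (h : V.S ⟶ U.S) (w : h ≫ U.p = V.p ≫ f.base) (a₁ a₂ : Y.L.obj U)
    (b₁ b₂ : X.L.obj V), Associated (f.log.map h w a₁ * b₁) (f.log.map h w a₂ * b₂) →
    V.Locally fun V' k wk => ∃ (U' : Et Y.X) (j : U'.S ⟶ U.S) (wj : j ≫ U.p = U'.p)
      (l : V'.S ⟶ U'.S) (wl : l ≫ U'.p = V'.p ≫ f.base) (_ : l ≫ j = k ≫ h)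
      (a₃ a₄ : Y.L.obj U') (b : X.L.obj V'),
      Associated (X.L.res k wk b₁) (f.log.map l wl a₃ * b) ∧
      Associated (X.L.res k wk b₂) (f.log.map l wl a₄ * b) ∧
      Associated (Y.L.res j wj a₁ * a₃) (Y.L.res j wj a₂ * a₄)

/-! ### Marked log smooth curves -/

/-- The sections over `V` of the direct sum of the constant sheaf `ℕ` and the sheaves `x_{i*} ℕ`. -/
abbrev MarkSec {X : Scheme.{0}} {l : ℕ} (x : Fin l → (Spec (.of ℂ) ⟶ X)) (V : Et X) : Type :=
  LocallyConstant V.S ℕ × ∀ i : Fin l, {v : V.S // V.p v ∈ Set.range (x i)} → ℕ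

/-- Restriction. -/
def MarkSec.res {X : Scheme.{0}} {l : ℕ} {x : Fin l → (Spec (.of ℂ) ⟶ X)} {V W : Et X}
    (h : W.S ⟶ V.S) (w : h ≫ V.p = W.p) (r : MarkSec x V) : MarkSec x W :=
  (r.1.comap ⟨h, h.continuous⟩, fun i y => r.2 i ⟨h y.1, by
    rw [← Scheme.Hom.comp_apply, w]; exact y.2⟩)

/-- An isomorphism, on the non-critical locus, of `M̄_C` with the direct sum of the constant sheaf `ℕ`
(generated by `t`) and of the sheaves `x_{i*} ℕ`: a homomorphism on `M_C` which is compatible with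
restriction, locally surjective, and identifies two sections if and only if they differ by a unit. -/
structure Marking {C : LogScheme} (pt : C ⟶ logPoint) {l : ℕ}
    (x : Fin l → (Spec (.of ℂ) ⟶ C.X)) where
  κ : ∀ V : Et C.X, Smooth (V.p ≫ pt.base) → (C.L.obj V →* Multiplicative (MarkSec x V))
  κ_res : ∀ (V W : Et C.X) (hV : Smooth (V.p ≫ pt.base)) (hW : Smooth (W.p ≫ pt.base))
    (h : W.S ⟶ V.S) (w : h ≫ V.p = W.p) (m : C.L.obj V),
    (κ W hW (C.L.res h w m)).toAdd = MarkSec.res h w (κ V hV m).toAdd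
  κ_t : ∀ (V : Et C.X) (hV : Smooth (V.p ≫ pt.base)), (κ V hV (tSec pt V)).toAdd = (1, 0)
  κ_eq : ∀ (V : Et C.X) (hV : Smooth (V.p ≫ pt.base)) (m m' : C.L.obj V),
    κ V hV m = κ V hV m' ↔ Associated m m'
  κ_surj : ∀ (V : Et C.X) (_ : Smooth (V.p ≫ pt.base)) (r : MarkSec x V),
    V.Locally fun W h w => ∃ (hW : Smooth (W.p ≫ pt.base)) (m : C.L.obj W),
      (κ W hW m).toAdd = MarkSec.res h w r

/-- A marked log smooth curve over the standard log point: a log smooth, integral, fine saturated log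
scheme which is a reduced connected separated curve of finite type, with sections `x i` in the
non-critical locus such that `M̄_C` is, on the non-critical locus, the direct sum of the pull-back of
`ℕ` and of the sheaves `x_{i*} ℕ`. -/
structure MarkedCurve where
  C : LogScheme
  pt : C ⟶ logPoint
  fs : C.IsFS
  logSmooth : IsLogSmooth pt
  integral : IsIntegralLog pt
  separated : IsSeparated pt.base
  finType : LocallyOfFiniteType pt.base
  qcpt : QuasiCompact pt.base
  reduced : IsReduced C.X
  connected : ConnectedSpace C.X
  dim : ∀ Z ∈ irreducibleComponents C.X, topologicalKrullDim Z = 1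
  l : ℕ
  x : Fin l → (Spec (.of ℂ) ⟶ C.X)
  x_pt : ∀ i, x i ≫ pt.base = 𝟙 _
  x_smooth : ∀ i, ∃ V : Et C.X, Set.range (x i) ⊆ Set.range V.p ∧ Smooth (V.p ≫ pt.base)
  marking : Nonempty (Marking pt x)

namespace MarkedCurve

variable (D : MarkedCurve)

/-- An irreducible component, as a reduced closed subscheme. -/
def comp (Z : irreducibleComponents D.C.X) : Scheme.{0} :=
  (Scheme.IdealSheafData.vanishingIdeal
    ⟨Z.1, isClosed_of_mem_irreducibleComponents Z.1 Z.2⟩).subscheme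

/-- The inclusion of an irreducible component. -/
def compι (Z : irreducibleComponents D.C.X) : D.comp Z ⟶ D.C.X :=
  (Scheme.IdealSheafData.vanishingIdeal
    ⟨Z.1, isClosed_of_mem_irreducibleComponents Z.1 Z.2⟩).subschemeι

/-- A component is complete if it is proper over `ℂ`. -/
def Complete (Z : irreducibleComponents D.C.X) : Prop := IsProper (D.compι Z ≫ D.pt.base)

end MarkedCurve

/-- The affine line. -/
def A1 : Scheme.{0} := Spec (.of (Polynomial ℂ))

/-- The inclusion `𝔾_m → 𝔸¹` given by `z`, resp. by its inverse. -/
def gmA1 (inv : Bool) : Spec (.of RG) ⟶ A1 :=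
  specMap (Polynomial.aeval (R := ℂ) (if inv then ((zG_unit.unit⁻¹ : RGˣ) : RG) else zG))

/-- A scheme over `ℂ` is isomorphic to the projective line: it is the union of two open affine
lines glued along `𝔾_m` by `z ↦ z⁻¹`. -/
def IsP1 {Z : Scheme.{0}} (p : Z ⟶ Spec (.of ℂ)) : Prop :=
  ∃ a b : A1 ⟶ Z, IsOpenImmersion a ∧ IsOpenImmersion b ∧ a ≫ p = toℂ (Polynomial ℂ) ∧
    b ≫ p = toℂ (Polynomial ℂ) ∧ Set.range a ∪ Set.range b = Set.univ ∧
    IsPullback (gmA1 false) (gmA1 true) a b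

/-- The incidence graph of irreducible components and their intersection points. -/
def incidenceGraph (X : Scheme.{0}) : SimpleGraph (irreducibleComponents X ⊕
    {x : X // ∃ Z ∈ irreducibleComponents X, ∃ Z' ∈ irreducibleComponents X,
      Z ≠ Z' ∧ x ∈ Z ∧ x ∈ Z'}) :=
  SimpleGraph.fromRel fun a b => ∃ Z x, a = Sum.inl Z ∧ b = Sum.inr x ∧ x.1 ∈ Z.1

/-- Genus zero: the complete components are projective lines, and the components form a tree. (The
non-complete components of the domain of a log map are affine lines.) -/
def MarkedCurve.IsRational (D : MarkedCurve) : Prop :=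
  (∀ Z, D.Complete Z → IsP1 (D.compι Z ≫ D.pt.base)) ∧ (incidenceGraph D.C.X).IsTree

/-! ### Log maps and log corals -/

/-- Parametrizations of an irreducible component by the affine line. -/
def MarkedCurve.Param (D : MarkedCurve) (Z : irreducibleComponents D.C.X) : Type :=
  {a : A1 ≅ D.comp Z // a.hom ≫ D.compι Z ≫ D.pt.base = toℂ (Polynomial ℂ)}

/-- The field `ℂ(z)` of rational functions on the affine line. -/
def specRat : Scheme.{0} := Spec (.of (RatFunc ℂ))

/-- The generic point of a parametrized component. -/
def MarkedCurve.genPt (D : MarkedCurve) {Z : irreducibleComponents D.C.X} (a : D.Param Z) :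
    specRat ⟶ D.C.X :=
  Spec.map (CommRingCat.ofHom (algebraMap (Polynomial ℂ) (RatFunc ℂ))) ≫ a.1.hom ≫ D.compι Z

/-- Log maps from a marked log smooth curve to a log scheme over the standard log point with a
function `s`. -/
structure IsLogMap (D : MarkedCurve) {Z : LogScheme} (ptZ : Z ⟶ logPoint) (sZ : Z.X ⟶ Aff)
    (f : D.C ⟶ Z) : Prop where
  over_pt : f ≫ ptZ = D.pt
  affine : ∀ C', ¬ D.Complete C' → Nonempty (D.Param C')
  dominant : ∀ C', ¬ D.Complete C' → IsDominant (D.compι C' ≫ f.base ≫ sZ)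
  marked : ∀ i, fres (D.x i ≫ f.base ≫ sZ) (AffineSpace.coord _ PUnit.unit) = 0
  stable : {φ : D.C ≅ D.C | φ.hom ≫ D.pt = D.pt ∧ (∀ i, D.x i ≫ φ.hom.base = D.x i) ∧
    φ.hom ≫ f = f}.Finite

/-- A function on `Spec ℂ(z)`, as a rational function. -/
def toRat (r : Γ(specRat, ⊤)) : RatFunc ℂ := (Scheme.ΓSpecIso (.of (RatFunc ℂ))).hom.hom r

/-- The valuation at `z = ∞`: minus the degree. -/
def valInf (r : RatFunc ℂ) : ℤ := -r.intDegree

/-- Asymptotic parallelism of `g : D → Y₀` at `η : Spec ℂ(z) → D`.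

If `η` is mapped to the torus in the component `v` of the chain, the coordinate `z` of this torus
(which is `x_v`, and the inverse of `y_{v-1}`) has valuation `0` at infinity. If `η` is mapped to the
node `j`, then near `η` the sections `x_j` and `y_j` are mapped to `φ_x t^α` and `φ_y t^β` with
invertible `φ_x` and `φ_y`, and `φ_x^β / φ_y^α` has valuation `0` at infinity. -/
def IsParallelAt (b : ℕ+) {D : LogScheme} (τ : D ⟶ logPoint) (η : specRat ⟶ D.X)
    (g : D ⟶ YLog b) : Prop :=
  (∀ (v : ℤ) (h : specRat ⟶ Spec (.of RG)), h ≫ ιG v = η ≫ g.base ≫ toX₀ →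
    valInf (toRat (pullFn h zG)) = 0) ∧
  ∀ (j : ℤ) (h : specRat ⟶ Spec (.of RD)), h ≫ ιD j = η ≫ g.base ≫ toX₀ →
    pullFn h (xD 0) = 0 → pullFn h (xD 1) = 0 →
    ∃ (W : Et D.X) (ζ : specRat ⟶ W.S) (U : Et Y₀) (l : W.S ⟶ U.S)
      (wl : l ≫ U.p = W.p ≫ g.base) (k : U.S ⟶ Spec (.of RD)) (wk : k ≫ ιD j = U.p ≫ toX₀)
      (φx φy : Γ(W.S, ⊤)ˣ) (α β : ℕ),
      ζ ≫ W.p = η ∧ 0 < α ∧ 0 < β ∧ α + β = b ∧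
      g.log.map (U := U) l wl ((YPres b).gen (YGen.x 0 j k wk)) =
        D.L.unitSec φx * tSec τ W ^ α ∧
      g.log.map (U := U) l wl ((YPres b).gen (YGen.x 1 j k wk)) =
        D.L.unitSec φy * tSec τ W ^ β ∧
      valInf (toRat (fres ζ φx) ^ β / toRat (fres ζ φy) ^ α) = 0

/-- Log corals on `Y₀`: log maps which are asymptotically parallel at the non-complete components. -/
structure IsCoralY (b : ℕ+) (D : MarkedCurve) (f : D.C ⟶ YLog b) : Prop extends
    IsLogMap D (YPt b) (sY b) f where
  parallel : ∀ C', ¬ D.Complete C' → ∀ a : D.Param C', IsParallelAt b D.pt (D.genPt a) f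

/-- Log corals on the degenerate Tate curve: log maps which are asymptotically parallel at the
non-complete components; this condition is tested on the étale local lifts to `Y₀`. -/
structure IsCoralT (b : ℕ+) (D : MarkedCurve) (f : D.C ⟶ TLog b) : Prop extends
    IsLogMap D (TPt b) (sT b) f where
  parallel : ∀ C', ¬ D.Complete C' → ∀ a : D.Param C', ∀ (W : Et D.C.X) (ζ : specRat ⟶ W.S),
    ζ ≫ W.p = D.genPt a → ∀ g : D.C.restrict W ⟶ YLog b,
      g ≫ πLog b = D.C.restrictHom W ≫ f → IsParallelAt b (D.C.restrictHom W ≫ D.pt) ζ g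

/-! ### Disjoint unions -/

/-- The log scheme `P` is the disjoint union of the log schemes `X i`, with inclusions `σ i`: these
are strict open immersions with disjoint images which cover `P`. -/
structure IsDisjointUnion {ι : Type} {X : ι → LogScheme} {P : LogScheme} (σ : ∀ i, X i ⟶ P) :
    Prop where
  openImm : ∀ i, IsOpenImmersion (σ i).base
  strict : ∀ i (V : Et (X i).X) (_ : Etale (V.p ≫ (σ i).base)),
    Function.Bijective ((σ i).log.map (U := ⟨V.S, V.p ≫ (σ i).base⟩) (V := V) (𝟙 V.S)
      (Category.id_comp _))
  disjoint : Pairwise fun i j => Disjoint (Set.range (σ i).base) (Set.range (σ j).base)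
  cover : ∀ p : P.X, ∃ i, p ∈ Set.range (σ i).base

end

end TateCoral

open CategoryTheory Limits AlgebraicGeometry

namespace TateCoral

noncomputable section

set_option linter.unusedVariables false

/-! ### Morphisms to affine schemes -/

/-! The chain is a covering of the nodal curve `E` with group the translations, and a tree of
projective and affine lines is simply connected enough for every morphism from it to `E` to lift.
The log structures add nothing to this problem, since the quotient map is strict and étale.

Covering. In the torus charts and away from the nodes, `πX` is an open immersion; near a node it is
standard étale (`nodePair_lift_bijective`), whence `etale_πX`. Translations act freely on points
(`shiftX_free`), and two lifts of one morphism differ locally by a translation (`locally_shift`). On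
a connected scheme they therefore differ by exactly one translation (`exists_shift`), which gives
the uniqueness assertions.

Existence of lifts. On an open part of the affine line the coordinate ring is a principal ideal
domain, and a point of the nodal cubic with `X ≠ 0` over such a ring is given by a coprime pair `[a
: c]`, the point of the normalization above it (`exists_factor_node`); the two branches at the node
then provide local lifts (`hasLocalLift_A1`). On an irreducible scheme, local lifts normalized at
the generic point agree on overlaps and glue (`exists_lift_of_irreducible`), so every component of a
rational curve has a lift. At each intersection point the lifts on the components differ by
integers; as the incidence graph is a tree, these integers are differences of a function on the
vertices (`exists_potential`), and translating the lifts by this function makes them agree at the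
intersection points. Lifts on the components that agree at points glue by étale descent
(`exists_lift_of_closed`). The result is `MarkedCurve.exists_lift`.

Log structure. Invariant sections over a scheme étale over `Y₀` correspond to arbitrary sections
there, because the fibre product with the covering splits locally into translates
(`isStrictEtale_quotMap`). Hence a log lift is the same as a lift of the underlying morphism
(`IsStrictEtale.lift`, `IsStrictEtale.hom_ext`), and the fibre product of log schemes is the étale
fibre product with the restricted log structure (`IsStrictEtale.isPullback`). The translates of one
lift are sections of this fibre product; they are disjoint open immersions covering it
(`isDisjointUnion_sheet`). The coral conditions pass from a morphism to any of its lifts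
(`IsCoralT.isCoralY`). -/

/-- The morphism to an affine scheme defined by a ring homomorphism. -/
def toSpec {T : Scheme.{0}} {A : Type} [CommRing A] (φ : A →+* Γ(T, ⊤)) : T ⟶ Spec (.of A) :=
  T.toSpecΓ ≫ Spec.map (CommRingCat.ofHom φ)

lemma pullFn_toSpec {T : Scheme.{0}} {A : Type} [CommRing A] (φ : A →+* Γ(T, ⊤)) :
    pullFn (toSpec φ) = φ := by
  ext a
  have h := Scheme.ΓSpecIso_inv_naturality (CommRingCat.ofHom φ)
  have h' := congrArg (fun f => f.hom a) h
  simp only [CommRingCat.hom_comp, RingHom.comp_apply, CommRingCat.hom_ofHom] at h'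
  simp only [pullFn, fres, toSpec, RingHom.comp_apply, Scheme.Hom.comp_appTop, CommRingCat.hom_comp]
  rw [← h', Scheme.toSpecΓ_appTop]
  exact congrArg (fun f => f.hom (φ a)) (Scheme.ΓSpecIso Γ(T, ⊤)).inv_hom_id

lemma eq_toSpec {T : Scheme.{0}} {A : Type} [CommRing A] (h : T ⟶ Spec (.of A)) :
    h = toSpec (pullFn h) := by
  have e : CommRingCat.ofHom (pullFn h) = (Scheme.ΓSpecIso (.of A)).inv ≫ h.appTop := rfl
  rw [toSpec, e, Spec.map_comp, ← Category.assoc, ← Scheme.toSpecΓ_naturality, Category.assoc,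
    toSpecΓ_SpecMap_ΓSpecIso_inv, Category.comp_id]

lemma toSpec_ext {T : Scheme.{0}} {A : Type} [CommRing A] {h k : T ⟶ Spec (.of A)}
    (e : pullFn h = pullFn k) : h = k := by rw [eq_toSpec h, e, ← eq_toSpec k]

lemma pullFn_specMap {T : Scheme.{0}} {A B : Type} [CommRing A] [Algebra ℂ A] [CommRing B]
    [Algebra ℂ B] (h : T ⟶ Spec (.of B)) (f : A →ₐ[ℂ] B) (a : A) :
    pullFn (h ≫ specMap f) a = pullFn h (f a) := by
  have h' := congrArg (fun g => g.hom a)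
    (Scheme.ΓSpecIso_inv_naturality (CommRingCat.ofHom f.toRingHom))
  rw [pullFn_comp]
  exact congrArg (fres h) h'.symm

/-- A morphism to the spectrum of a complex algebra makes the functions a complex algebra. -/
abbrev algOf {T : Scheme.{0}} {A : Type} [CommRing A] [Algebra ℂ A] (h : T ⟶ Spec (.of A)) :
    Algebra ℂ Γ(T, ⊤) := ((pullFn h).comp (algebraMap ℂ A)).toAlgebra

/-- The pull-back of functions as a homomorphism of complex algebras. -/
def pullAlg {T : Scheme.{0}} {A : Type} [CommRing A] [Algebra ℂ A] (h : T ⟶ Spec (.of A)) :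
    letI := algOf h
    A →ₐ[ℂ] Γ(T, ⊤) :=
  letI := algOf h
  { pullFn h with commutes' := fun _ => rfl }

/-- Invertibility of a function can be tested on germs, and at the points of its basic open set the
germs of `r` are units by definition. -/
lemma isUnit_res_basicOpen {T : Scheme.{0}} (r : Γ(T, ⊤)) :
    IsUnit (fres (T.basicOpen r).ι r) := by
  have h : (T.basicOpen r).ι ⁻¹ᵁ T.basicOpen r = ⊤ := by simp
  rw [Scheme.preimage_basicOpen] at h
  refine RingedSpace.isUnit_of_isUnit_germ _ _ _ fun x _ => ?_
  have hx : x ∈ (⊤ : (T.basicOpen r).toScheme.Opens) := trivial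
  rw [← h] at hx
  exact (Scheme.mem_basicOpen_top _ _ _).1 hx

/-- The functions vanishing at a point. -/
def vanishingAt {T : Scheme.{0}} (t : T) : Ideal Γ(T, ⊤) :=
  (IsLocalRing.maximalIdeal (T.presheaf.stalk t)).comap (T.presheaf.germ ⊤ t trivial).hom

lemma mem_vanishingAt {T : Scheme.{0}} {t : T} {r : Γ(T, ⊤)} :
    r ∈ vanishingAt t ↔ t ∉ T.basicOpen r := by
  rw [Scheme.mem_basicOpen_top]
  exact Iff.rfl

/-- Such an `r` has value `1` at `t`. At a node the coordinates `x` and `y` vanish, so this makes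
expressions of the form `1` plus multiples of `x` and `y` invertible nearby. -/
lemma mem_basicOpen_of_sub {T : Scheme.{0}} {t : T} {r : Γ(T, ⊤)} (h : r - 1 ∈ vanishingAt t) :
    t ∈ T.basicOpen r := by
  by_contra hr
  have h1 := (vanishingAt t).sub_mem (mem_vanishingAt.2 hr) h
  rw [sub_sub_cancel, mem_vanishingAt, Scheme.basicOpen_of_isUnit _ isUnit_one] at h1
  exact h1 trivial

lemma mem_basicOpen_pullFn {T : Scheme.{0}} {A : Type} [CommRing A] (h : T ⟶ Spec (.of A)) (a : A)
    (t : T) : t ∈ T.basicOpen (pullFn h a) ↔ a ∉ (h t).asIdeal := by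
  have e : h ⁻¹ᵁ (Spec (.of A)).basicOpen ((Scheme.ΓSpecIso (.of A)).inv a) =
      T.basicOpen (pullFn h a) := Scheme.preimage_basicOpen _ _
  rw [← e]
  exact Iff.of_eq (congrArg (h t ∈ ·) (basicOpen_eq_of_affine (R := .of A) a))

/-- A morphism to `D` on which `x` is invertible factors through the first branch. -/
lemma factor_φ₀ {T : Scheme.{0}} (h : T ⟶ Spec (.of RD)) (hx : IsUnit (pullFn h (xD 0))) :
    ∃ k : T ⟶ Spec (.of RW), k ≫ specMap φ₀ = h := by
  let _ := algOf h
  have hy : pullFn h (xD 1) = 0 := by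
    have := congrArg (pullFn h) xD_mul
    rw [map_mul, map_zero] at this
    exact hx.mul_right_eq_zero.1 this
  have hd := dD_unit.map (pullFn h)
  rw [map_sub, map_sub, map_one, hy, sub_zero] at hd
  refine ⟨toSpec (liftW _ hx hd).toRingHom, toSpec_ext ?_⟩
  have : (liftW _ hx hd).comp φ₀ = pullAlg h := by
    refine RD_ext fun i => ?_
    fin_cases i
    · simp [φ₀]; rfl
    · simp [φ₀]; exact hy.symm
  ext a
  rw [pullFn_specMap, pullFn_toSpec]
  exact DFunLike.congr_fun this a

/-- A morphism to `D` on which `y` is invertible factors through the second branch. -/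
lemma factor_φ₁ {T : Scheme.{0}} (h : T ⟶ Spec (.of RD)) (hy : IsUnit (pullFn h (xD 1))) :
    ∃ k : T ⟶ Spec (.of RW), k ≫ specMap φ₁ = h := by
  let _ := algOf h
  have hx : pullFn h (xD 0) = 0 := by
    have := congrArg (pullFn h) xD_mul
    rw [map_mul, map_zero] at this
    exact hy.mul_left_eq_zero.1 this
  have hd := dD_unit.map (pullFn h)
  rw [map_sub, map_sub, map_one, hx, sub_zero] at hd
  have hd' : IsUnit (1 - ((hy.unit⁻¹ : _ˣ) : Γ(T, ⊤))) := by
    have e : 1 - ((hy.unit⁻¹ : _ˣ) : Γ(T, ⊤)) =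
        -(1 - pullFn h (xD 1)) * ((hy.unit⁻¹ : _ˣ) : Γ(T, ⊤)) := by
      have := hy.mul_val_inv
      linear_combination -this
    rw [e]
    exact hd.neg.mul (Units.isUnit _)
  refine ⟨toSpec (liftW _ (Units.isUnit hy.unit⁻¹) hd').toRingHom, toSpec_ext ?_⟩
  have : (liftW _ (Units.isUnit hy.unit⁻¹) hd').comp φ₁ = pullAlg h := by
    refine RD_ext fun i => ?_
    fin_cases i
    · simp [φ₁]; exact hx.symm
    · refine eq_of_mul_eq_one' (a := liftW _ (Units.isUnit hy.unit⁻¹) hd' zW) ?_ ?_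
      · change _ * liftW _ (Units.isUnit hy.unit⁻¹) hd' (φ₁ (xD 1)) = 1
        rw [← map_mul]
        simp [φ₁]
      · rw [liftW_z]
        exact hy.val_inv_mul
  ext a
  rw [pullFn_specMap, pullFn_toSpec]
  exact DFunLike.congr_fun this a

/-- If the morphisms on which `a` is invertible factor through `Spec B`, then so do the points at
which `a` does not vanish. -/
lemma mem_range_of_factor {A B : Type} [CommRing A] [Algebra ℂ A] [CommRing B] [Algebra ℂ B]
    (f : A →ₐ[ℂ] B) (a : A) (H : ∀ {T : Scheme.{0}} (h : T ⟶ Spec (.of A)), IsUnit (pullFn h a) →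
      ∃ k : T ⟶ Spec (.of B), k ≫ specMap f = h) (d : Spec (.of A)) (hd : a ∉ d.asIdeal) :
    ∃ w, specMap f w = d := by
  let U := (Spec (.of A)).basicOpen (pullFn (𝟙 (Spec (.of A))) a)
  -- The hypothesis is tested on the universal case, the inclusion of the open subscheme where `a`
  -- is invertible.
  obtain ⟨k, hk⟩ := H U.ι (by
    have := isUnit_res_basicOpen (pullFn (𝟙 (Spec (.of A))) a)
    rwa [← pullFn_comp, Category.comp_id] at this)
  have hd : d ∈ U := (mem_basicOpen_pullFn _ _ _).2 hd
  obtain ⟨u, hu⟩ : ∃ u : U.toScheme, U.ι u = d := ⟨⟨d, hd⟩, rfl⟩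
  exact ⟨k u, by rw [← Scheme.Hom.comp_apply, hk, hu]⟩

lemma not_mem_φ₀ (w : Spec (.of RW)) : xD 0 ∉ (specMap φ₀ w).asIdeal := fun hm => by
  have : φ₀ (xD 0) ∈ w.asIdeal := hm
  rw [φ₀, liftD_x] at this
  exact w.2.ne_top (Ideal.eq_top_of_isUnit_mem _ this zW_unit)

lemma not_mem_φ₁ (w : Spec (.of RW)) : xD 1 ∉ (specMap φ₁ w).asIdeal := fun hm => by
  have : φ₁ (xD 1) ∈ w.asIdeal := hm
  rw [φ₁, liftD_y] at this
  exact w.2.ne_top (Ideal.eq_top_of_isUnit_mem _ this (Units.isUnit _))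

/-! ### The points of the chain and of the nodal curve -/

/-- A point of the chain is in the torus of a component or a node. -/
lemma X₀_cases (x : X₀) : (∃ v g, ιG v g = x) ∨
    ∃ j d, ιD j d = x ∧ xD 0 ∈ d.asIdeal ∧ xD 1 ∈ d.asIdeal := by
  have hW : ∀ v (w : Spec (.of RW)), ιG v (specMap Cell.wg w) = ιD v (specMap φ₀ w) := fun v w => by
    rw [← Scheme.Hom.comp_apply, ← glue₀, Scheme.Hom.comp_apply]
  -- The branch `x = 0` at the node `v` belongs to the component `v + 1`, which accounts for the
  -- index shift between the two branches.
  have hW' : ∀ v (w : Spec (.of RW)), ιG (v + 1) (specMap Cell.wg w) = ιD v (specMap φ₁ w) :=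
    fun v w => by
      have := glue₁ (v + 1)
      rw [add_sub_cancel_right] at this
      rw [← Scheme.Hom.comp_apply, ← this, Scheme.Hom.comp_apply]
  obtain ⟨c, y, hy⟩ := Scheme.IsLocallyDirected.ι_jointly_surjective Cell.diag x
  cases c with
  | comp v => exact .inl ⟨v, y, hy⟩
  | overlap v =>
    have h2 := colimit.w Cell.diag (homOfLE (show Cell.overlap v ≤ Cell.comp v from rfl))
    refine .inl ⟨v, specMap Cell.wg y, ?_⟩
    rw [← hy, ← h2]
    rfl
  | node j =>
    by_cases h0 : xD 0 ∈ PrimeSpectrum.asIdeal (R := RD) y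
    · by_cases h1 : xD 1 ∈ PrimeSpectrum.asIdeal (R := RD) y
      · exact .inr ⟨j, y, hy, h0, h1⟩
      · obtain ⟨w, hw⟩ := mem_range_of_factor _ _ factor_φ₁ y h1
        exact .inl ⟨j + 1, specMap Cell.wg w, by rw [hW', hw]; exact hy⟩
    · obtain ⟨w, hw⟩ := mem_range_of_factor _ _ factor_φ₀ y h0
      exact .inl ⟨j, specMap Cell.wg w, by rw [hW, hw]; exact hy⟩

/-- Points of two cells are identified in the colimit only through a cell contained in both, and the
only cells below a torus are itself and the overlap with the same index. -/
lemma ιG_inj {v v' : ℤ} {g g' : Spec (.of RG)} (h : ιG v g = ιG v' g') : v = v' := by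
  obtain ⟨k, f, f', -⟩ := Scheme.IsLocallyDirected.ι_eq_ι_iff Cell.diag |>.1 h
  have h1 : Cell.Le k _ := leOfHom f
  have h2 : Cell.Le k _ := leOfHom f'
  cases k with
  | node => exact h1.elim
  | comp w => exact h1.symm.trans h2
  | overlap w => exact h1.symm.trans h2

/-- The charts of neighbouring nodes do meet, along an overlap cell. Both images of an overlap in a
node chart miss the node itself, because `x` or `y` is invertible on them; hence the vanishing
conditions on `d`. -/
lemma ιD_inj {j j' : ℤ} {d d' : Spec (.of RD)} (h : ιD j d = ιD j' d') (h0 : xD 0 ∈ d.asIdeal)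
    (h1 : xD 1 ∈ d.asIdeal) : j = j' := by
  obtain ⟨k, f, f', y, hy, -⟩ := Scheme.IsLocallyDirected.ι_eq_ι_iff Cell.diag |>.1 h
  have h2 : Cell.Le k _ := leOfHom f
  have h3 : Cell.Le k _ := leOfHom f'
  cases k with
  | node => exact h2.symm.trans h3
  | comp w => exact h2.elim
  | overlap w =>
    change (if j = w then specMap φ₀ else specMap φ₁) y = d at hy
    split_ifs at hy
    · exact (not_mem_φ₀ y (hy ▸ h0)).elim
    · exact (not_mem_φ₁ y (hy ▸ h1)).elim

/-- Translations act freely on the points of the chain. -/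
lemma shiftX_free {n : ℤ} {x : X₀} (h : shiftX n x = x) : n = 0 := by
  rcases X₀_cases x with ⟨v, g, rfl⟩ | ⟨j, d, rfl, h0, h1⟩
  · rw [← Scheme.Hom.comp_apply, ιG_shiftX] at h
    have := ιG_inj h
    omega
  · rw [← Scheme.Hom.comp_apply, ιD_shiftX] at h
    have := ιD_inj h h0 h1
    omega

/-! ### Schemes glued from two open charts -/

section pushout

variable {A B C : Scheme.{0}} (f : A ⟶ B) (g : A ⟶ C) [IsOpenImmersion f] [IsOpenImmersion g]

instance isOpenImmersion_pushout_inl : IsOpenImmersion (pushout.inl f g) :=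
  inferInstanceAs (IsOpenImmersion (colimit.ι (span f g) .left))

instance isOpenImmersion_pushout_inr : IsOpenImmersion (pushout.inr f g) :=
  inferInstanceAs (IsOpenImmersion (colimit.ι (span f g) .right))

/-- The two charts cover a scheme glued from two charts. -/
lemma pushout_cases (e : ↥(pushout f g)) :
    (∃ c, pushout.inr f g c = e) ∨ ∃ b, pushout.inl f g b = e := by
  obtain ⟨c, y, hy⟩ := Scheme.IsLocallyDirected.ι_jointly_surjective (span f g) e
  rcases c with _ | _ | _
  · have h := colimit.w (span f g) WalkingSpan.Hom.snd
    refine .inl ⟨(span f g).map WalkingSpan.Hom.snd y, ?_⟩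
    rw [← hy, ← h]
    rfl
  · exact .inr ⟨y, hy⟩
  · exact .inl ⟨y, hy⟩

/-- In a scheme glued from two charts, these meet in the scheme along which they are glued. -/
lemma pushout_inr_eq_inl {b : B} {c : C} (h : pushout.inr f g c = pushout.inl f g b) :
    ∃ a, f a = b := by
  obtain ⟨k, t, t', y, -, hy⟩ := Scheme.IsLocallyDirected.ι_eq_ι_iff (span f g) (i := .right)
    (j := .left) |>.1 h
  -- Only the apex of the span maps to both feet, so all other combinations of arrows are void.
  rcases t with _ | _
  · rcases t' with _ | _
  · rcases t' with _ | _
    exact ⟨y, hy⟩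

end pushout

instance : IsOpenImmersion ιN := isOpenImmersion_pushout_inl _ _

instance : IsOpenImmersion ιE := isOpenImmersion_pushout_inr _ _

lemma E_cases (e : E) : (∃ g, ιE g = e) ∨ ∃ n, ιN n = e := pushout_cases _ _ e

/-- The two charts of the nodal curve meet in `W`, on which `X = z / (1 - z)²` is invertible; so a
point of the cubic with `X = 0` is not in the torus. -/
lemma ιE_ne_ιN {g : Spec (.of RG)} {n : Spec (.of RN)} (h : ιE g = ιN n)
    (h0 : xN 0 ∈ n.asIdeal) : False := by
  obtain ⟨y, rfl⟩ := pushout_inr_eq_inl _ _ h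
  have : ψW (xN 0) ∈ y.asIdeal := h0
  rw [ψW, liftN_x] at this
  exact y.2.ne_top (Ideal.eq_top_of_isUnit_mem _ this (zW_unit.mul ((Units.isUnit _).pow 2)))

lemma ψD_x : ψD (xN 0) = (xD 0 + xD 1) * ((dD_unit.unit⁻¹ : RDˣ) : RD) ^ 2 := liftN_x _ _ _

lemma ψD_y : ψD (xN 1) = (xD 0 ^ 2 - xD 1) * ((dD_unit.unit⁻¹ : RDˣ) : RD) ^ 3 := liftN_y _ _ _

/-- The node is not mapped to the torus of the nodal curve. -/
lemma πX_ne {v j : ℤ} {g : Spec (.of RG)} {d : Spec (.of RD)}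
    (h : πX (ιG v g) = πX (ιD j d)) (h0 : xD 0 ∈ d.asIdeal) (h1 : xD 1 ∈ d.asIdeal) : False := by
  rw [← Scheme.Hom.comp_apply, ← Scheme.Hom.comp_apply, πX, ιG_descX, ιD_descX,
    Scheme.Hom.comp_apply] at h
  refine ιE_ne_ιN h ?_
  change ψD (xN 0) ∈ d.asIdeal
  rw [ψD_x]
  exact Ideal.mul_mem_right _ _ (Ideal.add_mem _ h0 h1)

/-! ### The chain as a covering of the nodal curve -/

/-- Pull-backs of functions are only ring homomorphisms, so the complex structure on `B` is taken
from `f` in order to use the extensionality of algebra homomorphisms. -/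
lemma ringHom_RD_ext {B : Type} [CommRing B] {f g : RD →+* B}
    (hc : ∀ c, f (algebraMap ℂ RD c) = g (algebraMap ℂ RD c)) (h : ∀ i, f (xD i) = g (xD i)) :
    f = g := by
  let _ : Algebra ℂ B := (f.comp (algebraMap ℂ RD)).toAlgebra
  let f' : RD →ₐ[ℂ] B := { f with commutes' := fun _ => rfl }
  let g' : RD →ₐ[ℂ] B := { g with commutes' := fun c => (hc c).symm }
  have : f' = g' := RD_ext h
  ext a
  exact DFunLike.congr_fun this a

/-- Near the node, the chart `D` is determined by its image in the nodal curve. -/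
lemma ringHom_RD_eq {B : Type} [CommRing B] {f g : RD →+* B}
    (h : ∀ a, f (ψD a) = g (ψD a)) (h₁ : IsUnit (1 + f (xD 0) + f (xD 1)))
    (h₂ : IsUnit (f ((dD_unit.unit⁻¹ : RDˣ) : RD) + g ((dD_unit.unit⁻¹ : RDˣ) : RD) - 1)) :
    f = g := by
  have hX := h (xN 0)
  have hY := h (xN 1)
  have hf := congrArg f dD_unit.mul_val_inv
  have hg := congrArg g dD_unit.mul_val_inv
  have mf := congrArg f xD_mul
  have mg := congrArg g xD_mul
  rw [ψD_x] at hX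
  rw [ψD_y] at hY
  simp only [map_mul, map_add, map_sub, map_pow, map_one, map_zero] at hX hY hf hg mf mg
  set u := f ((dD_unit.unit⁻¹ : RDˣ) : RD)
  set v := g ((dD_unit.unit⁻¹ : RDˣ) : RD)
  set x := f (xD 0)
  set y := f (xD 1)
  set x' := g (xD 0)
  set y' := g (xD 1)
  -- With `d = 1 - x - y` and `u = 1 / d`, the function `X = (x + y) / d²` equals `u² - u`. Equality
  -- of the two values of `X` says `(u + v - 1) (u - v) = 0`, and the first factor is a unit by
  -- `h₂`.
  have huv : u = v := by
    have h0 : (u + v - 1) * (u - v) = 0 := by linear_combination hX + u * hf - v * hg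
    exact sub_eq_zero.1 (h₂.mul_right_eq_zero.1 h0)
  have hu : IsUnit u := (dD_unit.unit⁻¹).isUnit.map f
  rw [← huv] at hX hY hg
  have he : x + y = x' + y' := (hu.pow 2).mul_left_inj.1 hX
  have hy : x ^ 2 - y = x' ^ 2 - y' := (hu.pow 3).mul_left_inj.1 hY
  -- Put `σ = x + y`. As `x y = 0`, one has `x² = σ x`, so `x² - y = (1 + σ) x - σ`: for given `σ`
  -- this is linear in `x` with invertible coefficient.
  have hx : x = x' := by
    have h0 : (1 + x + y) * (x - x') = 0 := by
      linear_combination hy + (1 - x') * he + mf - mg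
    exact sub_eq_zero.1 (h₁.mul_right_eq_zero.1 h0)
  refine ringHom_RD_ext (fun c => ?_) fun i => ?_
  -- Constants come from the cubic, so the agreement on the image of `ψD` includes them.
  · have := h (algebraMap ℂ RN c)
    rwa [ψD.commutes] at this
  · fin_cases i
    · exact hx
    · change y = y'
      linear_combination he - hx

/-- Two lifts to the chain of a morphism to the nodal curve differ locally by a translation. -/
lemma locally_shift {T : Scheme.{0}} (a b : T ⟶ X₀) (h : a ≫ πX = b ≫ πX) (t : T) :
    ∃ (n : ℤ) (U : T.Opens), t ∈ U ∧ U.ι ≫ b = U.ι ≫ a ≫ shiftX n := by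
  have ht : πX (a t) = πX (b t) := by rw [← Scheme.Hom.comp_apply, h, Scheme.Hom.comp_apply]
  rcases X₀_cases (a t) with ⟨v, g, hg⟩ | ⟨i, d, hd, h0, h1⟩ <;>
    rcases X₀_cases (b t) with ⟨v', g', hg'⟩ | ⟨j, d', hd', h0', h1'⟩
  -- Both points in tori: all tori map to `E` by the same monomorphism `ιE`, so the two lifts have
  -- the same torus coordinate and differ only in the index of the component.
  · let U : T.Opens := a ⁻¹ᵁ (ιG v).opensRange ⊓ b ⁻¹ᵁ (ιG v').opensRange
    obtain ⟨a', ha'⟩ : ∃ a', a' ≫ ιG v = U.ι ≫ a :=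
      ⟨IsOpenImmersion.lift (ιG v) (U.ι ≫ a) (by rintro _ ⟨x, rfl⟩; exact x.2.1),
        IsOpenImmersion.lift_fac _ _ _⟩
    obtain ⟨b', hb'⟩ : ∃ b', b' ≫ ιG v' = U.ι ≫ b :=
      ⟨IsOpenImmersion.lift (ιG v') (U.ι ≫ b) (by rintro _ ⟨x, rfl⟩; exact x.2.2),
        IsOpenImmersion.lift_fac _ _ _⟩
    refine ⟨v' - v, U, ⟨⟨g, hg⟩, ⟨g', hg'⟩⟩, ?_⟩
    have e : a' = b' := by
      rw [← cancel_mono ιE]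
      have h1 : ∀ v, ιG v ≫ πX = ιE := fun v => ιG_descX _ _ _ _ _
      rw [← h1 v, ← Category.assoc, ha', h1, ← h1 v', ← Category.assoc b', hb', Category.assoc,
        Category.assoc, h]
    rw [← hb', ← Category.assoc, ← ha', Category.assoc, ιG_shiftX, e, add_sub_cancel]
  · rw [← hg, ← hd'] at ht
    exact (πX_ne ht h0' h1').elim
  · rw [← hd, ← hg'] at ht
    exact (πX_ne ht.symm h0 h1).elim
  -- Both points are nodes. The two coordinate maps to the node chart agree after `ψD`; after
  -- shrinking to where `r₁` and `r₂` are invertible, `ringHom_RD_eq` makes them equal.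
  · let U : T.Opens := a ⁻¹ᵁ (ιD i).opensRange ⊓ b ⁻¹ᵁ (ιD j).opensRange
    obtain ⟨a', ha'⟩ : ∃ a', a' ≫ ιD i = U.ι ≫ a :=
      ⟨IsOpenImmersion.lift (ιD i) (U.ι ≫ a) (by rintro _ ⟨x, rfl⟩; exact x.2.1),
        IsOpenImmersion.lift_fac _ _ _⟩
    obtain ⟨b', hb'⟩ : ∃ b', b' ≫ ιD j = U.ι ≫ b :=
      ⟨IsOpenImmersion.lift (ιD j) (U.ι ≫ b) (by rintro _ ⟨x, rfl⟩; exact x.2.2),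
        IsOpenImmersion.lift_fac _ _ _⟩
    obtain ⟨u, hu⟩ : ∃ u : U.toScheme, U.ι u = t := ⟨⟨t, ⟨⟨d, hd⟩, ⟨d', hd'⟩⟩⟩, rfl⟩
    have e : a' ≫ specMap ψD = b' ≫ specMap ψD := by
      rw [← cancel_mono ιN]
      have h1 : ∀ v, ιD v ≫ πX = specMap ψD ≫ ιN := fun v => ιD_descX _ _ _ _ _
      rw [Category.assoc, ← h1 i, ← Category.assoc, ha', Category.assoc b', ← h1 j,
        ← Category.assoc b', hb', Category.assoc, Category.assoc, h]
    have ea : a' u = d := (ιD i).isOpenEmbedding.injective (by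
      rw [← Scheme.Hom.comp_apply, ha', Scheme.Hom.comp_apply, hu, hd])
    have eb : b' u = d' := (ιD j).isOpenEmbedding.injective (by
      rw [← Scheme.Hom.comp_apply, hb', Scheme.Hom.comp_apply, hu, hd'])
    have va : ∀ k, pullFn a' (xD k) ∈ vanishingAt u := fun k => by
      rw [mem_vanishingAt, mem_basicOpen_pullFn, ea]
      fin_cases k
      · exact not_not.2 h0
      · exact not_not.2 h1
    have vb : ∀ k, pullFn b' (xD k) ∈ vanishingAt u := fun k => by
      rw [mem_vanishingAt, mem_basicOpen_pullFn, eb]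
      fin_cases k
      · exact not_not.2 h0'
      · exact not_not.2 h1'
    let r₁ : Γ(U, ⊤) := 1 + pullFn a' (xD 0) + pullFn a' (xD 1)
    let r₂ : Γ(U, ⊤) := pullFn a' ((dD_unit.unit⁻¹ : RDˣ) : RD) +
      pullFn b' ((dD_unit.unit⁻¹ : RDˣ) : RD) - 1
    have m₁ : u ∈ U.toScheme.basicOpen r₁ := mem_basicOpen_of_sub (by
      have := (vanishingAt u).add_mem (va 0) (va 1)
      convert! this using 1
      simp only [r₁]; ring)
    have m₂ : u ∈ U.toScheme.basicOpen r₂ := mem_basicOpen_of_sub (by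
      have hf := congrArg (pullFn a') dD_unit.mul_val_inv
      have hg := congrArg (pullFn b') dD_unit.mul_val_inv
      simp only [map_mul, map_sub, map_one] at hf hg
      have h1 := (vanishingAt u).mul_mem_left (pullFn a' ((dD_unit.unit⁻¹ : RDˣ) : RD))
        ((vanishingAt u).add_mem (va 0) (va 1))
      have h2 := (vanishingAt u).mul_mem_left (pullFn b' ((dD_unit.unit⁻¹ : RDˣ) : RD))
        ((vanishingAt u).add_mem (vb 0) (vb 1))
      have := (vanishingAt u).add_mem h1 h2
      convert! this using 1
      simp only [r₂]
      linear_combination hf + hg)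
    let O := U.toScheme.basicOpen (r₁ * r₂)
    have hO : u ∈ O := by
      rw [show O = _ from Scheme.basicOpen_mul _ _ _]
      exact ⟨m₁, m₂⟩
    have hr := isUnit_res_basicOpen (r₁ * r₂)
    rw [map_mul] at hr
    have key : O.ι ≫ a' = O.ι ≫ b' := by
      refine toSpec_ext (ringHom_RD_eq (fun c => ?_) ?_ ?_)
      · rw [← pullFn_specMap, ← pullFn_specMap, Category.assoc, e, Category.assoc]
      · have := isUnit_of_mul_isUnit_left hr
        simpa only [r₁, map_add, map_one, ← pullFn_comp] using this
      · have := isUnit_of_mul_isUnit_right hr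
        simpa only [r₂, map_add, map_one, map_sub, ← pullFn_comp] using this
    -- `O` is open in `U`; its image in `T` is the required neighbourhood.
    refine ⟨j - i, U.ι ''ᵁ O, ⟨u, hO, hu⟩, ?_⟩
    have e2 : O.ι ≫ U.ι ≫ b = O.ι ≫ U.ι ≫ a ≫ shiftX (j - i) := by
      rw [← hb', ← Category.assoc U.ι, ← ha', Category.assoc, ιD_shiftX, ← Category.assoc,
        ← Category.assoc, key, add_sub_cancel]
    rw [← U.ι.isoImage_inv_ι O]
    simp only [Category.assoc]
    rw [e2]

lemma shiftX_shiftX (m n : ℤ) : shiftX m ≫ shiftX n = shiftX (m + n) :=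
  X₀_ext (fun j => by rw [← Category.assoc, ιD_shiftX, ιD_shiftX, ιD_shiftX, add_assoc])
    (fun j => by rw [← Category.assoc, ιG_shiftX, ιG_shiftX, ιG_shiftX, add_assoc])

lemma shiftX_zero : shiftX 0 = 𝟙 X₀ :=
  X₀_ext (fun j => by rw [ιD_shiftX, add_zero, Category.comp_id])
    (fun j => by rw [ιG_shiftX, add_zero, Category.comp_id])

lemma shiftX_shiftX_apply (m n : ℤ) (x : X₀) : shiftX n (shiftX m x) = shiftX (m + n) x := by
  rw [← Scheme.Hom.comp_apply, shiftX_shiftX]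

lemma shiftX_inj {m n : ℤ} {x : X₀} (h : shiftX m x = shiftX n x) : m = n := by
  have h1 := congrArg (shiftX (-n)) h
  rw [shiftX_shiftX_apply, shiftX_shiftX_apply, add_neg_cancel, shiftX_zero] at h1
  have := shiftX_free h1
  omega

/-! ### Comparison of two lifts of one morphism -/

section lifts

variable {T : Scheme.{0}} {a b : T ⟶ X₀}

lemma exists_shift_point (h : a ≫ πX = b ≫ πX) (t : T) : ∃ n, b t = shiftX n (a t) := by
  obtain ⟨n, U, hU, e⟩ := locally_shift a b h t
  obtain ⟨u, rfl⟩ : ∃ u : U.toScheme, U.ι u = t := ⟨⟨t, hU⟩, rfl⟩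
  exact ⟨n, by simp only [← Scheme.Hom.comp_apply, Category.assoc, e]⟩

/-- Near a point of this set the lifts differ by a single translation, which freeness forces to be
the one by `n`. -/
lemma isOpen_shift (h : a ≫ πX = b ≫ πX) (n : ℤ) : IsOpen {t | b t = shiftX n (a t)} := by
  rw [isOpen_iff_forall_mem_open]
  intro t ht
  obtain ⟨m, U, hU, e⟩ := locally_shift a b h t
  have key : ∀ s ∈ U, b s = shiftX m (a s) := by
    intro s hs
    obtain ⟨u, rfl⟩ : ∃ u : U.toScheme, U.ι u = s := ⟨⟨s, hs⟩, rfl⟩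
    simp only [← Scheme.Hom.comp_apply, Category.assoc, e]
  obtain rfl : m = n := shiftX_inj ((key t hU).symm.trans ht)
  exact ⟨U, key, U.isOpen, hU⟩

/-- Two lifts which differ by the translation by `n` at every point differ by it. -/
lemma eq_shift_of_forall (h : a ≫ πX = b ≫ πX) (n : ℤ) (H : ∀ t, b t = shiftX n (a t)) : b = a ≫ shiftX n := by
  refine Scheme.hom_ext_of_forall _ _ fun t => ?_
  obtain ⟨m, U, hU, e⟩ := locally_shift a b h t
  obtain ⟨u, rfl⟩ : ∃ u : U.toScheme, U.ι u = t := ⟨⟨t, hU⟩, rfl⟩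
  have h1 : b (U.ι u) = shiftX m (a (U.ι u)) := by
    simp only [← Scheme.Hom.comp_apply, Category.assoc, e]
  obtain rfl : m = n := shiftX_inj (h1.symm.trans (H _))
  exact ⟨U, hU, e⟩

/-- On a connected scheme two lifts differ by a translation. -/
lemma exists_shift (h : a ≫ πX = b ≫ πX) [PreconnectedSpace T] : ∃ n, b = a ≫ shiftX n := by
  rcases isEmpty_or_nonempty T with hT | ⟨⟨t⟩⟩
  · exact ⟨0, eq_shift_of_forall h 0 fun t => (hT.false t).elim⟩
  obtain ⟨n, hn⟩ := exists_shift_point h t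
  refine ⟨n, eq_shift_of_forall h n fun s => ?_⟩
  -- The open sets belonging to the various integers partition `T`, so each of them is also closed.
  have hc : IsClosed {t | b t = shiftX n (a t)} := by
    have e : {t | b t = shiftX n (a t)}ᶜ = ⋃ m ∈ {m : ℤ | m ≠ n}, {t | b t = shiftX m (a t)} := by
      ext s
      simp only [Set.mem_compl_iff, Set.mem_ofPred_eq, Set.mem_iUnion, exists_prop]
      constructor
      · intro hs
        obtain ⟨m, hm⟩ := exists_shift_point h s
        exact ⟨m, fun e => hs (e ▸ hm), hm⟩
      · rintro ⟨m, hm, e⟩ e'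
        exact hm (shiftX_inj (e.symm.trans e'))
    rw [← isOpen_compl_iff, e]
    exact isOpen_biUnion fun m _ => isOpen_shift h m
  have := IsClopen.eq_univ ⟨hc, isOpen_shift h n⟩ ⟨t, hn⟩
  exact this.ge (Set.mem_univ s)

end lifts

/-- The projections of the fibre product of the chain with itself over `E` are two lifts of one
morphism; they are compared at a point above `(x, y)`. -/
lemma exists_shift_of_πX_eq {x y : X₀} (h : πX x = πX y) : ∃ n, y = shiftX n x := by
  obtain ⟨p, rfl, rfl⟩ := Scheme.Pullback.exists_preimage_pullback (f := πX) (g := πX) x y h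
  exact exists_shift_point pullback.condition p

/-! ### The covering is étale -/

/-- The neighbourhood of the node on which the covering is standard étale. -/
abbrev RD' : Type := Localization.Away (1 + xD 0 + xD 1)

/-- The homomorphism from the coordinate ring of the nodal cubic. -/
def ψD' : RN →+* RD' := (algebraMap RD RD').comp ψD.toRingHom

/-- The standard étale pair `(U² - U - X, U (2 U - 1))` over the coordinate ring of the nodal
cubic. -/
def nodePair : StandardEtalePair RN where
  f := Polynomial.X ^ 2 - Polynomial.X - Polynomial.C (xN 0)
  monic_f := by monicity!
  g := Polynomial.X * (2 * Polynomial.X - 1)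
  -- The derivative of `U² - U - X` is `2 U - 1`, and `U` times it is exactly `g`.
  cond := ⟨Polynomial.X, 0, 1, by simp; ring⟩

lemma nodePair_hasMap_iff {S : Type} [CommRing S] [Algebra RN S] (u : S) : nodePair.HasMap u ↔
    u ^ 2 - u - algebraMap RN S (xN 0) = 0 ∧ IsUnit (u * (2 * u - 1)) := by
  have h2 : Polynomial.aeval u (2 : Polynomial RN) = 2 := map_ofNat _ 2
  simp [StandardEtalePair.HasMap, nodePair, h2]

/-- The parameter is `u = 1 / (1 - x - y)`. It satisfies `u² - u = X`, and `2 u - 1 = u (1 + x +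
y)`, which is why `1 + x + y` has been inverted. Conversely `u` and `Y` determine `x` and `y`
rationally, which gives the inverse homomorphism. -/
lemma nodePair_lift_bijective : letI := ψD'.toAlgebra
    ∃ h : nodePair.HasMap (algebraMap RD RD' ((dD_unit.unit⁻¹ : RDˣ) : RD)),
      Function.Bijective (nodePair.lift _ h) := by
  let _ := ψD'.toAlgebra
  let j := algebraMap RD RD'
  have hj : ∀ a : RN, algebraMap RN RD' a = j (ψD a) := fun _ => rfl
  have hd := congrArg j dD_unit.mul_val_inv
  have hm := congrArg j xD_mul
  have h1 : IsUnit (j (1 + xD 0 + xD 1)) := IsLocalization.Away.algebraMap_isUnit _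
  have hu : IsUnit (j ((dD_unit.unit⁻¹ : RDˣ) : RD)) := (dD_unit.unit⁻¹).isUnit.map j
  have hX := congrArg j ψD_x
  have hY := congrArg j ψD_y
  simp only [map_mul, map_add, map_sub, map_pow, map_one, map_zero] at hd hm h1 hX hY
  set u := j ((dD_unit.unit⁻¹ : RDˣ) : RD) with hu_def
  set x := j (xD 0)
  set y := j (xD 1)
  have h : nodePair.HasMap u := by
    rw [nodePair_hasMap_iff]
    constructor
    · rw [hj, hX]
      linear_combination u * hd
    · refine hu.mul ?_
      have : 2 * u - 1 = u * (1 + x + y) := by linear_combination hd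
      rw [this]
      exact hu.mul h1
  refine ⟨h, ?_⟩
  let P := nodePair.Ring
  let i := algebraMap RN P
  let _ : Algebra ℂ P := (i.comp (algebraMap ℂ RN)).toAlgebra
  let U : P := nodePair.X
  obtain ⟨hU1, hU2⟩ := (nodePair_hasMap_iff U).1 nodePair.hasMap_X
  have hU : IsUnit U := isUnit_of_mul_isUnit_left hU2
  have hU' : IsUnit (2 * U - 1) := isUnit_of_mul_isUnit_right hU2
  have hU1 : U ^ 2 - U - i (xN 0) = 0 := hU1
  obtain ⟨d, hUd⟩ : ∃ d, U * d = 1 := ⟨_, hU.mul_val_inv⟩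
  have hdu : IsUnit d := IsUnit.of_mul_eq_one U (by rw [mul_comm]; exact hUd)
  have he : IsUnit (2 - d) := by
    have : 2 - d = (2 * U - 1) * d := by linear_combination -2 * hUd
    rw [this]
    exact hU'.mul hdu
  obtain ⟨c, hc⟩ : ∃ c, (2 - d) * c = 1 := ⟨_, he.mul_val_inv⟩
  have hN : i (xN 1) ^ 2 + i (xN 0) * i (xN 1) - i (xN 0) ^ 3 = 0 := by
    have := congrArg i xN_rel
    simpa only [map_mul, map_add, map_sub, map_pow, map_zero] using this
  have hX0 : i (xN 0) * d ^ 2 = 1 - d := by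
    linear_combination (-d ^ 2) * hU1 + (U * d + 1 - d) * hUd
  -- By `hX0`, `1 - d = X d²`, and the product becomes `-d⁶ (Y² + X Y - X³)`.
  have hxy : (i (xN 1) * d ^ 3 + (1 - d)) * ((1 - d) ^ 2 - i (xN 1) * d ^ 3) = 0 := by
    linear_combination (-d ^ 6) * hN + (i (xN 1) * d ^ 4
      - (i (xN 0) * d ^ 2) ^ 2 - (i (xN 0) * d ^ 2) * (1 - d) - (1 - d) ^ 2) * hX0
  -- The solution of `x + y = 1 - d` and `x² - y = Y d³` under `x y = 0`: these give `(2 - d) x = Y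
  -- d³ + (1 - d)`, and `c` is the inverse of `2 - d`.
  let x' : P := (i (xN 1) * d ^ 3 + (1 - d)) * c
  let y' : P := ((1 - d) ^ 2 - i (xN 1) * d ^ 3) * c
  have hs : x' + y' = 1 - d := by
    simp only [x', y']
    linear_combination (1 - d) * hc
  have hxy' : x' * y' = 0 := by
    simp only [x', y']
    linear_combination c ^ 2 * hxy
  have hd' : 1 - x' - y' = d := by linear_combination -hs
  let g₀ : RD →ₐ[ℂ] P := liftD x' y' hxy' (by rw [hd']; exact hdu)
  have g0 : g₀ (xD 0) = x' := liftD_x _ _ _ _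
  have g1 : g₀ (xD 1) = y' := liftD_y _ _ _ _
  have gu : g₀ ((dD_unit.unit⁻¹ : RDˣ) : RD) = U := by
    have := congrArg g₀ dD_unit.mul_val_inv
    simp only [map_mul, map_sub, map_one, g0, g1, hd'] at this
    exact eq_of_mul_eq_one' this (by rw [mul_comm]; exact hUd)
  let g : RD' →ₐ[ℂ] P := awayLift _ g₀ (by
    rw [map_add, map_add, map_one, g0, g1, add_assoc, hs]
    convert he using 1; ring)
  have gj : ∀ a, g (j a) = g₀ a := awayLift_algebraMap _ _ _
  have hgRN : ∀ a : RN, g (algebraMap RN RD' a) = i a := by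
    let iA : RN →ₐ[ℂ] P := { i with commutes' := fun _ => rfl }
    have : g₀.comp ψD = iA := by
      refine RN_ext fun k => ?_
      fin_cases k
      · change g₀ (ψD (xN 0)) = i (xN 0)
        rw [ψD_x, map_mul, map_add, map_pow, gu, g0, g1, hs]
        linear_combination hU1 - U * hUd
      · change g₀ (ψD (xN 1)) = i (xN 1)
        rw [ψD_y, map_mul, map_sub, map_pow, map_pow, gu, g0, g1]
        have : x' ^ 2 - y' = i (xN 1) * d ^ 3 := by
          have h3 : x' * (2 - d) = i (xN 1) * d ^ 3 + (1 - d) := by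
            simp only [x']
            linear_combination (i (xN 1) * d ^ 3 + (1 - d)) * hc
          linear_combination h3 + (x' - 1) * hs - hxy'
        rw [this]
        linear_combination i (xN 1) * (U ^ 2 * d ^ 2 + U * d + 1) * hUd
    intro a
    rw [hj, gj]
    exact DFunLike.congr_fun this a
  let gN : RD' →ₐ[RN] P := { g.toRingHom with commutes' := hgRN }
  have c1 : ∀ p, gN (nodePair.lift u h p) = p := by
    have : gN.comp (nodePair.lift u h) = AlgHom.id RN P := nodePair.hom_ext (by
      rw [AlgHom.comp_apply, nodePair.lift_X]
      exact (gj _).trans gu)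
    exact DFunLike.congr_fun this
  -- The composite is an endomorphism of a localization of `RD` and is checked on `x` and `y`; both
  -- maps are viewed as homomorphisms of complex algebras, since `RD_ext` needs this.
  have c2 : ∀ r, nodePair.lift u h (gN r) = r := by
    let l : P →ₐ[ℂ] RD' := { (nodePair.lift u h).toRingHom with
      commutes' := fun z => by
        refine ((nodePair.lift u h).commutes (algebraMap ℂ RN z)).trans ?_
        rw [hj, ψD.commutes]
        exact (IsScalarTower.algebraMap_apply ℂ RD RD' z).symm }
    have li : ∀ a, l (i a) = j (ψD a) := fun a => (nodePair.lift u h).commutes a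
    have lU : l U = u := nodePair.lift_X u h
    have ld : l d = 1 - x - y := by
      have := congrArg l hUd
      rw [map_mul, lU, map_one] at this
      exact eq_of_mul_eq_one' this (by rw [mul_comm]; exact hd)
    have lc : (1 + x + y) * l c = 1 := by
      have := congrArg l hc
      rw [map_mul, map_sub, ld, map_one, map_ofNat] at this
      linear_combination this
    have lx : l x' = x := by
      simp only [x', map_mul, map_add, map_sub, map_pow, map_one, li, ld, hY]
      have e : (x ^ 2 - y) * u ^ 3 * (1 - x - y) ^ 3 + (1 - (1 - x - y)) = x * (1 + x + y) := by
        linear_combination (x ^ 2 - y) * (((1 - x - y) * u) ^ 2 + (1 - x - y) * u + 1) * hd - hm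
      rw [e]
      linear_combination x * lc
    have ly : l y' = y := by
      have : y' = 1 - d - x' := by linear_combination hs
      rw [this, map_sub, map_sub, map_one, ld, lx]
      ring
    have : l.comp g = AlgHom.id ℂ RD' := IsLocalization.algHom_ext
      (Submonoid.powers (1 + xD 0 + xD 1)) (RD_ext fun k => by
        fin_cases k
        · change l (g (j (xD 0))) = x
          rw [gj, g0, lx]
        · change l (g (j (xD 1))) = y
          rw [gj, g1, ly])
    exact DFunLike.congr_fun this
  exact Function.bijective_iff_has_inverse.2 ⟨gN, c1, c2⟩

lemma etale_ψD' : ψD'.Etale := by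
  let _ := ψD'.toAlgebra
  obtain ⟨h, hb⟩ := nodePair_lift_bijective
  have : Algebra.IsStandardEtale RN RD' := ⟨⟨⟨nodePair, _, h, hb⟩⟩⟩
  exact inferInstanceAs (Algebra.Etale RN RD')

lemma etale_of_locally {X Y : Scheme.{0}} (f : X ⟶ Y)
    (H : ∀ x : X, ∃ (V : Scheme.{0}) (j : V ⟶ X), IsOpenImmersion j ∧ x ∈ Set.range j ∧
      Etale (j ≫ f)) : Etale f := by
  choose V j hj hx hf using H
  let 𝒰 : X.OpenCover := {
    I₀ := X, X i := V i, f i := j i,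
    mem₀ := by
      rw [Scheme.presieve₀_mem_precoverage_iff]
      exact ⟨fun x => ⟨x, hx x⟩, hj⟩ }
  have : IsZariskiLocalAtSource (@Etale : MorphismProperty Scheme.{0}) :=
    HasRingHomProperty.instIsZariskiLocalAtSource (Q := RingHom.Etale)
  exact (IsZariskiLocalAtSource.iff_of_openCover (P := @Etale) 𝒰).2 hf

/-- The standard étale description is available only where `1 + x + y` is invertible, which includes
the node. At every other point `x` or `y` is invertible, the point lies on one of the branches `φ₀`,
`φ₁`, and on either of them `ψD` restricts to the open immersion `ψW`. -/
instance : Etale (specMap ψD) := by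
  refine etale_of_locally _ fun d => ?_
  by_cases h0 : xD 0 ∈ d.asIdeal
  · by_cases h1 : xD 1 ∈ d.asIdeal
    · refine ⟨_, Spec.map (CommRingCat.ofHom (algebraMap RD RD')), inferInstance, ?_, ?_⟩
      · have : 1 + xD 0 + xD 1 ∉ d.asIdeal := fun h => by
          have h2 := d.asIdeal.sub_mem (d.asIdeal.sub_mem h h1) h0
          rw [add_sub_cancel_right, add_sub_cancel_right] at h2
          exact d.2.ne_top ((Ideal.eq_top_iff_one _).2 h2)
        have hr := PrimeSpectrum.localization_away_comap_range RD' (1 + xD 0 + xD 1)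
        exact hr.ge this
      · rw [← Spec.map_comp, ← CommRingCat.ofHom_comp]
        exact (HasRingHomProperty.Spec_iff (P := @Etale)).2 etale_ψD'
    · obtain ⟨w, hw⟩ := mem_range_of_factor _ _ factor_φ₁ d h1
      refine ⟨_, specMap φ₁, inferInstance, ⟨w, hw⟩, ?_⟩
      have : specMap φ₁ ≫ specMap ψD = specMap ψW := by
        rw [← φ₁_ψD, ← Spec.map_comp, ← CommRingCat.ofHom_comp]; rfl
      rw [this]
      infer_instance
  · obtain ⟨w, hw⟩ := mem_range_of_factor _ _ factor_φ₀ d h0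
    refine ⟨_, specMap φ₀, inferInstance, ⟨w, hw⟩, ?_⟩
    have : specMap φ₀ ≫ specMap ψD = specMap ψW := by
      rw [← φ₀_ψD, ← Spec.map_comp, ← CommRingCat.ofHom_comp]; rfl
    rw [this]
    infer_instance

lemma ιG_πX (v : ℤ) : ιG v ≫ πX = ιE := ιG_descX _ _ _ _ _
lemma ιD_πX (j : ℤ) : ιD j ≫ πX = specMap ψD ≫ ιN := ιD_descX _ _ _ _ _

instance etale_πX : Etale πX := by
  refine etale_of_locally _ fun x => ?_
  rcases X₀_cases x with ⟨v, g, hg⟩ | ⟨j, d, hd, -⟩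
  · exact ⟨_, ιG v, inferInstance, ⟨g, hg⟩, by rw [ιG_πX]; infer_instance⟩
  · exact ⟨_, ιD j, inferInstance, ⟨d, hd⟩, by rw [ιD_πX]; infer_instance⟩

/-- The projection to the nodal curve. -/
def toE : T₀ ⟶ E := 𝔸(PUnit.{1}; E) ↘ E

/-- Thus a lift through `πY` of a morphism to `T₀` is the same as a lift through `πX` of its
projection to `E`, and étaleness is inherited by base change. -/
lemma isPullback_πY : IsPullback πY toX₀ toE πX := AffineSpace.isPullback_map πX

instance etale_πY : Etale πY :=
  MorphismProperty.of_isPullback (P := @Etale) isPullback_πY.flip inferInstance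

lemma πY_toE : πY ≫ toE = toX₀ ≫ πX := isPullback_πY.w

/-! ### Lifting morphisms to the nodal curve: local lifts -/

/-- A morphism to the nodal cubic lifts to the node chart if its coordinates can be written in terms
of the coordinates of the latter. -/
lemma exists_lift_node {T : Scheme.{0}} (h : T ⟶ Spec (.of RN)) (x y : Γ(T, ⊤)) (hxy : x * y = 0)
    (hd : IsUnit (1 - x - y)) (hX : pullFn h (xN 0) * (1 - x - y) ^ 2 = x + y)
    (hY : pullFn h (xN 1) * (1 - x - y) ^ 3 = x ^ 2 - y) :
    ∃ k : T ⟶ Spec (.of RD), k ≫ specMap ψD = h := by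
  let _ := algOf h
  let g : RD →ₐ[ℂ] Γ(T, ⊤) := liftD x y hxy hd
  have g0 : g (xD 0) = x := liftD_x _ _ _ _
  have g1 : g (xD 1) = y := liftD_y _ _ _ _
  have gu := congrArg g dD_unit.mul_val_inv
  simp only [map_mul, map_sub, map_one, g0, g1] at gu
  set u := g ((dD_unit.unit⁻¹ : RDˣ) : RD)
  refine ⟨toSpec g.toRingHom, toSpec_ext ?_⟩
  have e : g.comp ψD = pullAlg h := by
    refine RN_ext fun i => ?_
    fin_cases i
    · change g (ψD (xN 0)) = pullFn h (xN 0)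
      rw [ψD_x, map_mul, map_add, map_pow, g0, g1, ← hX]
      change _ * u ^ 2 = _
      linear_combination pullFn h (xN 0) * ((1 - x - y) * u + 1) * gu
    · change g (ψD (xN 1)) = pullFn h (xN 1)
      rw [ψD_y, map_mul, map_sub, map_pow, map_pow, g0, g1, ← hY]
      change _ * u ^ 3 = _
      linear_combination pullFn h (xN 1) * (((1 - x - y) * u) ^ 2 + (1 - x - y) * u + 1) * gu
  refine RingHom.ext fun a => ?_
  rw [pullFn_specMap, pullFn_toSpec]
  exact DFunLike.congr_fun e a

/-- The factorization of the coordinates of a point of the nodal cubic over a principal ideal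
domain. -/
lemma exists_factor_node {B : Type} [CommRing B] [IsDomain B] [IsPrincipalIdealRing B] {X Y : B}
    (h : Y ^ 2 + X * Y - X ^ 3 = 0) (hX : X ≠ 0) :
    ∃ a c g : B, IsCoprime a c ∧ IsUnit (c - a) ∧ X = g * (c - a) ∧ Y = g * a ∧
      a * c = g * (c - a) ^ 3 := by
  -- On the torus `z = Y / (X + Y)`. Dividing numerator and denominator by their greatest common
  -- divisor `g` yields the point `[a : c]` of the normalization, a projective line.
  obtain ⟨g, hg⟩ := IsPrincipalIdealRing.principal (Ideal.span {Y, X + Y})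
  have hg : Ideal.span {Y, X + Y} = Ideal.span {g} := hg
  obtain ⟨a, ha⟩ := Ideal.mem_span_singleton.1 (hg.le (Ideal.subset_span (by simp)) : Y ∈ _)
  obtain ⟨c, hc⟩ := Ideal.mem_span_singleton.1 (hg.le (Ideal.subset_span (by simp)) : X + Y ∈ _)
  obtain ⟨u, v, huv⟩ := Ideal.mem_span_pair.1 (hg.ge (Ideal.mem_span_singleton_self g))
  have hX' : X = g * (c - a) := by linear_combination hc - ha
  have hg0 : g ≠ 0 := by
    rintro rfl
    exact hX (by rw [hX', zero_mul])
  have hco : IsCoprime a c := ⟨u, v, mul_left_cancel₀ hg0 (by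
    linear_combination huv - u * ha - v * hc)⟩
  have hac : a * c = g * (c - a) ^ 3 := by
    refine mul_left_cancel₀ (pow_ne_zero 2 hg0) ?_
    rw [hX', ha] at h
    linear_combination h
  refine ⟨a, c, g, hco, ?_, hX', ha, hac⟩
  -- Coprimality of `a` and `c` makes `c - a` prime to `a c`; as it also divides `a c = g (c - a)³`,
  -- it is a unit.
  have h1 : IsCoprime (a * c) (c - a) := by
    refine IsCoprime.mul_left ?_ ?_
    · obtain ⟨p, q, hpq⟩ := hco
      exact ⟨p + q, q, by linear_combination hpq⟩
    · obtain ⟨p, q, hpq⟩ := hco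
      exact ⟨p + q, -p, by linear_combination hpq⟩
  exact h1.isUnit_of_dvd' ⟨g * (c - a) ^ 2, by rw [hac]; ring⟩ dvd_rfl

/-- A morphism to the nodal curve lifts to the chain of projective lines near a point. -/
def HasLocalLift {Z : Scheme.{0}} (φ : Z ⟶ E) (z : Z) : Prop :=
  ∃ (V : Scheme.{0}) (j : V ⟶ Z) (s : V ⟶ X₀), IsOpenImmersion j ∧ z ∈ Set.range j ∧
    s ≫ πX = j ≫ φ

lemma HasLocalLift.of_openImmersion {Z V : Scheme.{0}} {φ : Z ⟶ E} (j : V ⟶ Z) [IsOpenImmersion j]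
    {v : V} (h : HasLocalLift (j ≫ φ) v) : HasLocalLift φ (j v) := by
  obtain ⟨W, i, s, hi, ⟨w, rfl⟩, hs⟩ := h
  exact ⟨W, i ≫ j, s, inferInstance, ⟨w, by simp⟩, by simp [hs]⟩

/-- Any node of the chain would do for the lift; the node `0` is used. -/
lemma hasLocalLift_of_node {T : Scheme.{0}} (h : T ⟶ Spec (.of RN)) (U : T.Opens) {t : T}
    (ht : t ∈ U) (x y : Γ(U.toScheme, ⊤)) (hxy : x * y = 0) (hd : IsUnit (1 - x - y))
    (hX : fres U.ι (pullFn h (xN 0)) * (1 - x - y) ^ 2 = x + y)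
    (hY : fres U.ι (pullFn h (xN 1)) * (1 - x - y) ^ 3 = x ^ 2 - y) :
    HasLocalLift (h ≫ ιN) t := by
  have e : ∀ a, pullFn (U.ι ≫ h) a = fres U.ι (pullFn h a) := fun a => pullFn_comp _ _ _
  rw [← e] at hX hY
  obtain ⟨k, hk⟩ := exists_lift_node (U.ι ≫ h) x y hxy hd hX hY
  exact ⟨U, U.ι, k ≫ ιD 0, inferInstance, ⟨⟨t, ht⟩, rfl⟩, by
    rw [Category.assoc, ιD_πX, reassoc_of% hk]⟩

/-- If `X = 0`, then also `Y = 0` and the morphism lifts to the constant morphism to a node.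
Otherwise let `[a : c]` be the point of the normalization: where `c` is invertible it lies on the
branch `x = a / c`, `y = 0`, and where `a` is invertible on the branch `x = 0`, `y = c / a`. The
required unit `1 - x - y` is `c - a` up to an invertible factor. -/
lemma hasLocalLift_of_isPrincipalIdealRing {T : Scheme.{0}} [IsDomain Γ(T, ⊤)]
    [IsPrincipalIdealRing Γ(T, ⊤)] (h : T ⟶ Spec (.of RN)) (t : T) : HasLocalLift (h ≫ ιN) t := by
  have hN : pullFn h (xN 1) ^ 2 + pullFn h (xN 0) * pullFn h (xN 1) - pullFn h (xN 0) ^ 3 = 0 := by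
    have := congrArg (pullFn h) xN_rel
    simpa only [map_mul, map_add, map_sub, map_pow, map_zero] using this
  by_cases hX : pullFn h (xN 0) = 0
  · have hY : pullFn h (xN 1) = 0 := by
      rw [hX] at hN
      exact pow_eq_zero_iff two_ne_zero |>.1 (by linear_combination hN)
    refine hasLocalLift_of_node h ⊤ (t := t) trivial 0 0 (by simp) (by simp) ?_ ?_ <;> simp [hX, hY]
  obtain ⟨a, c, g, ⟨p, q, hpq⟩, hu, hX', hY', hac⟩ := exists_factor_node hN hX
  by_cases hc : t ∈ T.basicOpen c
  · let ρ := fres (T.basicOpen c).ι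
    obtain ⟨c', hc'⟩ : ∃ c', ρ c * c' = 1 := ⟨_, (isUnit_res_basicOpen c).mul_val_inv⟩
    have e : 1 - ρ a * c' - 0 = ρ (c - a) * c' := by
      rw [map_sub]
      linear_combination -hc'
    have hac := congrArg ρ hac
    have hX' := congrArg ρ hX'
    have hY' := congrArg ρ hY'
    simp only [map_mul, map_pow, map_sub] at hac hX' hY'
    refine hasLocalLift_of_node h _ hc (ρ a * c') 0 (mul_zero _) ?_ ?_ ?_
    · rw [e]
      exact (hu.map ρ).mul (IsUnit.of_mul_eq_one (ρ c) (by rw [mul_comm]; exact hc'))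
    · rw [e, map_sub]
      change ρ _ * _ = _
      rw [hX']
      linear_combination (-c' ^ 2) * hac + ρ a * c' * hc'
    · rw [e, map_sub]
      change ρ _ * _ = _
      rw [hY']
      linear_combination (-c' ^ 3 * ρ a) * hac + (ρ a) ^ 2 * c' ^ 2 * hc'
  · have ha : t ∈ T.basicOpen a := by
      -- Since `p a + q c = 1`, the functions `a` and `c` cannot both vanish at `t`.
      by_contra ha
      have h1 := (vanishingAt t).add_mem ((vanishingAt t).mul_mem_left p (mem_vanishingAt.2 ha))
        ((vanishingAt t).mul_mem_left q (mem_vanishingAt.2 hc))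
      rw [hpq, mem_vanishingAt, Scheme.basicOpen_of_isUnit _ isUnit_one] at h1
      exact h1 trivial
    let ρ := fres (T.basicOpen a).ι
    obtain ⟨a', ha'⟩ : ∃ a', ρ a * a' = 1 := ⟨_, (isUnit_res_basicOpen a).mul_val_inv⟩
    have e : 1 - 0 - ρ c * a' = -ρ (c - a) * a' := by
      rw [map_sub]
      linear_combination -ha'
    have hac := congrArg ρ hac
    have hX' := congrArg ρ hX'
    have hY' := congrArg ρ hY'
    simp only [map_mul, map_pow, map_sub] at hac hX' hY'
    refine hasLocalLift_of_node h _ ha 0 (ρ c * a') (zero_mul _) ?_ ?_ ?_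
    · rw [e]
      exact (hu.map ρ).neg.mul (IsUnit.of_mul_eq_one (ρ a) (by rw [mul_comm]; exact ha'))
    · rw [e, map_sub]
      change ρ _ * _ = _
      rw [hX']
      linear_combination (-a' ^ 2) * hac + ρ c * a' * ha'
    · rw [e, map_sub]
      change ρ _ * _ = _
      rw [hY']
      linear_combination (a' ^ 3 * ρ a) * hac - ρ c * a' * (ρ a * a' + 1) * ha'

/-- Every ideal of a localization is generated by its contraction. -/
lemma isPrincipalIdealRing_of_isLocalization {A B : Type} [CommRing A] [IsPrincipalIdealRing A]
    [CommRing B] [Algebra A B] (M : Submonoid A) [IsLocalization M B] : IsPrincipalIdealRing B where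
  principal I := by
    rw [← IsLocalization.map_under M B I]
    obtain ⟨a, ha⟩ := IsPrincipalIdealRing.principal (I.under A)
    have ha : I.under A = Ideal.span {a} := ha
    refine ⟨algebraMap A B a, ?_⟩
    rw [ha, Ideal.map_span, Set.image_singleton]

/-- Over the torus of `E` the chart `ιG 0` gives a lift. Over the cubic, a basic open neighbourhood
has for coordinate ring a localization of `ℂ[z]`, which is a principal ideal domain. -/
lemma hasLocalLift_A1 (φ : A1 ⟶ E) (z : A1) : HasLocalLift φ z := by
  rcases E_cases (φ z) with ⟨g, hg⟩ | ⟨n, hn⟩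
  · let U := φ ⁻¹ᵁ ιE.opensRange
    have hr : Set.range (U.ι ≫ φ) ⊆ Set.range ιE := by
      rintro _ ⟨u, rfl⟩
      rw [Scheme.Hom.comp_apply]
      exact u.2
    refine ⟨U, U.ι, IsOpenImmersion.lift ιE (U.ι ≫ φ) hr ≫ ιG 0, inferInstance,
      ⟨⟨z, ⟨g, hg⟩⟩, rfl⟩, ?_⟩
    rw [Category.assoc, ιG_πX, IsOpenImmersion.lift_fac]
  · obtain ⟨f, hf, hfU⟩ : ∃ f : Polynomial ℂ, z ∈ PrimeSpectrum.basicOpen f ∧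
        (PrimeSpectrum.basicOpen f : Set (PrimeSpectrum (Polynomial ℂ))) ⊆ φ ⁻¹' Set.range ιN := by
      obtain ⟨_, ⟨f, rfl⟩, hf, hfU⟩ :=
        PrimeSpectrum.isTopologicalBasis_basic_opens.exists_subset_of_mem_open
        (show z ∈ φ ⁻¹' Set.range ιN from ⟨n, hn⟩)
        (ιN.isOpenEmbedding.isOpen_range.preimage φ.continuous)
      exact ⟨f, hf, hfU⟩
    have hf0 : f ≠ 0 := by
      rintro rfl
      rw [PrimeSpectrum.basicOpen_zero] at hf
      exact hf
    let B := Localization.Away f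
    have : IsDomain B := IsLocalization.isDomain_localization
      (powers_le_nonZeroDivisors_of_noZeroDivisors hf0)
    have : IsPrincipalIdealRing B := isPrincipalIdealRing_of_isLocalization (Submonoid.powers f)
    let e : B ≃+* Γ(Spec (.of B), ⊤) := (Scheme.ΓSpecIso (.of B)).symm.commRingCatIsoToRingEquiv
    have : IsDomain Γ(Spec (.of B), ⊤) := e.symm.toMulEquiv.isDomain B
    have : IsPrincipalIdealRing Γ(Spec (.of B), ⊤) := .of_surjective e e.surjective
    let j : Spec (.of B) ⟶ A1 := Spec.map (CommRingCat.ofHom (algebraMap (Polynomial ℂ) B))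
    have : IsOpenImmersion j := inferInstanceAs (IsOpenImmersion
      (Spec.map (CommRingCat.ofHom (algebraMap (Polynomial ℂ) B))))
    have hj : Set.range j = (PrimeSpectrum.basicOpen f : Set (PrimeSpectrum (Polynomial ℂ))) :=
      PrimeSpectrum.localization_away_comap_range B f
    obtain ⟨v, rfl⟩ : z ∈ Set.range j := by rw [hj]; exact hf
    have hr : Set.range (j ≫ φ) ⊆ Set.range ιN := by
      rintro _ ⟨u, rfl⟩
      rw [Scheme.Hom.comp_apply]
      exact hfU (hj ▸ ⟨u, rfl⟩)
    refine HasLocalLift.of_openImmersion j ?_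
    rw [← IsOpenImmersion.lift_fac ιN (j ≫ φ) hr]
    exact hasLocalLift_of_isPrincipalIdealRing _ _

/-! ### Lifting morphisms to the nodal curve: gluing -/

/-- A function on the oriented edges of a tree is the difference of a function on the vertices. -/
lemma exists_potential {V : Type*} {G : SimpleGraph V} (hG : G.IsTree) (w : V → V → ℤ)
    (hw : ∀ u v, w u v = -w v u) : ∃ c : V → ℤ, ∀ u v, G.Adj u v → c v - c u = w u v := by
  classical
  obtain ⟨r⟩ := hG.connected.nonempty
  choose p hp huniq using fun v => hG.existsUnique_path r v
  -- The potential of a vertex is the total weight of the unique path from the root `r` to it.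
  let wt {u v : V} (q : G.Walk u v) : ℤ := (q.darts.map fun d => w d.fst d.snd).sum
  have key : ∀ u v, G.Adj u v → v ∉ (p u).support → wt (p v) - wt (p u) = w u v := by
    intro u v h hv
    rw [← huniq v _ ((hp u).concat hv h)]
    simp [wt, SimpleGraph.Walk.darts_concat]
  refine ⟨fun v => wt (p v), fun u v h => ?_⟩
  -- Of two adjacent vertices of a tree, one has the path to the other as the initial part of its
  -- own; antisymmetry of `w` treats both cases alike.
  by_cases hv : v ∈ (p u).support
  · have hu : u ∉ (p v).support := hG.isAcyclic.ne_mem_support_of_support_of_adj_of_isPath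
      (hp u) (hp v) h hv
    rw [hw, ← key v u h.symm hu, neg_sub]
  · exact key u v h hv

/-- Every nonempty open set contains the generic point, so the local lifts can be translated to have
one common value there. Overlaps are connected, hence on them two of these lifts differ by a
translation, which is trivial because it fixes that value. -/
lemma exists_lift_of_irreducible {Z : Scheme.{0}} [IrreducibleSpace Z] (φ : Z ⟶ E)
    (H : ∀ z, HasLocalLift φ z) : ∃ s : Z ⟶ X₀, s ≫ πX = φ := by
  choose V j s hj hz hs using H
  have hξ : ∀ z, ∃ v : V z, j z v = genericPoint Z := fun z =>
    (genericPoint_specializes z).mem_open (j z).isOpenEmbedding.isOpen_range (hz z)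
  choose ξ hξ using hξ
  have hφ : ∀ z, πX (s z (ξ z)) = φ (genericPoint Z) := fun z => by
    rw [← Scheme.Hom.comp_apply, hs, Scheme.Hom.comp_apply, hξ]
  -- The common value is that of the lift chosen around the generic point itself.
  choose n hn using fun z => exists_shift_of_πX_eq ((hφ z).trans (hφ (genericPoint Z)).symm)
  let 𝒰 : Z.OpenCover := {
    I₀ := Z, X i := V i, f i := j i,
    mem₀ := by
      rw [Scheme.presieve₀_mem_precoverage_iff]
      exact ⟨fun x => ⟨x, hz x⟩, hj⟩ }
  have hs' : ∀ z, (s z ≫ shiftX (n z)) ≫ πX = j z ≫ φ := fun z => by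
    rw [Category.assoc, shiftX_πX, hs]
  have compat : ∀ z z', pullback.fst (j z) (j z') ≫ s z ≫ shiftX (n z) =
      pullback.snd (j z) (j z') ≫ s z' ≫ shiftX (n z') := by
    intro z z'
    have : PreirreducibleSpace ↥(pullback (j z) (j z')) :=
      (pullback.fst (j z) (j z') ≫ j z).isOpenEmbedding.preirreducibleSpace
    have e : (pullback.fst (j z) (j z') ≫ s z ≫ shiftX (n z)) ≫ πX =
        (pullback.snd (j z) (j z') ≫ s z' ≫ shiftX (n z')) ≫ πX := by
      rw [Category.assoc, hs', Category.assoc, hs', pullback.condition_assoc]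
    obtain ⟨m, hm⟩ := exists_shift e
    obtain ⟨p, hp, hp'⟩ := Scheme.Pullback.exists_preimage_pullback (f := j z) (g := j z') (ξ z)
      (ξ z') ((hξ z).trans (hξ z').symm)
    have h1 := congrArg (fun k => k p) hm
    simp only [Scheme.Hom.comp_apply, hp, hp', ← hn] at h1
    rw [hm, shiftX_free h1.symm, shiftX_zero, Category.comp_id]
  refine ⟨Scheme.Cover.glueMorphisms 𝒰 (fun z => s z ≫ shiftX (n z)) compat,
    Scheme.Cover.hom_ext 𝒰 _ _ fun z => ?_⟩
  rw [Scheme.Cover.ι_glueMorphisms_assoc]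
  exact hs' z

/-- Lifts on finitely many closed subschemes which agree at all points glue. -/
lemma exists_lift_of_closed {C : Scheme.{0}} (φ : C ⟶ E) {K : Type*} [Finite K]
    (Z : K → Scheme.{0}) (i : ∀ k, Z k ⟶ C) [∀ k, IsClosedImmersion (i k)]
    (hi : ∀ c, ∃ k z, i k z = c) (s : ∀ k, Z k ⟶ X₀) (hs : ∀ k, s k ≫ πX = i k ≫ φ)
    (H : ∀ k l z z', i k z = i l z' → s k z = s l z') : ∃ s : C ⟶ X₀, s ≫ πX = φ := by
  -- Lifts of `φ` are sections of `P` over `C`, and `P` is étale over `C`. The union `W` of the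
  -- images of the desired section is shown to be open; descent along `W ⟶ C` then gives the lift
  -- without any construction of an inverse.
  let P := pullback φ πX
  let pr₁ : P ⟶ C := pullback.fst φ πX
  let pr₂ : P ⟶ X₀ := pullback.snd φ πX
  have hP : pr₁ ≫ φ = pr₂ ≫ πX := pullback.condition
  let a (k : K) : pullback pr₁ (i k) ⟶ P := pullback.fst pr₁ (i k)
  let b (k : K) : pullback pr₁ (i k) ⟶ Z k := pullback.snd pr₁ (i k)
  have hab : ∀ k, a k ≫ pr₁ = b k ≫ i k := fun k => pullback.condition
  -- The points of `P` above `Z k` at which the lift is not the prescribed one. Being a given lift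
  -- is an open condition, and `a k` is a closed immersion, so this set is closed.
  let F (k : K) : Set P := a k '' {q | pr₂ (a k q) = s k (b k q)}ᶜ
  have hF : ∀ k, IsClosed (F k) := fun k => by
    have e : (b k ≫ s k) ≫ πX = (a k ≫ pr₂) ≫ πX := by
      rw [Category.assoc, hs, ← reassoc_of% hab, Category.assoc, ← hP]
    have h1 : IsOpen {q | pr₂ (a k q) = s k (b k q)} := by
      have h1 := isOpen_shift e 0
      rwa [shiftX_zero] at h1
    have : IsClosedImmersion (a k) := inferInstanceAs (IsClosedImmersion (pullback.fst pr₁ (i k)))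
    exact (a k).isClosedEmbedding.isClosedMap _ h1.isClosed_compl
  -- Finiteness of `K` makes the union of the bad sets closed.
  let W : P.Opens := ⟨(⋃ k, F k)ᶜ, (isClosed_iUnion_of_finite hF).isOpen_compl⟩
  have hW : ∀ (p : P) (k : K) (z : Z k), p ∈ W → i k z = pr₁ p → pr₂ p = s k z := by
    intro p k z hp hz
    obtain ⟨q, hq, hq'⟩ := Scheme.Pullback.exists_preimage_pullback (f := pr₁) (g := i k) p z hz.symm
    by_contra hne
    refine hp (Set.mem_iUnion.2 ⟨k, q, fun h => hne ?_, hq⟩)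
    rw [← hq, ← hq']
    exact h
  let f : W.toScheme ⟶ C := W.ι ≫ pr₁
  let e : W.toScheme ⟶ X₀ := W.ι ≫ pr₂
  have he : e ≫ πX = f ≫ φ := by simp only [e, f, Category.assoc, hP]
  have hf : Etale f := inferInstanceAs (Etale (W.ι ≫ pullback.fst φ πX))
  -- Above a point of `Z k` the prescribed value of `s k` gives a point of `P`; it avoids every bad
  -- set because the prescribed lifts agree at common points.
  have hfs : Surjective f := ⟨fun c => by
    obtain ⟨k, z, rfl⟩ := hi c
    obtain ⟨p, hp, hp'⟩ := Scheme.Pullback.exists_preimage_pullback (f := φ) (g := πX) (i k z) (s k z)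
      (by rw [← Scheme.Hom.comp_apply, ← hs, Scheme.Hom.comp_apply])
    have hpW : p ∈ W := by
      intro hp''
      obtain ⟨l, q, hq, hqp⟩ := Set.mem_iUnion.1 hp''
      refine hq ?_
      change pr₂ (a l q) = s l (b l q)
      rw [hqp]
      refine hp'.trans (H _ _ _ _ ?_)
      rw [← Scheme.Hom.comp_apply, ← hab, Scheme.Hom.comp_apply, hqp]
      exact hp.symm
    obtain ⟨w, rfl⟩ : ∃ w : W.toScheme, W.ι w = p := ⟨⟨p, hpW⟩, rfl⟩
    exact ⟨w, by rw [Scheme.Hom.comp_apply]; exact hp⟩⟩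
  have hes : ∀ (w : W.toScheme) (k : K) (z : Z k), i k z = f w → e w = s k z := fun w k z hz => by
    rw [Scheme.Hom.comp_apply]
    exact hW _ k z w.2 (by rw [hz, Scheme.Hom.comp_apply])
  clear_value f e
  -- Descent condition. Both composites lift the same morphism to `E` and have the prescribed values
  -- at all points; lifts that agree at all points are equal, by `eq_shift_of_forall` with `n = 0`,
  -- even if `T` is not reduced.
  have hd : ∀ {T : Scheme.{0}} (g₁ g₂ : T ⟶ W.toScheme), g₁ ≫ f = g₂ ≫ f → g₁ ≫ e = g₂ ≫ e := by
    intro T g₁ g₂ h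
    have h1 : (g₂ ≫ e) ≫ πX = (g₁ ≫ e) ≫ πX := by
      rw [Category.assoc, he, Category.assoc, he, reassoc_of% h]
    have h2 := eq_shift_of_forall h1 0 fun t => by
      obtain ⟨k, z, hz⟩ := hi (f (g₁ t))
      have hz' : i k z = f (g₂ t) := by
        rw [hz, ← Scheme.Hom.comp_apply, h, Scheme.Hom.comp_apply]
      rw [shiftX_zero, Scheme.Hom.comp_apply, Scheme.Hom.comp_apply, hes _ k z hz, hes _ k z hz']
      rfl
    rw [h2, shiftX_zero, Category.comp_id]
  -- The étale surjection `f` is an effective epimorphism.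
  refine ⟨EffectiveEpi.desc f e hd, ?_⟩
  rw [← cancel_epi f, EffectiveEpi.fac_assoc, he]

/-! ### Lifting morphisms to the nodal curve: rational curves -/

namespace MarkedCurve

variable (D : MarkedCurve)

lemma range_compι (Z : irreducibleComponents D.C.X) : Set.range (D.compι Z) = Z.1 := by
  have h := (Scheme.IdealSheafData.vanishingIdeal
    ⟨Z.1, isClosed_of_mem_irreducibleComponents Z.1 Z.2⟩).range_subschemeι
  rw [Scheme.IdealSheafData.coe_support_vanishingIdeal] at h
  exact h

instance (Z : irreducibleComponents D.C.X) : IsClosedImmersion (D.compι Z) :=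
  inferInstanceAs (IsClosedImmersion (Scheme.IdealSheafData.vanishingIdeal
    ⟨Z.1, isClosed_of_mem_irreducibleComponents Z.1 Z.2⟩).subschemeι)

instance irreducibleSpace_comp (Z : irreducibleComponents D.C.X) : IrreducibleSpace (D.comp Z) := by
  have hZ : IsIrreducible Z.1 := Z.2.1
  have : IrreducibleSpace (Set.range (D.compι Z)) := by
    rw [range_compι]
    exact Subtype.irreducibleSpace hZ
  let e := (D.compι Z).isEmbedding.toHomeomorph.symm
  exact e.surjective.irreducibleSpace e.continuous

/-- A curve of finite type over `ℂ` is a noetherian scheme. The gluing of lifts over closed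
subschemes needs this finiteness. -/
lemma finite_irreducibleComponents : Finite (irreducibleComponents D.C.X) := by
  have := D.finType
  have := D.qcpt
  have : IsLocallyNoetherian logPoint.X := inferInstanceAs (IsLocallyNoetherian (Spec (.of ℂ)))
  have : CompactSpace logPoint.X := inferInstanceAs (CompactSpace (Spec (.of ℂ)))
  have h1 : IsLocallyNoetherian D.C.X := LocallyOfFiniteType.isLocallyNoetherian D.pt.base
  have h2 : CompactSpace D.C.X := QuasiCompact.compactSpace_of_compactSpace D.pt.base
  have : IsNoetherian D.C.X := { h1, h2 with }
  exact TopologicalSpace.NoetherianSpace.finite_irreducibleComponents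

variable {D}

/-- A component is an affine line, or a projective line covered by two of them, so lifts exist
locally; it is irreducible, so they glue. -/
lemma exists_lift_comp (hD : D.IsRational) (ha : ∀ C', ¬ D.Complete C' → Nonempty (D.Param C'))
    (Z : irreducibleComponents D.C.X) (φ : D.comp Z ⟶ E) : ∃ s : D.comp Z ⟶ X₀, s ≫ πX = φ := by
  refine exists_lift_of_irreducible φ fun z => ?_
  by_cases hZ : D.Complete Z
  · obtain ⟨a, b, _, _, -, -, hab, -⟩ := hD.1 Z hZ
    rcases hab.ge (Set.mem_univ z) with ⟨v, rfl⟩ | ⟨v, rfl⟩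
    · exact .of_openImmersion a (hasLocalLift_A1 _ _)
    · exact .of_openImmersion b (hasLocalLift_A1 _ _)
  · obtain ⟨a⟩ := ha Z hZ
    have h := HasLocalLift.of_openImmersion a.1.hom (hasLocalLift_A1 (a.1.hom ≫ φ) (a.1.inv z))
    rwa [← Scheme.Hom.comp_apply, a.1.inv_hom_id] at h

/-- A morphism from a rational curve to the nodal curve lifts to the chain of projective lines. -/
lemma exists_lift (hD : D.IsRational) (ha : ∀ C', ¬ D.Complete C' → Nonempty (D.Param C'))
    (φ : D.C.X ⟶ E) : ∃ s : D.C.X ⟶ X₀, s ≫ πX = φ := by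
  classical
  choose s hs using fun Z => exists_lift_comp hD ha Z (D.compι Z ≫ φ)
  have hsp : ∀ Z z, πX (s Z z) = φ (D.compι Z z) := fun Z z => by
    rw [← Scheme.Hom.comp_apply, hs, Scheme.Hom.comp_apply]
  let N := {x : D.C.X // ∃ Z ∈ irreducibleComponents D.C.X, ∃ Z' ∈ irreducibleComponents D.C.X,
      Z ≠ Z' ∧ x ∈ Z ∧ x ∈ Z'}
  have hpt : ∀ (Z : irreducibleComponents D.C.X) (x : D.C.X), x ∈ Z.1 → ∃ z, D.compι Z z = x :=
    fun Z x hx => (D.range_compι Z).ge hx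
  have hy : ∀ x : N, ∃ y : X₀, πX y = φ x.1 := by
    rintro ⟨x, Z, hZ, Z', hZ', -, hx, -⟩
    obtain ⟨z, hz⟩ := hpt ⟨Z, hZ⟩ x hx
    exact ⟨s ⟨Z, hZ⟩ z, by rw [hsp, hz]⟩
  choose y hy using hy
  -- `d` measures how far the lift on `Z` is from the reference point `y x` chosen above the
  -- intersection point `x`. If `x` is not on `Z` the condition is void and `d = 0`.
  have hd : ∀ (Z : irreducibleComponents D.C.X) (x : N), ∃ d : ℤ,
      ∀ z, D.compι Z z = x.1 → y x = shiftX d (s Z z) := by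
    intro Z x
    by_cases hx : x.1 ∈ Z.1
    · obtain ⟨z, hz⟩ := hpt Z _ hx
      obtain ⟨d, hd⟩ := exists_shift_of_πX_eq (x := s Z z) (y := y x) (by rw [hsp, hy, hz])
      refine ⟨d, fun z' hz' => ?_⟩
      rwa [(D.compι Z).isClosedEmbedding.injective (hz'.trans hz.symm)]
    · exact ⟨0, fun z hz => (hx (hz ▸ (D.range_compι Z).le ⟨z, rfl⟩)).elim⟩
  choose d hd using hd
  -- The discrepancies as an antisymmetric weight on the incidence graph; the value on pairs of
  -- vertices of the same kind is irrelevant, since these are not adjacent.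
  let w : irreducibleComponents D.C.X ⊕ N → irreducibleComponents D.C.X ⊕ N → ℤ
    | .inl Z, .inr x => d Z x
    | .inr x, .inl Z => -d Z x
    | _, _ => 0
  obtain ⟨c, hc⟩ := exists_potential hD.2 w (by rintro (Z | x) (Z | x) <;> simp [w])
  have hc' : ∀ (Z : irreducibleComponents D.C.X) (x : N), x.1 ∈ Z.1 →
      c (.inr x) - c (.inl Z) = d Z x := fun Z x hx =>
    hc _ _ (by
      rw [incidenceGraph, SimpleGraph.fromRel_adj]
      exact ⟨by simp, .inl ⟨Z, x, rfl, rfl, hx⟩⟩)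
  -- After translation by minus the potential, the value of the lift on `Z` at `x` no longer depends
  -- on `Z`.
  have key : ∀ Z (x : N) z, D.compι Z z = x.1 →
      shiftX (-c (.inl Z)) (s Z z) = shiftX (-c (.inr x)) (y x) := by
    intro Z x z hz
    have hx : x.1 ∈ Z.1 := hz ▸ (D.range_compι Z).le ⟨z, rfl⟩
    have e : c (.inr x) - c (.inl Z) + -c (.inr x) = -c (.inl Z) := by abel
    rw [hd Z x z hz, shiftX_shiftX_apply, ← hc' Z x hx, e]
  have := D.finite_irreducibleComponents
  refine exists_lift_of_closed φ D.comp D.compι (fun x => ?_)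
    (fun Z => s Z ≫ shiftX (-c (.inl Z))) (fun Z => by rw [Category.assoc, shiftX_πX, hs]) ?_
  · obtain ⟨Z, hZ, hx⟩ := exists_mem_irreducibleComponents_subset_of_isIrreducible {x}
      isIrreducible_singleton
    obtain ⟨z, hz⟩ := hpt ⟨Z, hZ⟩ x (by simpa using hx)
    exact ⟨⟨Z, hZ⟩, z, hz⟩
  · intro Z Z' z z' h
    by_cases e : Z = Z'
    · subst e
      rw [(D.compι Z).isClosedEmbedding.injective h]
    · let x : N := ⟨D.compι Z z, Z.1, Z.2, Z'.1, Z'.2, fun h' => e (Subtype.ext h'),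
        (D.range_compι Z).le ⟨z, rfl⟩, h ▸ (D.range_compι Z').le ⟨z', rfl⟩⟩
      rw [Scheme.Hom.comp_apply, Scheme.Hom.comp_apply, key Z x z rfl, key Z' x z' h.symm]

end MarkedCurve

/-! ### Strict étale morphisms -/

/-- A scheme étale over the source of an étale morphism, as a scheme étale over the target. -/
abbrev Et.push {X Y : Scheme.{0}} (g : X ⟶ Y) [Etale g] (U : Et X) : Et Y := ⟨U.S, U.p ≫ g⟩

namespace LogScheme

/-- A morphism of log schemes is strict and étale: it is étale, and the log structure of the source
is the restriction of the log structure of the target. -/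
structure IsStrictEtale {Y T : LogScheme} (g : Y ⟶ T) : Prop where
  etale : Etale g.base
  bij : ∀ U : Et Y.X, Function.Bijective
    (g.log.map (U := Et.push g.base U) (V := U) (𝟙 U.S) (Category.id_comp _))

namespace IsStrictEtale

variable {Y T : LogScheme} {g : Y ⟶ T} (hg : IsStrictEtale g)

/-- Sections of the log structure of the source as sections of the log structure of the target. -/
def inv (U : Et Y.X) :
    letI := hg.etale
    Y.L.obj U →* T.L.obj (Et.push g.base U) :=
  (MulEquiv.ofBijective _ (hg.bij U)).symm.toMonoidHom

lemma map_inv (U : Et Y.X) (a : Y.L.obj U) :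
    letI := hg.etale
    g.log.map (U := Et.push g.base U) (V := U) (𝟙 U.S) (Category.id_comp _) (hg.inv U a) = a :=
  (MulEquiv.ofBijective _ (hg.bij U)).apply_symm_apply a

lemma inv_eq {U : Et Y.X} {a : Y.L.obj U}
    {c : letI := hg.etale; T.L.obj (Et.push g.base U)}
    (h : letI := hg.etale
      g.log.map (U := Et.push g.base U) (V := U) (𝟙 U.S) (Category.id_comp _) c = a) :
    hg.inv U a = c :=
  (hg.bij U).1 ((hg.map_inv U a).trans h.symm)

lemma inv_res {U U' : Et Y.X} (k : U'.S ⟶ U.S) (wk : k ≫ U.p = U'.p) (a : Y.L.obj U) :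
    letI := hg.etale
    hg.inv U' (Y.L.res k wk a) = T.L.res (V := Et.push g.base U) (W := Et.push g.base U') k
      (by rw [← Category.assoc, wk]) (hg.inv U a) := by
  let _ := hg.etale
  refine hg.inv_eq ?_
  have w : k ≫ U.p ≫ g.base = U'.p ≫ g.base := by rw [← Category.assoc, wk]
  refine (g.log.map_res (U := Et.push g.base U) (U' := Et.push g.base U') k w (𝟙 _)
    (Category.id_comp _) (by rw [Category.id_comp]; exact w) (hg.inv U a)).trans ?_
  conv_rhs => rw [← hg.map_inv U a]
  refine Eq.trans ?_ (g.log.res_map (U := Et.push g.base U) (𝟙 _) (Category.id_comp _) k wk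
    (by rw [Category.comp_id]; exact w) (hg.inv U a)).symm
  exact map_congr rfl (by rw [Category.id_comp]; exact (Category.comp_id k).symm) _ _ _

/-- The lift of a morphism along a strict étale morphism with given underlying morphism of
schemes. -/
def lift {C : LogScheme} (f : C ⟶ T) (f₀ : C.X ⟶ Y.X) (h : f₀ ≫ g.base = f.base) : C ⟶ Y where
  base := f₀
  log :=
    letI := hg.etale
    { map := fun {U V} k w => (f.log.map (U := Et.push g.base U) k (by
        rw [← h, ← Category.assoc, ← Category.assoc, w])).comp (hg.inv U)
      map_res := fun {U U' V} k wk l w w' a => by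
        simp only [MonoidHom.comp_apply]
        rw [hg.inv_res k wk]
        exact f.log.map_res (U := Et.push g.base U) (U' := Et.push g.base U') k _ l _ _ _
      res_map := fun {U V V'} k w l wl w' a => f.log.res_map (U := Et.push g.base U) k _ l wl _ _
      α_map := fun {U V} k w a => by
        simp only [MonoidHom.comp_apply]
        refine (f.log.α_map (U := Et.push g.base U) k _ _).trans ?_
        have h1 := g.log.α_map (U := Et.push g.base U) (V := U) (𝟙 U.S) (Category.id_comp _)
          (hg.inv U a)
        rw [hg.map_inv] at h1
        rw [h1]
        exact congrArg (fres k) (fres_id _).symm }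

/-- Pulling a section back along `g` and then applying `inv` only restricts it (`h1`), so the log
part of the composite is that of `f`. -/
lemma lift_comp {C : LogScheme} (f : C ⟶ T) (f₀ : C.X ⟶ Y.X) (h : f₀ ≫ g.base = f.base) :
    hg.lift f f₀ h ≫ g = f := by
  let _ := hg.etale
  refine hom_ext h fun U V k w w' a => ?_
  have w₁ : k ≫ U.p = (V.p ≫ f₀) ≫ g.base := by rw [Category.assoc]; exact w
  refine (comp_map (hg.lift f f₀ h) g (W := U.pb g.base) k w (U.pbLift _ k (V.p ≫ f₀) w₁)
    (U.pbLift_p _ _ _ _) (U.pbFst _) (U.pb_cond _) (U.pbLift_fst _ _ _ _) a).trans ?_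
  have h1 : hg.inv (U.pb g.base) (g.log.map (U.pbFst g.base) (U.pb_cond g.base) a) =
      T.L.res (V := U) (W := Et.push g.base (U.pb g.base)) (U.pbFst g.base) (U.pb_cond g.base) a := by
    refine hg.inv_eq ?_
    refine (g.log.map_res (U := U) (U' := Et.push g.base (U.pb g.base)) _ _ _ _
      (by rw [Category.id_comp]; exact U.pb_cond g.base) a).trans ?_
    exact map_congr rfl (Category.id_comp _) _ _ _
  refine (congrArg (f.log.map (U := Et.push g.base (U.pb g.base)) _ _) h1).trans ?_
  refine (f.log.map_res (U := U) (U' := Et.push g.base (U.pb g.base)) _ _ _ _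
    (by rw [U.pbLift_fst]; exact w') a).trans ?_
  exact map_congr rfl (U.pbLift_fst _ _ _ _) _ _ _

end IsStrictEtale

/-- Every section of the log structure of `Y` is pulled back from `T`, so the log part of a morphism
to `Y` is determined by its composite with `g`. -/
lemma IsStrictEtale.hom_ext {C Y T : LogScheme} {g : Y ⟶ T} (hg : IsStrictEtale g) {f₁ f₂ : C ⟶ Y}
    (hb : f₁.base = f₂.base) (h : f₁ ≫ g = f₂ ≫ g) :
    f₁ = f₂ := by
  let _ := hg.etale
  refine LogScheme.hom_ext hb fun U V k w w' a => ?_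
  rw [← hg.map_inv U a]
  refine (comp_map f₁ g (U := Et.push g.base U) (W := U) k (by
      rw [← Category.assoc, ← Category.assoc, w]) k w (𝟙 _) (Category.id_comp _)
      (Category.comp_id _) _).symm.trans (Eq.trans ?_
    (comp_map f₂ g (U := Et.push g.base U) (W := U) k (by
      rw [← Category.assoc, ← Category.assoc, w']) k w' (𝟙 _) (Category.id_comp _)
      (Category.comp_id _) _))
  exact map_congr h rfl _ _ _

lemma isStrictEtale_restrictHom (X : LogScheme) (V : Et X.X) :
    IsStrictEtale (X.restrictHom V) where
  etale := V.et
  bij U := by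
    have : ∀ a, (X.restrictHom V).log.map (U := @Et.push _ _ (X.restrictHom V).base V.et U) (V := U)
        (𝟙 U.S) (Category.id_comp _) a = a := fun a => X.L.res_id _ a
    exact ⟨fun a b h => by rwa [this, this] at h, fun a => ⟨a, this a⟩⟩

/-- The same étale scheme over `T` may occur with its structure morphism bracketed differently; the
bijection is therefore stated for any morphism equal to `U.p ≫ g.base`. -/
lemma IsStrictEtale.bij_of_eq {Y T : LogScheme} {g : Y ⟶ T} (hg : IsStrictEtale g) (U : Et Y.X)
    (p : U.S ⟶ T.X) (_ : Etale p) (w : 𝟙 _ ≫ p = U.p ≫ g.base) :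
    Function.Bijective (g.log.map (U := ⟨U.S, p⟩) (V := U) (𝟙 U.S) w) := by
  obtain rfl : p = U.p ≫ g.base := by rw [← w, Category.id_comp]
  exact hg.bij U

lemma isStrictEtale_id (X : LogScheme) : IsStrictEtale (𝟙 X) where
  etale := inferInstanceAs (Etale (𝟙 X.X))
  bij U := by
    have e : Etale (U.p ≫ 𝟙 X.X) := inferInstance
    have h1 : ∀ (p : U.S ⟶ X.X) (_ : Etale p) (w : 𝟙 _ ≫ p = U.p),
        Function.Bijective (X.L.res (V := ⟨U.S, p⟩) (W := U) (𝟙 U.S) w) := by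
      intro p _ w
      obtain rfl : p = U.p := by rw [← w, Category.id_comp]
      exact ⟨fun a b h => by rwa [X.L.res_id, X.L.res_id] at h, fun a => ⟨a, X.L.res_id _ a⟩⟩
    exact h1 _ e (by rw [Category.id_comp, Category.comp_id])

/-- A morphism whose composition with a strict étale morphism is strict étale is so itself. -/
lemma IsStrictEtale.of_comp {X Y T : LogScheme} {f : X ⟶ Y} {g : Y ⟶ T} (hg : IsStrictEtale g)
    (hfg : IsStrictEtale (f ≫ g)) : IsStrictEtale f := by
  let _ := hg.etale
  have h1 : Etale (f.base ≫ g.base) := hfg.etale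
  let _ : Etale f.base := Etale.of_comp f.base g.base
  refine ⟨‹_›, fun U => ?_⟩
  have w : 𝟙 U.S ≫ (U.p ≫ f.base) ≫ g.base = U.p ≫ f.base ≫ g.base := by simp
  have h2 := hfg.bij_of_eq U ((U.p ≫ f.base) ≫ g.base) inferInstance w
  have h3 := hg.bij (Et.push f.base U)
  have h4 : ∀ a, (f ≫ g).log.map (U := ⟨U.S, (U.p ≫ f.base) ≫ g.base⟩) (V := U) (𝟙 U.S) w a =
      f.log.map (U := Et.push f.base U) (V := U) (𝟙 U.S) (Category.id_comp _)
        (g.log.map (U := Et.push g.base (Et.push f.base U)) (V := Et.push f.base U) (𝟙 U.S)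
          (Category.id_comp _) a) :=
    fun a => comp_map f g _ _ _ _ _ _ (Category.id_comp _) a
  refine (Function.Bijective.of_comp_iff _ h3).1 ?_
  convert h2 using 1
  exact funext fun a => (h4 a).symm

end LogScheme

/-! ### The quotient map is strict and étale -/

/-- The empty scheme is covered by the empty family, and sections are separated. -/
lemma LogStr.eq_of_isEmpty {X : Scheme.{0}} (M : LogStr X) {V : Et X} [IsEmpty V.S]
    (a b : M.obj V) : a = b := M.sep a b fun v => isEmptyElim v

section Quot

variable {Y : LogScheme} {T : Scheme.{0}} (π : Y.X ⟶ T) (Φ : ℤ → (Y ⟶ Y))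
  (hπ : ∀ n, (Φ n).base ≫ π = π)

/-- The quotient log structure asks for invariance under the generator `Φ 1` only. Invariance under
its inverse follows by applying `Φ (-1)` to the equation, and induction gives the whole group. -/
lemma act_all (h0 : Φ 0 = 𝟙 Y) (hadd : ∀ m n, Φ m ≫ Φ n = Φ (m + n)) (V : Et T)
    {q : Y.L.obj (V.pb π)} (hq : V.act π (Φ 1) (hπ 1) q = q) (n : ℤ) :
    V.act π (Φ n) (hπ n) q = q := by
  have comp : ∀ m n, V.act π (Φ (m + n)) (hπ (m + n)) q =
      V.act π (Φ m) (hπ m) (V.act π (Φ n) (hπ n) q) := by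
    intro m n
    have hb : (Φ m).base ≫ (Φ n).base = (Φ (m + n)).base := congrArg LogScheme.Hom.base (hadd m n)
    refine Eq.trans ?_ (LogScheme.comp_map (Φ m) (Φ n) (V.pbAct π (Φ (m + n)) (hπ (m + n)))
      (by rw [hb]; exact V.pbAct_p _ _ _) (V.pbAct π (Φ m) (hπ m)) (V.pbAct_p _ _ _)
      (V.pbAct π (Φ n) (hπ n)) (V.pbAct_p _ _ _) ?_ q)
    · exact LogScheme.map_congr (hadd m n).symm rfl _ _ _
    · apply V.pb_ext <;> simp [Et.pbAct, hb]
  have zero : V.act π (Φ 0) (hπ 0) q = q := by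
    have hb : (Φ 0).base = 𝟙 _ := congrArg LogScheme.Hom.base h0
    have e : V.pbAct π (Φ 0) (hπ 0) = 𝟙 _ := by apply V.pb_ext <;> simp [Et.pbAct, hb]
    refine (LogScheme.map_congr h0 e _ (by simp) q).trans ?_
    exact Y.L.res_id _ _
  have neg : V.act π (Φ (-1)) (hπ (-1)) q = q := by
    have := comp (-1) 1
    rw [hq] at this
    exact this.symm.trans zero
  induction n using Int.induction_on with
  | zero => exact zero
  | succ n ih => rw [comp, hq, ih]
  | pred n ih => rw [sub_eq_add_neg, comp, neg, ih]

variable [Etale π]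

/-- The fibre product of `U` and `Y` over `T` is covered by the loci where the two projections to `Y`
differ by a translation. -/
lemma locally_translate
    (loc : ∀ (W : Scheme.{0}) (a b : W ⟶ Y.X), a ≫ π = b ≫ π → ∀ w : W, ∃ (n : ℤ) (O : W.Opens),
      w ∈ O ∧ O.ι ≫ b = O.ι ≫ a ≫ (Φ n).base) (U : Et Y.X) : ((Et.push π U).pb π).Locally fun W h _ =>
    ∃ n, (h ≫ (Et.push π U).pbFst π) ≫ U.p = W.p ≫ (Φ n).base := by
  let V := Et.push π U
  intro v
  obtain ⟨n, O, hv, e⟩ := loc _ (V.pb π).p (V.pbFst π ≫ U.p)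
    (by rw [Category.assoc]; exact (V.pb_cond π).symm) v
  refine ⟨⟨O, O.ι ≫ (V.pb π).p⟩, O.ι, rfl, ⟨⟨v, hv⟩, rfl⟩, n, ?_⟩
  exact (Category.assoc _ _ _).trans (e.trans (Category.assoc _ _ _).symm)

/-- The quotient by a free action is strict and étale. -/
lemma isStrictEtale_quotMap (h0 : Φ 0 = 𝟙 Y) (hadd : ∀ m n, Φ m ≫ Φ n = Φ (m + n))
    (free : ∀ (n : ℤ) (y : Y.X), (Φ n).base y = y → n = 0)
    (loc : ∀ (W : Scheme.{0}) (a b : W ⟶ Y.X), a ≫ π = b ≫ π → ∀ w : W, ∃ (n : ℤ) (O : W.Opens),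
      w ∈ O ∧ O.ι ≫ b = O.ι ≫ a ≫ (Φ n).base) :
    LogScheme.IsStrictEtale (quotMap π (Φ 1) (hπ 1)) := by
  have hbase : ∀ m n, (Φ m).base ≫ (Φ n).base = (Φ (m + n)).base := fun m n =>
    congrArg LogScheme.Hom.base (hadd m n)
  have hb0 : (Φ 0).base = 𝟙 Y.X := congrArg LogScheme.Hom.base h0
  have hshift : ∀ m n (y : Y.X), (Φ m).base y = (Φ n).base y → m = n := by
    intro m n y h
    have h1 := congrArg (Φ (-n)).base h
    rw [← Scheme.Hom.comp_apply, ← Scheme.Hom.comp_apply, hbase, hbase, add_neg_cancel, hb0] at h1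
    have := free _ _ h1
    omega
  -- An isomorphism is étale; this allows schemes étale over `Y` to be viewed over `Y` through `Φ 1`
  -- further on.
  have : IsIso (Φ 1).base := ⟨(Φ (-1)).base, by rw [hbase, add_neg_cancel, hb0], by
    rw [hbase, neg_add_cancel, hb0]⟩
  refine ⟨‹Etale π›, fun U => ?_⟩
  let V := Et.push π U
  -- The tautological section of `U ×_T Y` over `U`. The map in question sends an invariant section
  -- on `U ×_T Y` to its restriction along `τ`.
  let τ : U.S ⟶ (V.pb π).S := V.pbLift π (𝟙 U.S) U.p (Category.id_comp _)
  have hτ : τ ≫ V.pbFst π = 𝟙 U.S := V.pbLift_fst _ _ _ _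
  have hτp : τ ≫ (V.pb π).p = U.p := V.pbLift_p _ _ _ _
  constructor
  · intro q q' h
    let q : invSub π (Φ 1) (hπ 1) V := q
    let q' : invSub π (Φ 1) (hπ 1) V := q'
    have h : Y.L.res τ hτp q.1.1 = Y.L.res τ hτp q'.1.1 := h
    have e1 : ∀ q : invSub π (Φ 1) (hπ 1) V, q.1.2 = Y.L.α (Y.L.res τ hτp q.1.1) := by
      intro q
      rw [Y.L.α_res, q.2.2, ← fres_comp, hτ, fres_id]
    refine Subtype.ext (Prod.ext ?_ (((e1 q).trans (congrArg Y.L.α h)).trans (e1 q').symm))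
    refine Y.L.sep _ _ ((locally_translate π Φ loc U).mono ?_)
    rintro W k wk ⟨n, hn⟩
    -- Where the projections differ by `Φ n`, the action of `Φ n` carries the inclusion into a map
    -- through `τ`. By invariance, `q` is there determined by its restriction along `τ`, which
    -- proves injectivity.
    have key : ∀ q : invSub π (Φ 1) (hπ 1) V, Y.L.res k wk q.1.1 =
        (Φ n).log.map (U := U) (k ≫ V.pbFst π) hn (Y.L.res τ hτp q.1.1) := by
      intro q
      have h1 := act_all π Φ hπ h0 hadd V q.2.1 n
      have e : k ≫ V.pbAct π (Φ n) (hπ n) = (k ≫ V.pbFst π) ≫ τ := by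
        apply V.pb_ext
        · rw [Category.assoc, V.pbAct_fst, Category.assoc, hτ, Category.comp_id]
        · rw [Category.assoc, V.pbAct_p, ← Category.assoc, wk, Category.assoc _ τ, hτp, hn]
      conv_lhs => rw [← h1]
      have w1 : ((k ≫ V.pbFst π) ≫ τ) ≫ (V.pb π).p = W.p ≫ (Φ n).base := by
        rw [Category.assoc, hτp, hn]
      rw [Et.act, (Φ n).log.res_map _ _ k wk (by rw [e]; exact w1),
        (Φ n).log.map_res τ hτp (k ≫ V.pbFst π) hn w1]
      exact LogScheme.map_congr rfl e _ _ _
    exact (key q).trans ((congrArg _ h).trans (key q').symm)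
  · intro a
    -- The only possible invariant extension of `a`: its pull-back by `Φ n` on the locus where the
    -- projections differ by `Φ n`.
    let F : ∀ (W : Et Y.X) (k : W.S ⟶ (V.pb π).S), k ≫ (V.pb π).p = W.p → Set (Y.L.obj W) :=
      fun W k _ => {s | ∃ (n : ℤ) (hn : (k ≫ V.pbFst π) ≫ U.p = W.p ≫ (Φ n).base),
        s = (Φ n).log.map (U := U) (k ≫ V.pbFst π) hn a}
    have hcov : (V.pb π).Locally fun W k w => (F W k w).Nonempty :=
      (locally_translate π Φ loc U).mono (by
        rintro W k wk ⟨n, hn⟩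
        exact ⟨_, n, hn, rfl⟩)
    obtain ⟨m, hm⟩ := Y.L.glue (V := V.pb π) F
      (by
        rintro W k wk _ ⟨n, hn, rfl⟩ Z l wl wlk
        have hn' : ((l ≫ k) ≫ V.pbFst π) ≫ U.p = Z.p ≫ (Φ n).base := by
          rw [Category.assoc l, Category.assoc, hn, ← Category.assoc, wl]
        refine ⟨n, hn', ?_⟩
        rw [(Φ n).log.res_map _ _ l wl (by rw [← Category.assoc l]; exact hn')]
        exact LogScheme.map_congr rfl (Category.assoc _ _ _).symm _ _ _)
      (by
        rintro W k wk _ ⟨n, hn, rfl⟩ _ ⟨n', hn', rfl⟩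
        -- On a nonempty `W` freeness determines `n`; on the empty one all sections agree.
        rcases isEmpty_or_nonempty W.S with hW | ⟨⟨w⟩⟩
        · exact Y.L.eq_of_isEmpty _ _
        · obtain rfl : n = n' := hshift n n' (W.p w) (by
            rw [← Scheme.Hom.comp_apply, ← hn, hn', Scheme.Hom.comp_apply])
          rfl)
      hcov
    have hinv : V.act π (Φ 1) (hπ 1) m = m := by
      refine Y.L.sep _ _ (hcov.mono ?_)
      rintro W k wk ⟨_, n, hn, rfl⟩
      rw [hm W k wk _ ⟨n, hn, rfl⟩]
      -- Applying `Φ 1` to the second factor lowers the difference of the projections from `n` to `n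
      -- - 1`; on `W`, regarded over `Y` through `Φ 1`, the section is thus given by `Φ (n - 1)`,
      -- and `Φ 1 ≫ Φ (n - 1) = Φ n`.
      let W₁ : Et Y.X := Et.push (Φ 1).base W
      have hk : (k ≫ V.pbAct π (Φ 1) (hπ 1)) ≫ (V.pb π).p = W₁.p := by
        rw [Category.assoc, V.pbAct_p, ← Category.assoc, wk]
      have e : (k ≫ V.pbAct π (Φ 1) (hπ 1)) ≫ V.pbFst π = k ≫ V.pbFst π := by
        rw [Category.assoc, V.pbAct_fst]
      have hn₁ : ((k ≫ V.pbAct π (Φ 1) (hπ 1)) ≫ V.pbFst π) ≫ U.p = W₁.p ≫ (Φ (n - 1)).base := by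
        rw [e, hn, Category.assoc, hbase, add_sub_cancel]
      have h1 := hm W₁ (k ≫ V.pbAct π (Φ 1) (hπ 1)) hk _ ⟨n - 1, hn₁, rfl⟩
      rw [Et.act, (Φ 1).log.res_map _ _ k wk hk]
      have h2 := (Φ 1).log.map_res (U := V.pb π) (U' := W₁) (V := W) (k ≫ V.pbAct π (Φ 1) (hπ 1)) hk (𝟙 W.S)
        (Category.id_comp _) (by rw [Category.id_comp]; exact hk) m
      rw [h1] at h2
      refine Eq.trans ?_ (h2.symm.trans ?_)
      · exact LogScheme.map_congr rfl (Category.id_comp _).symm _ _ _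
      · have w₁ : (k ≫ V.pbFst π) ≫ U.p = W.p ≫ (Φ 1).base ≫ (Φ (n - 1)).base := by
          rw [hn, hbase, add_sub_cancel]
        refine (LogScheme.comp_map (Φ 1) (Φ (n - 1)) (W := W₁) (k ≫ V.pbFst π) w₁ (𝟙 W.S)
          (Category.id_comp _) _ hn₁ (by rw [Category.id_comp, e]) a).symm.trans ?_
        exact LogScheme.map_congr ((hadd 1 (n - 1)).trans (by rw [add_sub_cancel])) rfl _ _ _
    have hα : Y.L.α m = fres (V.pbFst π) (Y.L.α a) := by
      refine fn_sep _ _ _ (hcov.mono ?_)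
      rintro W k wk ⟨_, n, hn, rfl⟩
      rw [← Y.L.α_res k wk, hm W k wk _ ⟨n, hn, rfl⟩, (Φ n).log.α_map, fres_comp]
    refine ⟨(⟨(m, Y.L.α a), hinv, hα⟩ : invSub π (Φ 1) (hπ 1) V), ?_⟩
    -- Along `τ` the projections coincide, so there the glued section is the one for `n = 0`, that
    -- is, `a`.
    refine (hm U τ hτp a ⟨0, by rw [hτ, hb0, Category.id_comp, Category.comp_id], ?_⟩)
    refine Eq.trans (Y.L.res_id U a).symm ?_
    exact LogScheme.map_congr h0.symm hτ.symm (by simp) _ _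

end Quot

/-! ### The translations -/

/-- A morphism to `Y₀` is determined by its projections to the chain and to the quotient. -/
lemma Y₀_ext {W : Scheme.{0}} {a b : W ⟶ Y₀} (h : a ≫ toX₀ = b ≫ toX₀) (h' : a ≫ πY = b ≫ πY) :
    a = b := isPullback_πY.hom_ext h' h

lemma shiftY_shiftY (m n : ℤ) : shiftY m ≫ shiftY n = shiftY (m + n) := by
  refine Y₀_ext ?_ ?_
  · rw [Category.assoc, shiftY_toX₀, ← Category.assoc, shiftY_toX₀, Category.assoc, shiftX_shiftX,
      shiftY_toX₀]
  · rw [Category.assoc, shiftY_πY, shiftY_πY, shiftY_πY]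

lemma shiftY_zero : shiftY 0 = 𝟙 Y₀ := by
  refine Y₀_ext ?_ ?_
  · rw [shiftY_toX₀, shiftX_zero, Category.comp_id, Category.id_comp]
  · rw [shiftY_πY, Category.id_comp]

lemma shiftY_free {n : ℤ} {y : Y₀} (h : shiftY n y = y) : n = 0 := by
  refine shiftX_free (x := toX₀ y) ?_
  rw [← Scheme.Hom.comp_apply, ← shiftY_toX₀, Scheme.Hom.comp_apply, h]

lemma locally_shiftY {W : Scheme.{0}} (a b : W ⟶ Y₀) (h : a ≫ πY = b ≫ πY) (w : W) :
    ∃ (n : ℤ) (O : W.Opens), w ∈ O ∧ O.ι ≫ b = O.ι ≫ a ≫ shiftY n := by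
  obtain ⟨n, O, hw, e⟩ := locally_shift (a ≫ toX₀) (b ≫ toX₀)
    (by rw [Category.assoc, Category.assoc, ← πY_toE, reassoc_of% h]) w
  refine ⟨n, O, hw, Y₀_ext ?_ ?_⟩
  · simp only [Category.assoc, shiftY_toX₀] at e ⊢
    exact e
  · simp only [Category.assoc, shiftY_πY, h]

lemma comp_shiftY_πY {W : Scheme.{0}} (a : W ⟶ Y₀) (n : ℤ) : (a ≫ shiftY n) ≫ πY = a ≫ πY := by
  rw [Category.assoc, shiftY_πY]

lemma exists_shiftY {W : Scheme.{0}} [PreconnectedSpace W] {a b : W ⟶ Y₀}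
    (h : a ≫ πY = b ≫ πY) : ∃ n, b = a ≫ shiftY n := by
  obtain ⟨n, hn⟩ := exists_shift (a := a ≫ toX₀) (b := b ≫ toX₀)
    (by rw [Category.assoc, Category.assoc, ← πY_toE, reassoc_of% h])
  refine ⟨n, Y₀_ext ?_ ?_⟩
  · rw [hn, Category.assoc, Category.assoc, shiftY_toX₀]
  · rw [comp_shiftY_πY, h]

lemma shiftY_inj {m n : ℤ} {y : Y₀} (h : shiftY m y = shiftY n y) : m = n := by
  have h1 := congrArg (shiftY (-n)) h
  rw [← Scheme.Hom.comp_apply, ← Scheme.Hom.comp_apply, shiftY_shiftY, shiftY_shiftY,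
    add_neg_cancel, shiftY_zero] at h1
  have := shiftY_free h1
  omega

lemma comp_shiftY_inj {W : Scheme.{0}} {a : W ⟶ Y₀} {m n : ℤ} {w : W}
    (h : (a ≫ shiftY m) w = (a ≫ shiftY n) w) : m = n := by
  rw [Scheme.Hom.comp_apply, Scheme.Hom.comp_apply] at h
  exact shiftY_inj h

lemma YShift_gen (b : ℕ+) (n : ℤ) {U V : Et Y₀} (h : V.S ⟶ U.S) (w : h ≫ U.p = V.p ≫ shiftY n)
    (g : YGen U) : (YShift b n).log.map (U := U) (V := V) h w ((YPres b).gen g) =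
      (YPres b).gen (YGen.shift n h w g) :=
  GenMap.hom_gen (X := YLog b) (shiftGen b n) h w g

lemma YGen.x_congr {V : Et Y₀} {i : Fin 2} {j j' : ℤ} {h h' : V.S ⟶ Spec (.of RD)}
    {w : h ≫ ιD j = V.p ≫ toX₀} {w' : h' ≫ ιD j' = V.p ≫ toX₀} (ej : j = j') (eh : h = h') :
    YGen.x i j h w = YGen.x i j' h' w' := by
  subst ej eh; rfl

/-- It suffices to compare generators: `s` and `t` are fixed, and both sides move the chart `j` to
`j - m - n`. -/
lemma YShift_YShift (b : ℕ+) (m n : ℤ) : YShift b m ≫ YShift b n = YShift b (m + n) := by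
  refine LogPres.hom_ext (R := YPres b) (shiftY_shiftY m n) fun U (V : Et Y₀) h w w' g => ?_
  have w₁ : h ≫ U.p = (V.p ≫ shiftY m) ≫ shiftY n := by
    rw [Category.assoc]; exact w
  refine (LogScheme.comp_map (YShift b m) (YShift b n) (U := U) (W := U.pb (shiftY n)) (V := V) h w
    (U.pbLift _ h (V.p ≫ shiftY m) w₁) (U.pbLift_p _ _ _ _)
    (U.pbFst _) (U.pb_cond _) (U.pbLift_fst _ _ _ _) ((YPres b).gen g)).trans ?_
  refine Eq.trans (congrArg _ (YShift_gen b n (U.pbFst _) (U.pb_cond _) g)) ?_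
  refine (YShift_gen b m _ (U.pbLift_p _ _ _ _) _).trans
    (Eq.trans ?_ (YShift_gen b (m + n) h w' g).symm)
  refine congrArg (YPres b).gen ?_
  cases g with
  | x i j k wk => exact YGen.x_congr (by ring) (by rw [← Category.assoc, U.pbLift_fst])
  | _ => rfl

lemma YShift_zero (b : ℕ+) : YShift b 0 = 𝟙 (YLog b) := by
  refine LogPres.hom_ext (R := YPres b) shiftY_zero fun U (V : Et Y₀) h w w' g => ?_
  have w₁ : h ≫ U.p = V.p := w'.trans (Category.comp_id _)
  refine (YShift_gen b 0 h w g).trans (Eq.trans ?_ ((YPres b).gen_res h w₁ g).symm)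
  refine congrArg (YPres b).gen ?_
  cases g with
  | x i j k wk => exact YGen.x_congr (by ring) rfl
  | _ => rfl

lemma isStrictEtale_πLog (b : ℕ+) : LogScheme.IsStrictEtale (πLog b) :=
  have : Etale (X := (YLog b).X) πY := etale_πY
  isStrictEtale_quotMap (Y := YLog b) πY (YShift b) shiftY_πY (YShift_zero b) (YShift_YShift b)
    (fun _ _ h => shiftY_free h) (fun _ => locally_shiftY)

/-! ### The quotient map, translations and structure morphisms -/

section Quot

variable {Y : LogScheme} {T : Scheme.{0}} (π : Y.X ⟶ T)

/-- On sections, the quotient map followed by pull-back along `Φ n` is the action of `Φ n` on an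
invariant section, which is trivial by `act_all`. -/
lemma comp_quotMap (Φ : ℤ → (Y ⟶ Y)) (hπ : ∀ n, (Φ n).base ≫ π = π) (h0 : Φ 0 = 𝟙 Y)
    (hadd : ∀ m n, Φ m ≫ Φ n = Φ (m + n)) (n : ℤ) :
    Φ n ≫ quotMap π (Φ 1) (hπ 1) = quotMap π (Φ 1) (hπ 1) := by
  refine LogScheme.hom_ext (hπ n) fun (U : Et T) V h w w' q => ?_
  let q : invSub π (Φ 1) (hπ 1) U := q
  have w₀ : h ≫ U.p = V.p ≫ π := w'
  have w₁ : h ≫ U.p = (V.p ≫ (Φ n).base) ≫ π := by rw [Category.assoc, hπ]; exact w'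
  refine (LogScheme.comp_map (Φ n) (quotMap π (Φ 1) (hπ 1)) (U := U) (W := U.pb π) h w
    (U.pbLift π h (V.p ≫ (Φ n).base) w₁) (U.pbLift_p _ _ _ _) (U.pbFst π) (U.pb_cond π)
    (U.pbLift_fst _ _ _ _) q).trans ?_
  have e : U.pbLift π (U.pbFst π) (U.pb π).p (U.pb_cond π) = 𝟙 _ := by
    apply U.pb_ext <;> simp
  have h1 : (quotMap π (Φ 1) (hπ 1)).log.map (U := U) (V := U.pb π) (U.pbFst π) (U.pb_cond π) q =
      q.1.1 := by
    refine Eq.trans ?_ (Y.L.res_id _ q.1.1)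
    exact Y.L.res_congr e _ _ _
  refine (congrArg _ h1).trans ?_
  change _ = Y.L.res (U.pbLift π h V.p w₀) (U.pbLift_p _ _ _ _) q.1.1
  have e' : U.pbLift π h V.p w₀ ≫ U.pbAct π (Φ n) (hπ n) = U.pbLift π h (V.p ≫ (Φ n).base) w₁ := by
    apply U.pb_ext <;> simp [Et.pbAct]
  have w₂ : (U.pbLift π h V.p w₀ ≫ U.pbAct π (Φ n) (hπ n)) ≫ (U.pb π).p = V.p ≫ (Φ n).base := by
    rw [e', U.pbLift_p]
  have h2 := (Φ n).log.res_map (U.pbAct π (Φ n) (hπ n)) (U.pbAct_p _ _ _) (U.pbLift π h V.p w₀)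
    (U.pbLift_p _ _ _ _) w₂ q.1.1
  refine Eq.trans (LogScheme.map_congr rfl e'.symm _ w₂ _) (h2.symm.trans ?_)
  exact congrArg _ (act_all π Φ hπ h0 hadd U q.2.1 n)

lemma quotMap_quotDesc (Φ : Y ⟶ Y) (hΦ : Φ.base ≫ π = π) {Z : LogScheme} (g : Y ⟶ Z)
    (hg : Φ ≫ g = g) (g₀ : T ⟶ Z.X) (hg₀ : π ≫ g₀ = g.base) :
    quotMap π Φ hΦ ≫ quotDesc π Φ hΦ g hg g₀ hg₀ = g := by
  refine LogScheme.hom_ext hg₀ fun U V h w w' a => ?_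
  have w₁ : h ≫ U.p = (V.p ≫ π) ≫ g₀ := by rw [Category.assoc]; exact w
  refine (LogScheme.comp_map (quotMap π Φ hΦ) (quotDesc π Φ hΦ g hg g₀ hg₀) (U := U)
    (W := U.pb g₀) h w (U.pbLift g₀ h (V.p ≫ π) w₁) (U.pbLift_p _ _ _ _) (U.pbFst g₀)
    (U.pb_cond g₀) (U.pbLift_fst _ _ _ _) a).trans ?_
  let W : Et T := U.pb g₀
  let l : V.S ⟶ W.S := U.pbLift g₀ h (V.p ≫ π) w₁
  have wl : l ≫ W.p = V.p ≫ π := U.pbLift_p _ _ _ _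
  have e : W.pbLift π l V.p wl ≫ W.pbFst π ≫ U.pbFst g₀ = h := by
    rw [W.pbLift_fst_assoc, U.pbLift_fst]
  refine (g.log.res_map (W.pbFst π ≫ U.pbFst g₀) (quotDesc_w π g g₀ hg₀ _ (U.pb_cond g₀))
    (W.pbLift π l V.p wl) (W.pbLift_p _ _ _ _) (by rw [e]; exact w') a).trans ?_
  exact LogScheme.map_congr rfl e _ _ _

end Quot

lemma YShift_πLog (b : ℕ+) (n : ℤ) : YShift b n ≫ πLog b = πLog b :=
  comp_quotMap (Y := YLog b) πY (YShift b) shiftY_πY (YShift_zero b) (YShift_YShift b) n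

lemma πLog_TPt (b : ℕ+) : πLog b ≫ TPt b = YPt b :=
  quotMap_quotDesc (Y := YLog b) πY (YShift b 1) (shiftY_πY 1) (YPt b) (YShift_YPt b 1) strT πY_strT

lemma πY_sT (b : ℕ+) : (πLog b).base ≫ sT b = sY b := by
  have h := AffineSpace.map_comp (n := PUnit.{1}) πX strE
  rw [πX_strE] at h
  exact h.symm

/-! ### Lifts of log corals are log corals -/

/-- Asymptotic parallelism may be tested étale locally. -/
lemma IsParallelAt.of_restrict {b : ℕ+} {C : LogScheme} {τ : C ⟶ logPoint} {g : C ⟶ YLog b}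
    (V : Et C.X) {ζ : specRat ⟶ V.S}
    (h : IsParallelAt b (C.restrictHom V ≫ τ) ζ (C.restrictHom V ≫ g)) :
    IsParallelAt b τ (ζ ≫ V.p) g := by
  have hV : (C.restrictHom V).base = V.p := rfl
  have e : ζ ≫ (C.restrictHom V ≫ g).base ≫ toX₀ = (ζ ≫ V.p) ≫ g.base ≫ toX₀ := by
    rw [LogScheme.comp_base, hV]
    exact (congrArg (ζ ≫ ·) (Category.assoc V.p g.base toX₀)).trans (Category.assoc _ _ _).symm
  refine ⟨fun v k hk => h.1 v k (hk.trans e.symm), fun j k hk h0 h1 => ?_⟩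
  obtain ⟨W, ξ, U, l, wl, m, wm, φx, φy, α, β, hξ, hα, hβ, hαβ, hx, hy, hval⟩ :=
    h.2 j k (hk.trans e.symm) h0 h1
  -- The étale neighbourhood of the restriction is used as one of `C`; the restricted log structure
  -- has the same sections over it, so all data carry over.
  let W' : Et C.X := Et.push V.p W
  have wl' : l ≫ U.p = W'.p ≫ g.base := wl.trans (Category.assoc W.p V.p g.base).symm
  have hmap : ∀ a, (C.restrictHom V ≫ g).log.map (U := U) (V := W) l wl a =
      g.log.map (U := U) (V := W') l wl' a := fun a =>
    (LogScheme.comp_map (C.restrictHom V) g (U := U) (W := W') (V := W) l wl (𝟙 W.S)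
      (Category.id_comp _) l wl' (Category.id_comp _) a).trans (C.L.res_id W' _)
  have hu : ∀ φ : Γ(W.S, ⊤)ˣ, (C.restrict V).L.unitSec (V := W) φ = C.L.unitSec (V := W') φ :=
    fun φ => C.L.eq_unitSec (V := W') φ _ ((C.restrict V).L.α_unitSec (V := W) φ)
  have ht : tSec (C.restrictHom V ≫ τ) W = tSec τ W' :=
    (LogScheme.comp_map (C.restrictHom V) τ (U := Et.self logPoint.X) (W := W') (V := W) _ _ (𝟙 W.S)
      (Category.id_comp _) (W'.p ≫ τ.base) (Category.comp_id _)
      (by rw [Category.id_comp]; exact Category.assoc _ _ _) _).trans (C.L.res_id W' _)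
  have hx' := (hmap _).symm.trans (hx.trans (congrArg₂ (· * ·) (hu φx) (congrArg (· ^ α) ht)))
  have hy' := (hmap _).symm.trans (hy.trans (congrArg₂ (· * ·) (hu φy) (congrArg (· ^ β) ht)))
  exact ⟨W', ξ, U, l, wl', m, wm, φx, φy, α, β, by rw [← hξ]; exact (Category.assoc _ _ _).symm,
    hα, hβ, hαβ, hx', hy', hval⟩

/-- The conditions on `s` and on the base depend only on the composite with the quotient map, and an
automorphism compatible with `g` is compatible with `f`, so stability is inherited. -/
lemma IsCoralT.isCoralY {b : ℕ+} {D : MarkedCurve} {f : D.C ⟶ TLog b} (hf : IsCoralT b D f)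
    {g : D.C ⟶ YLog b} (hg : g ≫ πLog b = f) : IsCoralY b D g := by
  have hs : g.base ≫ sY b = f.base ≫ sT b := by
    rw [← hg, ← πY_sT]
    exact (Category.assoc _ _ _).symm
  exact
  { over_pt := by rw [← πLog_TPt, ← Category.assoc, hg, hf.over_pt]
    affine := hf.affine
    dominant := fun C' h => by
      rw [hs]
      exact hf.dominant C' h
    marked := fun i => by
      rw [hs]
      exact hf.marked i
    stable := hf.stable.subset fun φ hφ => ⟨hφ.1, hφ.2.1, by rw [← hg, ← Category.assoc, hφ.2.2]⟩
    parallel := fun C' h a => by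
      -- The global lift `g` is itself an étale local lift of `f`, over the trivial étale
      -- neighbourhood.
      have h1 := hf.parallel C' h a (Et.self D.C.X) (D.genPt a) (Category.comp_id _)
        (D.C.restrictHom _ ≫ g) (by rw [Category.assoc, hg])
      have h2 := h1.of_restrict
      have e : D.genPt a ≫ (Et.self D.C.X).p = D.genPt a := Category.comp_id _
      exact e ▸ h2 }

/-! ### Fibre products with strict étale morphisms -/

namespace LogScheme

variable {C Y T : LogScheme} {g : Y ⟶ T} (hg : IsStrictEtale g) (f : C ⟶ T)

/-- The source of an étale morphism, as an object of the small étale site. -/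
abbrev IsStrictEtale.toEt : Et T.X := @Et.mk _ Y.X g.base hg.etale

/-- The projection of the fibre product to the source of a strict étale morphism. -/
def IsStrictEtale.pbFst : C.restrict (hg.toEt.pb f.base) ⟶ Y :=
  hg.lift (C.restrictHom (hg.toEt.pb f.base) ≫ f) (hg.toEt.pbFst f.base) (hg.toEt.pb_cond f.base)

/-- The fibre product with a strict étale morphism. -/
lemma IsStrictEtale.isPullback :
    IsPullback (C.restrictHom (hg.toEt.pb f.base)) (hg.pbFst f) f g := by
  have hq := isStrictEtale_restrictHom C (hg.toEt.pb f.base)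
  have hF : hg.pbFst f ≫ g = C.restrictHom (hg.toEt.pb f.base) ≫ f := hg.lift_comp _ _ _
  -- Both projections to be controlled, to `C` and to `Y`, are compared through strict étale
  -- morphisms, so existence and uniqueness reduce to the fibre product of schemes.
  refine .of_isLimit' ⟨hF.symm⟩ (PullbackCone.IsLimit.mk _
    (fun s => hq.lift s.fst (hg.toEt.pbLift f.base s.snd.base s.fst.base
      (congrArg Hom.base s.condition).symm) (hg.toEt.pbLift_p _ _ _ _))
    (fun s => hq.lift_comp _ _ _) (fun s => hg.hom_ext ?_ ?_) (fun s m h₁ h₂ => hq.hom_ext ?_ ?_))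
  · exact hg.toEt.pbLift_fst _ _ _ _
  · rw [Category.assoc, hF, ← Category.assoc]
    exact (congrArg (· ≫ f) (hq.lift_comp _ _ _)).trans s.condition
  · apply hg.toEt.pb_ext
    · exact (congrArg Hom.base h₂).trans (hg.toEt.pbLift_fst _ _ _ _).symm
    · exact (congrArg Hom.base h₁).trans (hg.toEt.pbLift_p _ _ _ _).symm
  · exact h₁.trans (hq.lift_comp _ _ _).symm

end LogScheme

/-! ### The sheets of the covering -/

section Sheets

variable {b : ℕ+} {C : LogScheme} (f : C ⟶ YLog b)

/-- The pull-back of the covering to `C`. -/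
abbrev coverEt : Et C.X := (isStrictEtale_πLog b).toEt.pb (f ≫ πLog b).base

/-- The projection of the pull-back to the covering. -/
abbrev coverFst : (coverEt f).S ⟶ Y₀ := (isStrictEtale_πLog b).toEt.pbFst (f ≫ πLog b).base

/-- The pull-back of the covering to `C`, as a log scheme. -/
abbrev coverLog : LogScheme := C.restrict (coverEt f)

lemma sheet_w (n : ℤ) : (f.base ≫ shiftY n) ≫ πY = 𝟙 C.X ≫ (f ≫ πLog b).base :=
  (comp_shiftY_πY f.base n).trans (Category.id_comp _).symm

/-- The underlying morphism of the section of the covering given by a translate of `f`. -/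
def sheetBase (n : ℤ) : C.X ⟶ (coverEt f).S :=
  (isStrictEtale_πLog b).toEt.pbLift (f ≫ πLog b).base (f.base ≫ shiftY n) (𝟙 C.X) (sheet_w f n)

lemma sheetBase_fst (n : ℤ) : sheetBase f n ≫ coverFst f = f.base ≫ shiftY n :=
  Et.pbLift_fst _ _ _ _ _

lemma sheetBase_p (n : ℤ) : sheetBase f n ≫ (coverEt f).p = 𝟙 C.X := Et.pbLift_p _ _ _ _ _

/-- The section of the covering given by a translate of `f`. -/
def sheet (n : ℤ) : C ⟶ coverLog f :=
  (LogScheme.isStrictEtale_restrictHom C (coverEt f)).lift (𝟙 C) (sheetBase f n) (sheetBase_p f n)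

lemma sheet_restrictHom (n : ℤ) : sheet f n ≫ C.restrictHom (coverEt f) = 𝟙 C :=
  LogScheme.IsStrictEtale.lift_comp _ _ _ _

lemma sheet_pbFst (n : ℤ) :
    sheet f n ≫ (isStrictEtale_πLog b).pbFst (f ≫ πLog b) = f ≫ YShift b n := by
  refine (isStrictEtale_πLog b).hom_ext (sheetBase_fst f n) ?_
  rw [Category.assoc, Category.assoc, YShift_πLog]
  refine (congrArg (sheet f n ≫ ·) (LogScheme.IsStrictEtale.lift_comp _ _ _ _)).trans ?_
  rw [← Category.assoc, sheet_restrictHom, Category.id_comp]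

lemma isStrictEtale_sheet (n : ℤ) : LogScheme.IsStrictEtale (sheet f n) := by
  refine (LogScheme.isStrictEtale_restrictHom C (coverEt f)).of_comp ?_
  rw [sheet_restrictHom]
  exact LogScheme.isStrictEtale_id C

/-- A section of an étale morphism is étale and a monomorphism, hence an open immersion. -/
instance isOpenImmersion_sheetBase (n : ℤ) : IsOpenImmersion (sheetBase f n) := by
  have : Etale (sheetBase f n) := (isStrictEtale_sheet f n).etale
  have : Mono (sheetBase f n) := (⟨⟨_, sheetBase_p f n⟩⟩ : IsSplitMono _).mono
  exact IsOpenImmersion.of_flat_of_mono _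

/-- The pull-back of the covering is the disjoint union of its sheets. -/
lemma isDisjointUnion_sheet : IsDisjointUnion (sheet f) where
  openImm n := isOpenImmersion_sheetBase f n
  strict n V hV := (isStrictEtale_sheet f n).bij_of_eq V _ hV _
  disjoint m n hmn := Set.disjoint_left.2 <| by
    -- The projection to `C` identifies the two points of `C`; the projection to `Y₀` then shows two
    -- translates of one point to be equal, against freeness.
    rintro _ ⟨c, rfl⟩ ⟨c', hc⟩
    have hc : sheetBase f n c' = sheetBase f m c := hc
    have h1 := congrArg (coverEt f).p hc
    rw [← Scheme.Hom.comp_apply, ← Scheme.Hom.comp_apply, sheetBase_p, sheetBase_p] at h1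
    obtain rfl : c' = c := h1
    have h2 := congrArg (coverFst f) hc
    rw [← Scheme.Hom.comp_apply, ← Scheme.Hom.comp_apply, sheetBase_fst, sheetBase_fst] at h2
    exact hmn (comp_shiftY_inj h2).symm
  cover p := by
    let p : (coverEt f).S := p
    have e : ((coverEt f).p ≫ f.base) ≫ πY = coverFst f ≫ πY :=
      (Category.assoc _ _ _).trans (Et.pb_cond _ _).symm
    -- On the pull-back there are two lifts of one morphism, the projection to `Y₀` and the
    -- composite with `f`. Where they differ by the translation by `n`, the inclusion factors
    -- through the sheet `n`.
    obtain ⟨n, O, hp, h⟩ := locally_shiftY ((coverEt f).p ≫ f.base) (coverFst f) e p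
    have h1 : O.ι = O.ι ≫ (coverEt f).p ≫ sheetBase f n := by
      refine Et.pb_ext _ _ ?_ ?_
      · refine h.trans ?_
        simp only [Category.assoc]
        exact congrArg (fun k => O.ι ≫ (coverEt f).p ≫ k) (sheetBase_fst f n).symm
      · rw [Category.assoc, Category.assoc]
        refine Eq.trans ?_ (congrArg (fun k => O.ι ≫ (coverEt f).p ≫ k) (sheetBase_p f n)).symm
        exact (congrArg (O.ι ≫ ·) (Category.comp_id _)).symm
    obtain ⟨u, hu⟩ : ∃ u : O.toScheme, O.ι u = p := ⟨⟨p, hp⟩, rfl⟩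
    refine ⟨n, (coverEt f).p p, ?_⟩
    have h2 := congrArg (fun k => k u) h1
    simp only [Scheme.Hom.comp_apply, hu] at h2
    exact h2.symm

/-- Two lifts of a morphism from a connected log scheme differ by a unique translation. -/
lemma existsUnique_shift [ConnectedSpace C.X] {g : C ⟶ YLog b} (h : g ≫ πLog b = f ≫ πLog b) :
    ∃! n : ℤ, g = f ≫ YShift b n := by
  have hb : g.base ≫ πY = f.base ≫ πY := congrArg LogScheme.Hom.base h
  obtain ⟨n, hn⟩ := exists_shiftY hb.symm
  refine ⟨n, (isStrictEtale_πLog b).hom_ext hn ?_, fun m hm => ?_⟩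
  · rw [h, Category.assoc, YShift_πLog]
  · obtain ⟨c⟩ := ‹ConnectedSpace C.X›.toNonempty
    exact comp_shiftY_inj (congrArg (fun k => k c) ((congrArg LogScheme.Hom.base hm).symm.trans hn))

end Sheets

/-- A log coral on the degenerate Tate curve whose domain is rational lifts to the covering. -/
lemma IsCoralT.exists_lift {b : ℕ+} {D : MarkedCurve} (hD : D.IsRational) {f : D.C ⟶ TLog b}
    (hf : IsCoralT b D f) : ∃ g : D.C ⟶ YLog b, g ≫ πLog b = f := by
  -- The lift to the chain and the given morphism to `T₀` together define a morphism to `Y₀`;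
  -- strictness of the quotient map supplies its log part.
  obtain ⟨s, hs⟩ := MarkedCurve.exists_lift hD hf.affine (f.base ≫ toE)
  exact ⟨(isStrictEtale_πLog b).lift f (isPullback_πY.lift f.base s hs.symm)
    (isPullback_πY.lift_fst _ _ _), LogScheme.IsStrictEtale.lift_comp _ _ _ _⟩

end

end TateCoral

/-- Once one lift `f` exists, the fibre product is the étale fibre product with the restricted log
structure, the maps `σ n` are its sheets, and every other lift is compared with `f` on the connected
curve. -/
theorem mainTheorem12 (b : ℕ+) (D : TateCoral.MarkedCurve) (hD : D.IsRational)
    (f' : D.C ⟶ TateCoral.TLog b) (hf' : TateCoral.IsCoralT b D f') :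
    ∃ f : D.C ⟶ TateCoral.YLog b, TateCoral.IsCoralY b D f ∧ f ≫ TateCoral.πLog b = f' ∧
      (∃ (P : TateCoral.LogScheme) (q : P ⟶ D.C) (F : P ⟶ TateCoral.YLog b) (σ : ℤ → (D.C ⟶ P)),
        IsPullback q F f' (TateCoral.πLog b) ∧ TateCoral.IsDisjointUnion σ ∧
          ∀ n : ℤ, σ n ≫ q = 𝟙 D.C ∧ σ n ≫ F = f ≫ TateCoral.YShift b n) ∧
      ∀ g : D.C ⟶ TateCoral.YLog b, g ≫ TateCoral.πLog b = f' →
        TateCoral.IsCoralY b D g ∧ ∃! n : ℤ, g = f ≫ TateCoral.YShift b n := by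
  obtain ⟨f, rfl⟩ := hf'.exists_lift hD
  have := D.connected
  refine ⟨f, hf'.isCoralY rfl, rfl, ⟨TateCoral.coverLog f, _, _, TateCoral.sheet f,
    (TateCoral.isStrictEtale_πLog b).isPullback (f ≫ TateCoral.πLog b),
    TateCoral.isDisjointUnion_sheet f, fun n =>
      ⟨TateCoral.sheet_restrictHom f n, TateCoral.sheet_pbFst f n⟩⟩,
    fun g hg => ⟨hf'.isCoralY hg, TateCoral.existsUnique_shift f hg⟩⟩
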